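/- A cell is a pair of integers, regarded as a point of the Euclidean plane, and the king graph of size $n \times n$ has vertex set $A = \{0, 1, \ldots, n-1\}^2$, two distinct cells $(x', y')$ and $(x'', y'')$ being adjacent if and only if $|x' - x''| \le 1$ and $|y' - y''| \le 1$. A snake cycle in a graph $G$ is a cycle of $G$, understood as a subgraph (without starting vertex or direction), which is also an induced subgraph of $G$; its length is its number of edges. A symmetry of $A$ is the restriction to $A$ of an isometry of the plane which preserves $A$. A subgraph is asymmetric if the identity is the only symmetry of $A$ which maps it onto itself, and two subgraphs are essentially distinct if no symmetry of $A$ maps one onto the other. Let $n$ be a positive integer with $n \equiv 0 \pmod 4$ and $n \ge 8$. Then the greatest length of a snake cycle in the king graph of size $n \times n$ is $n^2/2 - 1$. Furthermore, for all such $n$, there are exactly $48$ snake cycles which attain this greatest length. These cycles are all asymmetric, and exactly six of them are essentially distinct, that is, they form exactly six classes under the symmetries of $A$. -/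

import Mathlib

/-- A subgraph of `G` is a cycle when it is finite, connected (in particular nonempty), and every
one of its vertices has exactly two neighbours in it. Thus a cycle is a subgraph, not a sequence of
vertices: it has no distinguished starting vertex or direction. -/
def IsCycleSubgraph {V : Type*} {G : SimpleGraph V} (C : G.Subgraph) : Prop :=
  C.verts.Finite ∧ C.Connected ∧ ∀ v ∈ C.verts, (C.neighborSet v).ncard = 2

/-- A snake cycle in `G` is a cycle in `G` which is also an induced subgraph of `G`. -/
def IsSnakeCycle {V : Type*} {G : SimpleGraph V} (C : G.Subgraph) : Prop :=
  IsCycleSubgraph C ∧ C.IsInduced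

/-- The length of a cycle is the number of its edges. -/
noncomputable def cycleLength {V : Type*} {G : SimpleGraph V} (C : G.Subgraph) : ℕ :=
  C.edgeSet.ncard

/-- The snake cycles of the greatest length. -/
def IsLongestSnakeCycle {V : Type*} {G : SimpleGraph V} (C : G.Subgraph) : Prop :=
  IsSnakeCycle C ∧ ∀ D : G.Subgraph, IsSnakeCycle D → cycleLength D ≤ cycleLength C

/-- The king graph on a set `S` of cells: two distinct cells are adjacent when they differ by at
most one in each coordinate. -/
def kingGraph (S : Set (ℤ × ℤ)) : SimpleGraph S where
  Adj a b := a ≠ b ∧ |a.1.1 - b.1.1| ≤ 1 ∧ |a.1.2 - b.1.2| ≤ 1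
  symm := ⟨fun a b h =>
    ⟨h.1.symm, by rw [abs_sub_comm]; exact h.2.1, by rw [abs_sub_comm]; exact h.2.2⟩⟩
  loopless := ⟨fun _ h => h.1 rfl⟩

/-- The standard board with `m` rows and `n` columns. -/
def standardBoard (m n : ℕ) : Set (ℤ × ℤ) :=
  Set.Ico (0 : ℤ) n ×ˢ Set.Ico (0 : ℤ) m

/-- A cell as a point of the Euclidean plane. -/
noncomputable def cellPoint (a : ℤ × ℤ) : EuclideanSpace ℝ (Fin 2) :=
  !₂[(a.1 : ℝ), (a.2 : ℝ)]

/-- A permutation of a set of cells is a symmetry of that set when it is the restriction of an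
isometry of the Euclidean plane. -/
def IsBoardSymmetry {A : Set (ℤ × ℤ)} (σ : Equiv.Perm A) : Prop :=
  ∃ f : EuclideanSpace ℝ (Fin 2) ≃ᵢ EuclideanSpace ℝ (Fin 2),
    ∀ a : A, f (cellPoint a) = cellPoint (σ a)

/-- The permutation `σ` of the vertices carries the subgraph `C` onto the subgraph `D`. -/
def CarriesOnto {V : Type*} {G : SimpleGraph V} (σ : Equiv.Perm V) (C D : G.Subgraph) : Prop :=
  (∀ v, σ v ∈ D.verts ↔ v ∈ C.verts) ∧ ∀ v w, D.Adj (σ v) (σ w) ↔ C.Adj v w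

/-- A subgraph of the king graph on `A` is asymmetric when only the identity symmetry of `A`
carries it onto itself. -/
def IsAsymmetric {A : Set (ℤ × ℤ)} (C : (kingGraph A).Subgraph) : Prop :=
  ∀ σ : Equiv.Perm A, IsBoardSymmetry σ → CarriesOnto σ C C → σ = 1

/-- Two subgraphs of the king graph on `A` are equivalent when some symmetry of `A` carries one
onto the other; they are essentially distinct when they are not equivalent. -/
def symmetrySetoid (A : Set (ℤ × ℤ)) : Setoid (kingGraph A).Subgraph where
  r C D := ∃ σ : Equiv.Perm A, IsBoardSymmetry σ ∧ CarriesOnto σ C D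
  iseqv :=
    { refl := fun _ => ⟨1, ⟨IsometryEquiv.refl _, fun _ => rfl⟩, fun _ => Iff.rfl,
        fun _ _ => Iff.rfl⟩
      symm := by
        rintro C D ⟨σ, ⟨f, hf⟩, hv, ha⟩
        refine ⟨σ.symm, ⟨f.symm, fun a => ?_⟩, fun v => ?_, fun v w => ?_⟩
        · rw [IsometryEquiv.symm_apply_eq, hf, Equiv.apply_symm_apply]
        · rw [← hv, Equiv.apply_symm_apply]
        · rw [← ha, Equiv.apply_symm_apply, Equiv.apply_symm_apply]
      trans := by
        rintro C D E ⟨σ, ⟨f, hf⟩, hv, ha⟩ ⟨τ, ⟨g, hg⟩, hw, hb⟩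
        refine ⟨τ * σ, ⟨f.trans g, fun a => ?_⟩, fun v => ?_, fun v w => ?_⟩
        · rw [IsometryEquiv.trans_apply, hf, hg, Equiv.Perm.mul_apply]
        · rw [Equiv.Perm.mul_apply, hw, hv]
        · rw [Equiv.Perm.mul_apply, Equiv.Perm.mul_apply, hb, ha] }

/-- The longest snake cycles in the king graph on `A`, up to the symmetries of `A`. -/
def EssentialLongestSnakeCycles (A : Set (ℤ × ℤ)) : Type :=
  Quotient ((symmetrySetoid A).comap
    (Subtype.val : {C : (kingGraph A).Subgraph // IsLongestSnakeCycle C} → (kingGraph A).Subgraph))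

/-! Write n = 2k and cut the board into k² aligned 2 × 2 blocks. A block is a clique, so a snake
cycle with three cells in it is a triangle; any longer one has at most two cells per block, hence
length at most 2k². If every border block held two cells, each line across the border strip of width
two would hold exactly one cell. A strip cell next to the inner board would then find both its
neighbours along the strip, so nothing would join the strip to the inner board, against
connectedness (`Snake.border_not_full`). Hence the bound 2k² - 1, and in a cycle attaining it
exactly one block is defective: it holds one cell and lies on the border.

A symmetry moves the defect to the side x = 0, with its cell in the left column of the block
(`TopDefect`). Degree counts, propagated along the third and fourth rows from the inner corners,
force the defective block to be (0, 1) (`TopDefect.eq_one`) and, for k ≥ 6, fix the cells where the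
border path enters the inner board (`TopDefect.entry`). Contracting the border path to the cell (0,
1) of the inner board (`peel`) gives a cycle of the same kind on the board of side 2(k - 2).
Conversely, a cycle on the smaller board can be opened at that cell and surrounded by a border path
(`wrap`). The two operations are inverse provided the border path is forced to be straight, which
`Tight` ensures; a wrapped board is always tight, so tightness has to be checked only for k = 4.
Thus the number of these standard cycles is the same for all even k ≥ 4, and for k = 4 a direct
analysis gives six (`standard_four`).

The eight symmetries carry the block (0, 1) to eight different blocks (`act_eq_act`). Hence the 8 ·
6 images are distinct, no extremal cycle has a nontrivial symmetry, and the standard cycles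
represent the six classes. What remains is the translation between subgraphs and indicator
functions, and the fact that a symmetry of the board is one of the eight obvious maps
(`IsBoardSymmetry.exists_move`). -/

/-! ### Indicator functions of snake cycles, blocks and border strips -/

/-- The sum of the values of `s` at the eight king neighbours of a cell. -/
def kingSum (s : ℤ → ℤ → ℤ) (x y : ℤ) : ℤ :=
  s (x - 1) (y - 1) + s (x - 1) y + s (x - 1) (y + 1) + s x (y - 1) + s x (y + 1) +
    s (x + 1) (y - 1) + s (x + 1) y + s (x + 1) (y + 1)

/-- A predicate that is inherited by the king neighbours within the support of `s`. -/
def KingClosed (s : ℤ → ℤ → ℤ) (T : ℤ → ℤ → Prop) : Prop :=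
  ∀ x y x' y', s x y = 1 → s x' y' = 1 → x' - x ≤ 1 → x - x' ≤ 1 → y' - y ≤ 1 → y - y' ≤ 1 →
    T x y → T x' y'

/-- `s` is the indicator function of the vertex set of a snake cycle on the board of side `2 * k`,
other than a triangle. -/
structure Snake (k : ℤ) (s : ℤ → ℤ → ℤ) : Prop where
  val : ∀ x y, s x y = 0 ∨ s x y = 1
  out : ∀ x y, ¬(0 ≤ x ∧ x < 2 * k ∧ 0 ≤ y ∧ y < 2 * k) → s x y = 0
  deg : ∀ x y, s x y = 1 → kingSum s x y = 2
  win : ∀ x y, s x y + s x (y + 1) + s (x + 1) y + s (x + 1) (y + 1) ≤ 2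
  conn : ∀ T, KingClosed s T → ∀ x y x' y', s x y = 1 → s x' y' = 1 → T x y → T x' y'

/-- The number of cells in the aligned two by two block with index `(i, j)`. -/
def blk (s : ℤ → ℤ → ℤ) (i j : ℤ) : ℤ :=
  s (2 * i) (2 * j) + s (2 * i) (2 * j + 1) + s (2 * i + 1) (2 * j) + s (2 * i + 1) (2 * j + 1)

def reflX (k : ℤ) (s : ℤ → ℤ → ℤ) : ℤ → ℤ → ℤ := fun x y => s (2 * k - 1 - x) y

def reflY (k : ℤ) (s : ℤ → ℤ → ℤ) : ℤ → ℤ → ℤ := fun x y => s x (2 * k - 1 - y)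

def transp (s : ℤ → ℤ → ℤ) : ℤ → ℤ → ℤ := fun x y => s y x

namespace Snake

variable {k : ℤ} {s : ℤ → ℤ → ℤ}

theorem transp (H : Snake k s) : Snake k (transp s) where
  val x y := H.val y x
  out x y h := H.out y x (by tauto)
  deg x y h := by
    have := H.deg y x h
    simp only [kingSum, _root_.transp] at this ⊢
    omega
  win x y := by
    have := H.win y x
    simp only [_root_.transp] at this ⊢
    omega
  conn T hT x y x' y' h h' t := by
    refine H.conn (fun a b => T b a) ?_ y x y' x' h h' t
    intro a b a' b' h1 h2 h3 h4 h5 h6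
    exact hT b a b' a' h1 h2 h5 h6 h3 h4

theorem reflX (H : Snake k s) : Snake k (reflX k s) where
  val x y := H.val _ y
  out x y h := H.out _ y (by omega)
  deg x y h := by
    have := H.deg _ y h
    simp only [kingSum, _root_.reflX] at this ⊢
    rw [show 2 * k - 1 - (x - 1) = 2 * k - 1 - x + 1 by ring,
      show 2 * k - 1 - (x + 1) = 2 * k - 1 - x - 1 by ring]
    omega
  win x y := by
    have := H.win (2 * k - 1 - x - 1) y
    simp only [_root_.reflX]
    rw [show 2 * k - 1 - x - 1 + 1 = 2 * k - 1 - x by ring] at this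
    rw [show 2 * k - 1 - (x + 1) = 2 * k - 1 - x - 1 by ring]
    omega
  conn T hT x y x' y' h h' t := by
    have := H.conn (fun a b => T (2 * k - 1 - a) b) ?_ (2 * k - 1 - x) y (2 * k - 1 - x') y' h h'
      (by simpa using t)
    · simpa using this
    · intro a b a' b' h1 h2 h3 h4 h5 h6
      refine hT (2 * k - 1 - a) b (2 * k - 1 - a') b' ?_ ?_ (by omega) (by omega) h5 h6 <;>
        simpa [_root_.reflX]

theorem reflY (H : Snake k s) : Snake k (reflY k s) :=
  H.transp.reflX.transp

theorem nonneg (H : Snake k s) (x y : ℤ) : 0 ≤ s x y := by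
  have := H.val x y
  omega

theorem le_one (H : Snake k s) (x y : ℤ) : s x y ≤ 1 := by
  have := H.val x y
  omega

theorem inside (H : Snake k s) {x y : ℤ} (h : s x y = 1) :
    0 ≤ x ∧ x < 2 * k ∧ 0 ≤ y ∧ y < 2 * k := by
  by_contra h'
  have := H.out x y h'
  omega

theorem deg_at (H : Snake k s) (x₀ x₁ x₂ y₀ y₁ y₂ : ℤ) (h : s x₁ y₁ = 1)
    (hx : x₀ + 1 = x₁ := by omega) (hx' : x₁ + 1 = x₂ := by omega)
    (hy : y₀ + 1 = y₁ := by omega) (hy' : y₁ + 1 = y₂ := by omega) :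
    s x₀ y₀ + s x₀ y₁ + s x₀ y₂ + s x₁ y₀ + s x₁ y₂ + s x₂ y₀ + s x₂ y₁ + s x₂ y₂ = 2 := by
  have := H.deg x₁ y₁ h
  subst hx' hy'
  obtain rfl : x₀ = x₁ - 1 := by omega
  obtain rfl : y₀ = y₁ - 1 := by omega
  exact this

theorem win_at (H : Snake k s) (x₀ x₁ y₀ y₁ : ℤ) (hx : x₀ + 1 = x₁ := by omega)
    (hy : y₀ + 1 = y₁ := by omega) : s x₀ y₀ + s x₀ y₁ + s x₁ y₀ + s x₁ y₁ ≤ 2 := by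
  subst hx hy
  exact H.win _ _

theorem _root_.blk_at {s : ℤ → ℤ → ℤ} (x₀ x₁ y₀ y₁ i j b : ℤ) (h : blk s i j = b) (hx : 2 * i = x₀ := by omega)
    (hx' : x₀ + 1 = x₁ := by omega) (hy : 2 * j = y₀ := by omega)
    (hy' : y₀ + 1 = y₁ := by omega) : s x₀ y₀ + s x₀ y₁ + s x₁ y₀ + s x₁ y₁ = b := by
  subst hx hx' hy hy'
  exact h

theorem out_left (H : Snake k s) (x y : ℤ) (h : x < 0 := by omega) : s x y = 0 :=
  H.out x y (by omega)

theorem out_bot (H : Snake k s) (x y : ℤ) (h : y < 0 := by omega) : s x y = 0 :=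
  H.out x y (by omega)

/-- If both cells were occupied, the windows on either side would have no room for a third cell, and
`(0, c)` would have only one neighbour. -/
theorem strip_le_one (H : Snake k s) (c : ℤ) : s 0 c + s 1 c ≤ 1 := by
  by_contra hc
  have v0 := H.val 0 c
  have v1 := H.val 1 c
  have h0 : s 0 c = 1 := by omega
  have := H.deg_at (-1) 0 1 (c - 1) c (c + 1) h0
  have := H.win_at 0 1 (c - 1) c
  have := H.win_at 0 1 c (c + 1)
  have := H.out_left (-1) (c - 1)
  have := H.out_left (-1) c
  have := H.out_left (-1) (c + 1)
  omega

theorem strip_of_blk (H : Snake k s) {j : ℤ} (h : blk s 0 j = 2) :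
    s 0 (2 * j) + s 1 (2 * j) = 1 ∧ s 0 (2 * j + 1) + s 1 (2 * j + 1) = 1 := by
  have := H.strip_le_one (2 * j)
  have := H.strip_le_one (2 * j + 1)
  have := blk_at 0 1 (2 * j) (2 * j + 1) 0 j 2 h
  omega

theorem strip_eq_one (H : Snake k s) (c : ℤ) (h : blk s 0 (c / 2) = 2) : s 0 c + s 1 c = 1 := by
  have := H.strip_of_blk h
  rcases (by omega : c = 2 * (c / 2) ∨ c = 2 * (c / 2) + 1) with h' | h' <;> rw [h'] <;> tauto

/-- The strip bounds in both directions put the two cells on a diagonal of the block. All neighbours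
of `(0, 0)` lie in the block, so it would have only one neighbour there. -/
theorem corner (H : Snake k s) (h : blk s 0 0 = 2) :
    s 0 0 = 0 ∧ s 1 1 = 0 ∧ s 0 1 = 1 ∧ s 1 0 = 1 := by
  have h1 := blk_at 0 1 0 1 0 0 2 h
  have a := H.strip_le_one 0
  have b := H.strip_le_one 1
  have c := H.transp.strip_le_one 0
  have d := H.transp.strip_le_one 1
  simp only [_root_.transp] at c d
  have v0 := H.val 0 0
  have v1 := H.val 1 0
  have v2 := H.val 0 1
  have v3 := H.val 1 1
  rcases v0 with v0 | v0
  · omega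
  have := H.deg_at (-1) 0 1 (-1) 0 1 v0
  have := H.out_left (-1) (-1)
  have := H.out_left (-1) 0
  have := H.out_left (-1) 1
  have := H.out_bot 0 (-1)
  have := H.out_bot 1 (-1)
  omega

/-- A cell of the second row whose two sideways columns are occupied is not joined to the third
row. -/
theorem no_cross (H : Snake k s) {c d : ℤ} (h1 : s 1 c = 1) (h2 : s 2 d = 1) (hd : d - c ≤ 1)
    (hd' : c - d ≤ 1) (hl : s 0 (c - 1) + s 1 (c - 1) = 1) (hr : s 0 (c + 1) + s 1 (c + 1) = 1) :
    False := by
  -- The two sideways columns already supply both neighbours of `(1, c)`.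
  have := H.deg_at 0 1 2 (c - 1) c (c + 1) h1
  have := H.nonneg 2 (c - 1)
  have := H.nonneg 2 c
  have := H.nonneg 2 (c + 1)
  have := H.nonneg 0 c
  rcases (by omega : d = c - 1 ∨ d = c ∨ d = c + 1) with rfl | rfl | rfl <;> omega

end Snake

/-! ### The border strip cannot be full -/

/-- The cell `(x, y)` lies in the inner board, at distance at least two from the edge. -/
def InnerCell (k x y : ℤ) : Prop := 2 ≤ x ∧ x < 2 * k - 2 ∧ 2 ≤ y ∧ y < 2 * k - 2

theorem blk_reflX (k : ℤ) (s : ℤ → ℤ → ℤ) (i j : ℤ) : blk (reflX k s) i j = blk s (k - 1 - i) j := by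
  simp only [blk, reflX]
  rw [show 2 * k - 1 - 2 * i = 2 * (k - 1 - i) + 1 by ring,
    show 2 * k - 1 - (2 * i + 1) = 2 * (k - 1 - i) by ring]
  ring

theorem blk_transp (s : ℤ → ℤ → ℤ) (i j : ℤ) : blk (transp s) i j = blk s j i := by
  simp only [blk, transp]
  ring

theorem blk_reflY (k : ℤ) (s : ℤ → ℤ → ℤ) (i j : ℤ) : blk (reflY k s) i j = blk s i (k - 1 - j) := by
  have := blk_reflX k (transp s) j i
  rw [blk_transp] at this
  rw [← this, ← blk_transp]
  rfl

namespace Snake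

variable {k : ℤ} {s : ℤ → ℤ → ℤ}

/-- The border and the inner board cannot both be occupied without being joined. -/
theorem exists_cross (H : Snake k s) {a b a' b' : ℤ} (hab : s a b = 1) (hI : ¬InnerCell k a b)
    (hab' : s a' b' = 1) (hI' : InnerCell k a' b')
    (h : ∀ x y x' y', s x y = 1 → s x' y' = 1 → x' - x ≤ 1 → x - x' ≤ 1 → y' - y ≤ 1 →
      y - y' ≤ 1 → ¬InnerCell k x y → InnerCell k x' y' → False) : False :=
  H.conn (fun x y => ¬InnerCell k x y)
    (fun x y x' y' h1 h2 h3 h4 h5 h6 hb hi => h x y x' y' h1 h2 h3 h4 h5 h6 hb hi)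
    a b a' b' hab hab' hI hI'

/-- The four border strips of the board, apart from the one along `x = 0`. -/
structure Sides (k : ℤ) (s : ℤ → ℤ → ℤ) : Prop where
  left : ∀ i, 0 < i → i < k → blk s i 0 = 2
  right : ∀ i, 0 < i → i < k → blk s i (k - 1) = 2
  bottom : ∀ j, 0 ≤ j → j < k → blk s (k - 1) j = 2
  -- The line `x = 1` is listed separately because the corner blocks on the side `x = 0` may be
  -- defective, while the crossing argument at `x = 2` needs the sums on both sides of it.
  left_one : s 1 0 + s 1 1 = 1
  right_one : s 1 (2 * k - 1) + s 1 (2 * k - 2) = 1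

theorem left_sum (H : Snake k s) (S : Sides k s) (x : ℤ) (h : 1 ≤ x) (h' : x < 2 * k) :
    s x 0 + s x 1 = 1 := by
  rcases h.eq_or_lt with rfl | h
  · exact S.left_one
  exact H.transp.strip_eq_one x (by rw [blk_transp]; exact S.left _ (by omega) (by omega))

theorem right_sum (H : Snake k s) (S : Sides k s) (x : ℤ) (h : 1 ≤ x) (h' : x < 2 * k) :
    s x (2 * k - 1) + s x (2 * k - 2) = 1 := by
  rcases h.eq_or_lt with rfl | h
  · exact S.right_one
  have := H.reflY.transp.strip_eq_one x (by
    rw [blk_transp, blk_reflY]; simpa using S.right _ (by omega) (by omega))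
  simp only [_root_.transp, _root_.reflY, sub_zero, sub_sub] at this
  exact this

theorem bottom_sum (H : Snake k s) (S : Sides k s) (y : ℤ) (h : 0 ≤ y) (h' : y < 2 * k) :
    s (2 * k - 1) y + s (2 * k - 2) y = 1 := by
  have := H.reflX.strip_eq_one y (by
    rw [blk_reflX]; simpa using S.bottom _ (by omega) (by omega))
  simp only [_root_.reflX, sub_zero, sub_sub] at this
  exact this

theorem no_cross_left (H : Snake k s) (S : Sides k s) {x c : ℤ} (hx : 2 ≤ x) (hx' : x < 2 * k - 1)
    (h1 : s x 1 = 1) (h2 : s c 2 = 1) (h : c - x ≤ 1) (h' : x - c ≤ 1) : False :=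
  H.transp.no_cross h1 h2 h h' (H.left_sum S (x - 1) (by omega) (by omega))
    (H.left_sum S (x + 1) (by omega) (by omega))

theorem no_cross_right (H : Snake k s) (S : Sides k s) {x c : ℤ} (hx : 2 ≤ x)
    (hx' : x < 2 * k - 1) (h1 : s x (2 * k - 2) = 1) (h2 : s c (2 * k - 3) = 1) (h : c - x ≤ 1)
    (h' : x - c ≤ 1) : False := by
  have e (t : ℤ) : _root_.reflY k s t 0 = s t (2 * k - 1) ∧
      _root_.reflY k s t 1 = s t (2 * k - 2) ∧ _root_.reflY k s t 2 = s t (2 * k - 3) := by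
    refine ⟨?_, ?_, ?_⟩ <;> simp only [_root_.reflY] <;> congr 1 <;> ring
  refine H.reflY.transp.no_cross (c := x) (d := c) ?_ ?_ h h' ?_ ?_ <;>
    simp only [_root_.transp, e, h1, h2]
  · exact H.right_sum S (x - 1) (by omega) (by omega)
  · exact H.right_sum S (x + 1) (by omega) (by omega)

theorem no_cross_bottom (H : Snake k s) (S : Sides k s) {y d : ℤ} (hy : 1 ≤ y)
    (hy' : y < 2 * k - 1) (h1 : s (2 * k - 2) y = 1) (h2 : s (2 * k - 3) d = 1) (h : d - y ≤ 1)
    (h' : y - d ≤ 1) : False := by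
  have e (t : ℤ) : _root_.reflX k s 0 t = s (2 * k - 1) t ∧
      _root_.reflX k s 1 t = s (2 * k - 2) t ∧ _root_.reflX k s 2 t = s (2 * k - 3) t := by
    refine ⟨?_, ?_, ?_⟩ <;> simp only [_root_.reflX] <;> congr 1 <;> ring
  refine H.reflX.no_cross (c := y) (d := d) ?_ ?_ h h' ?_ ?_ <;>
    simp only [e, h1, h2]
  · exact H.bottom_sum S (y - 1) (by omega) (by omega)
  · exact H.bottom_sum S (y + 1) (by omega) (by omega)

/-- All adjacencies between the border and the inner board cross the side `x = 0`. -/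
theorem cross_top (H : Snake k s) (S : Sides k s) {x y x' y' : ℤ} (h : s x y = 1)
    (h' : s x' y' = 1) (hx : x' - x ≤ 1) (hx' : x - x' ≤ 1) (hy : y' - y ≤ 1) (hy' : y - y' ≤ 1)
    (hb : ¬InnerCell k x y) (hi : InnerCell k x' y') :
    x = 1 ∧ x' = 2 ∧ ¬(s 0 (y - 1) + s 1 (y - 1) = 1 ∧ s 0 (y + 1) + s 1 (y + 1) = 1) := by
  obtain ⟨i1, i2, i3, i4⟩ := H.inside h
  simp only [InnerCell] at hb hi
  by_cases c1 : x ≤ 1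
  · obtain rfl : x = 1 := by omega
    obtain rfl : x' = 2 := by omega
    exact ⟨rfl, rfl, fun c => H.no_cross h h' hy hy' c.1 c.2⟩
  exfalso
  by_cases c2 : x < 2 * k - 2
  · by_cases c3 : y ≤ 1
    · obtain rfl : y = 1 := by omega
      obtain rfl : y' = 2 := by omega
      exact H.no_cross_left S (by omega) (by omega) h h' hx hx'
    · obtain rfl : y = 2 * k - 2 := by omega
      obtain rfl : y' = 2 * k - 3 := by omega
      exact H.no_cross_right S (by omega) (by omega) h h' hx hx'
  · obtain rfl : x = 2 * k - 2 := by omega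
    obtain rfl : x' = 2 * k - 3 := by omega
    exact H.no_cross_bottom S (by omega) (by omega) h h' hy hy'

/-- If every border block holds two cells, then the border is closed up. -/
theorem border_not_full (H : Snake k s) (hk : 3 ≤ k) (hin : 1 ≤ blk s 1 1)
    (h : ∀ i j, 0 ≤ i → i < k → 0 ≤ j → j < k → (i = 0 ∨ i = k - 1 ∨ j = 0 ∨ j = k - 1) →
      blk s i j = 2) : False := by
  obtain ⟨-, -, h01, h10⟩ := H.corner (h 0 0 le_rfl (by omega) le_rfl (by omega) (by omega))
  have c2 := H.reflY.corner (by
    rw [blk_reflY]; exact h _ _ (by omega) (by omega) (by omega) (by omega) (by omega))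
  have top (y : ℤ) (h0 : 0 ≤ y) (h1 : y < 2 * k) : s 0 y + s 1 y = 1 :=
    H.strip_eq_one y (h _ _ (by omega) (by omega) (by omega) (by omega) (by omega))
  have l1 := H.transp.strip_eq_one 1 (by
    rw [blk_transp]; exact h _ _ (by omega) (by omega) (by omega) (by omega) (by omega))
  have r1 := H.reflY.transp.strip_eq_one 1 (by
    rw [blk_transp, blk_reflY]
    exact h _ _ (by omega) (by omega) (by omega) (by omega) (by omega))
  have S : Sides k s := by
    refine ⟨?_, ?_, ?_, ?_, ?_⟩
    · exact fun i hi hi' => h _ _ (by omega) (by omega) (by omega) (by omega) (by omega)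
    · exact fun i hi hi' => h _ _ (by omega) (by omega) (by omega) (by omega) (by omega)
    · exact fun i hi hi' => h _ _ (by omega) (by omega) (by omega) (by omega) (by omega)
    · simpa only [_root_.transp] using l1
    · simp only [_root_.transp, _root_.reflY, sub_zero, sub_sub] at r1
      exact r1
  have : ∃ a b, s a b = 1 ∧ InnerCell k a b := by
    by_contra! hno
    have e := blk_at 2 3 2 3 1 1 _ rfl (s := s)
    have h1 (a b : ℤ) (hab : InnerCell k a b) : s a b = 0 :=
      (H.val a b).resolve_right fun h => hno a b h hab
    rw [h1 2 2 (by simp [InnerCell]; omega), h1 2 3 (by simp [InnerCell]; omega),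
      h1 3 2 (by simp [InnerCell]; omega), h1 3 3 (by simp [InnerCell]; omega)] at e
    omega
  obtain ⟨a, b, hab, hI⟩ := this
  refine H.exists_cross h01 (by simp [InnerCell]) hab hI ?_
  intro x y x' y' h1 h2 h3 h4 h5 h6 hb hi
  obtain ⟨rfl, rfl, hn⟩ := H.cross_top S h1 h2 h3 h4 h5 h6 hb hi
  simp only [InnerCell] at hi
  exact hn ⟨top _ (by omega) (by omega), top _ (by omega) (by omega)⟩

end Snake

/-! ### The position of the defective block on the side `x = 0` -/

/-- A snake cycle all of whose blocks hold two cells, except for the block `(0, q)` which holds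
only one, in its left column. -/
structure TopDefect (k q : ℤ) (s : ℤ → ℤ → ℤ) : Prop where
  snake : Snake k s
  four_le : 4 ≤ k
  nonneg : 0 ≤ q
  lt : q < k
  good : ∀ i j, 0 ≤ i → i < k → 0 ≤ j → j < k → (i ≠ 0 ∨ j ≠ q) → blk s i j = 2
  colL : s 0 (2 * q) + s 1 (2 * q) = 1
  colR : s 0 (2 * q + 1) + s 1 (2 * q + 1) = 0

namespace TopDefect

variable {k q : ℤ} {s : ℤ → ℤ → ℤ}

theorem top_sum (D : TopDefect k q s) (c : ℤ) (h : 0 ≤ c) (h' : c < 2 * k) (hc : c ≠ 2 * q + 1) :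
    s 0 c + s 1 c = 1 := by
  by_cases h1 : c = 2 * q
  · rw [h1]; exact D.colL
  · have := D.four_le
    exact D.snake.strip_eq_one c (D.good _ _ (by omega) (by omega) (by omega) (by omega) (by omega))

theorem gap (D : TopDefect k q s) : s 0 (2 * q + 1) = 0 ∧ s 1 (2 * q + 1) = 0 := by
  have := D.colR
  have := D.snake.nonneg 0 (2 * q + 1)
  have := D.snake.nonneg 1 (2 * q + 1)
  omega

/-- In the corner, the cell of column `0` would have too few neighbours: `(0, 0)` none, and `(1, 0)`
at most one of `(2, 0)` and `(2, 1)`, by the strip bound along `y = 0`. -/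
theorem pos (D : TopDefect k q s) : 0 < q := by
  by_contra hq
  obtain rfl : q = 0 := by linarith [D.nonneg]
  have g := D.gap
  have cl := D.colL
  norm_num at g cl
  have H := D.snake
  have o1 := H.out_left (-1) (-1)
  have o2 := H.out_left (-1) 0
  have o3 := H.out_left (-1) 1
  have o4 := H.out_bot 0 (-1)
  have o5 := H.out_bot 1 (-1)
  have o6 := H.out_bot 2 (-1)
  rcases H.val 0 0 with h | h
  · have h1 : s 1 0 = 1 := by omega
    have := H.deg_at 0 1 2 (-1) 0 1 h1
    have t := H.transp.strip_le_one 2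
    simp only [transp] at t
    omega
  · have := H.deg_at (-1) 0 1 (-1) 0 1 h
    omega

theorem corner_left (D : TopDefect k q s) : s 0 0 = 0 ∧ s 1 1 = 0 ∧ s 0 1 = 1 ∧ s 1 0 = 1 :=
  D.snake.corner (D.good _ _ le_rfl (by linarith [D.four_le]) le_rfl (by linarith [D.four_le])
    (Or.inr D.pos.ne))

/-- Since column `2q + 1` is empty in the strip, a cell at `(0, 2q)` would have only one neighbour,
in column `2q - 1`. -/
theorem lower_left (D : TopDefect k q s) : s 1 (2 * q) = 1 ∧ s 0 (2 * q) = 0 := by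
  have H := D.snake
  have cl := D.colL
  have := H.val 0 (2 * q)
  have := D.pos
  have := D.lt
  have := D.gap
  have : s 0 (2 * q) ≠ 1 := by
    intro h
    have := H.deg_at (-1) 0 1 (2 * q - 1) (2 * q) (2 * q + 1) h
    have := D.top_sum (2 * q - 1) (by omega) (by omega) (by omega)
    have := H.out_left (-1) (2 * q - 1)
    have := H.out_left (-1) (2 * q)
    have := H.out_left (-1) (2 * q + 1)
    omega
  omega

theorem right_one (D : TopDefect k q s) : s 1 (2 * k - 1) + s 1 (2 * k - 2) = 1 := by
  by_cases h : q = k - 1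
  · have := D.lower_left
    have := D.gap
    rw [h, show 2 * (k - 1) = 2 * k - 2 by ring] at *
    rw [show 2 * k - 2 + 1 = 2 * k - 1 by ring] at *
    omega
  · have := D.four_le
    have h2 := D.snake.reflY.corner (by
      rw [blk_reflY]; exact D.good _ _ (by omega) (by omega) (by omega) (by omega) (by omega))
    simp only [reflY, sub_zero, sub_sub] at h2
    norm_num at h2
    omega

theorem sides (D : TopDefect k q s) : Snake.Sides k s where
  left i h h' := D.good _ _ (by omega) (by omega) (by omega) (by omega) (by omega)
  right i h h' := D.good _ _ (by omega) (by omega) (by omega) (by omega) (by omega)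
  bottom j h h' := by
    have := D.four_le
    exact D.good _ _ (by omega) (by omega) (by omega) (by omega) (by omega)
  left_one := by
    have := D.corner_left
    omega
  right_one := D.right_one

/-- The full block `(1, 1)` provides two inner cells, of which at most one is excluded. -/
theorem exists_inner (D : TopDefect k q s) (c d : ℤ) :
    ∃ a b, s a b = 1 ∧ InnerCell k a b ∧ ¬(a = c ∧ b = d) := by
  have := D.four_le
  by_contra! hno
  have e := blk_at 2 3 2 3 1 1 _ (D.good 1 1 (by omega) (by omega) (by omega) (by omega) (by omega))
  have h1 (a b : ℤ) (hab : InnerCell k a b) (hne : ¬(a = c ∧ b = d)) : s a b = 0 :=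
    (D.snake.val a b).resolve_right fun h => hne (hno a b h hab)
  have n (a b : ℤ) := D.snake.le_one a b
  have := n 2 2
  have := n 2 3
  have := n 3 2
  have := n 3 3
  have e2 := h1 2 2 (by simp [InnerCell]; omega)
  have e3 := h1 2 3 (by simp [InnerCell]; omega)
  have e4 := h1 3 2 (by simp [InnerCell]; omega)
  have e5 := h1 3 3 (by simp [InnerCell]; omega)
  omega

/-- With the defect in the last block, the only possible crossing is from `(1, 2q)` to `(2, 2q -
1)`. But `(1, 2q)` already has a neighbour in column `2q - 1` of the top strip and one in row `2` of
the right strip. -/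
theorem lt_pred (D : TopDefect k q s) : q < k - 1 := by
  by_contra hq
  have := D.lt
  obtain rfl : k = q + 1 := by omega
  have H := D.snake
  have h4 := D.four_le
  obtain ⟨a, b, hab, hI, -⟩ := D.exists_inner 0 0
  refine H.exists_cross D.corner_left.2.2.1 (by simp [InnerCell]) hab hI ?_
  intro x y x' y' h1 h2 h3 h4 h5 h6 hb hi
  obtain ⟨rfl, rfl, hn⟩ := H.cross_top D.sides h1 h2 h3 h4 h5 h6 hb hi
  simp only [InnerCell] at hi
  by_cases hy : y = 2 * q
  · subst hy
    obtain rfl : y' = 2 * q - 1 := by omega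
    have := H.deg_at 0 1 2 (2 * q - 1) (2 * q) (2 * q + 1) h1
    have := D.top_sum (2 * q - 1) (by omega) (by omega) (by omega)
    have := H.right_sum D.sides 2 (by omega) (by omega)
    rw [show 2 * (q + 1) - 1 = 2 * q + 1 by ring, show 2 * (q + 1) - 2 = 2 * q by ring] at this
    have := D.gap
    have := D.lower_left
    omega
  · exact hn ⟨D.top_sum _ (by omega) (by omega) (by omega),
      D.top_sum _ (by omega) (by omega) (by omega)⟩

theorem lower_right (D : TopDefect k q s) : s 1 (2 * q + 2) = 1 ∧ s 0 (2 * q + 2) = 0 := by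
  have H := D.snake
  have := D.pos
  have := D.lt_pred
  have cl := D.top_sum (2 * q + 2) (by omega) (by omega) (by omega)
  have := H.val 0 (2 * q + 2)
  have := D.gap
  have : s 0 (2 * q + 2) ≠ 1 := by
    intro h
    have := H.deg_at (-1) 0 1 (2 * q + 1) (2 * q + 2) (2 * q + 3) h
    have := D.top_sum (2 * q + 3) (by omega) (by omega) (by omega)
    have := H.out_left (-1) (2 * q + 1)
    have := H.out_left (-1) (2 * q + 2)
    have := H.out_left (-1) (2 * q + 3)
    omega
  omega

theorem corner_right (D : TopDefect k q s) : s 0 (2 * k - 2) = 1 ∧ s 1 (2 * k - 1) = 1 ∧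
    s 0 (2 * k - 1) = 0 ∧ s 1 (2 * k - 2) = 0 := by
  have := D.four_le
  have := D.lt_pred
  have h2 := D.snake.reflY.corner (by
    rw [blk_reflY]; exact D.good _ _ (by omega) (by omega) (by omega) (by omega) (by omega))
  simp only [reflY, sub_zero, sub_sub] at h2
  norm_num at h2
  tauto

/-- For `q = k - 2` the corner pattern would occupy `(0, 2q + 2)`, against `lower_right`. -/
theorem le_sub_three (D : TopDefect k q s) : q ≤ k - 3 := by
  by_contra hq
  have := D.lt_pred
  obtain rfl : k = q + 2 := by omega
  have h1 := D.corner_right.1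
  rw [show 2 * (q + 2) - 2 = 2 * q + 2 by ring] at h1
  have := D.lower_right
  omega

/-- The only border cells that may be joined to the inner board. -/
theorem cross (D : TopDefect k q s) {x y x' y' : ℤ} (h : s x y = 1)
    (h' : s x' y' = 1) (hx : x' - x ≤ 1) (hx' : x - x' ≤ 1) (hy : y' - y ≤ 1) (hy' : y - y' ≤ 1)
    (hb : ¬InnerCell k x y) (hi : InnerCell k x' y') :
    x = 1 ∧ x' = 2 ∧ (y = 2 * q ∨ y = 2 * q + 2) := by
  obtain ⟨rfl, rfl, hn⟩ := D.snake.cross_top D.sides h h' hx hx' hy hy' hb hi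
  refine ⟨rfl, rfl, ?_⟩
  by_contra! hc
  simp only [InnerCell] at hi
  exact hn ⟨D.top_sum _ (by omega) (by omega) (by omega),
      D.top_sum _ (by omega) (by omega) (by omega)⟩

/-- An occupied `(2, 2q + 1)` would be adjacent to both gates `(1, 2q)` and `(1, 2q + 2)` and close
up the border path, cutting it off from every other inner cell. -/
theorem below_gap (D : TopDefect k q s) : s 2 (2 * q + 1) = 0 := by
  by_contra h0
  have H := D.snake
  have hm : s 2 (2 * q + 1) = 1 := (H.val _ _).resolve_left h0
  obtain ⟨a, b, hab, hI, hne⟩ := D.exists_inner 2 (2 * q + 1)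
  have q0 := D.pos
  have q3 := D.le_sub_three
  have g := D.gap
  have ll := D.lower_left
  have lr := D.lower_right
  have tl := D.top_sum (2 * q - 1) (by omega) (by omega) (by omega)
  have tr := D.top_sum (2 * q + 3) (by omega) (by omega) (by omega)
  have nn := H.nonneg
  have key := H.conn (fun x y => ¬InnerCell k x y ∨ (x = 2 ∧ y = 2 * q + 1)) ?_ 1 (2 * q) a b ll.1
    hab (Or.inl (by simp [InnerCell]))
  · tauto
  intro x y x' y' h1 h2 h3 h4 h5 h6 hT
  by_cases hI' : InnerCell k x' y'
  · right
    rcases hT with hb | ⟨rfl, rfl⟩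
    · obtain ⟨rfl, rfl, rfl | rfl⟩ := D.cross h1 h2 h3 h4 h5 h6 hb hI'
      · have := H.deg_at 0 1 2 (2 * q - 1) (2 * q) (2 * q + 1) h1
        have := nn 2 (2 * q - 1)
        have := nn 2 (2 * q)
        rcases (by omega : y' = 2 * q - 1 ∨ y' = 2 * q ∨ y' = 2 * q + 1) with rfl | rfl | rfl <;>
          omega
      · have := H.deg_at 0 1 2 (2 * q + 1) (2 * q + 2) (2 * q + 3) h1
        have := nn 2 (2 * q + 3)
        have := nn 2 (2 * q + 2)
        rcases (by omega : y' = 2 * q + 1 ∨ y' = 2 * q + 2 ∨ y' = 2 * q + 3) with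
          rfl | rfl | rfl <;> omega
    · by_contra hc
      have := H.deg_at 1 2 3 (2 * q) (2 * q + 1) (2 * q + 2) h1
      simp only [InnerCell] at hI'
      have := nn 2 (2 * q)
      have := nn 2 (2 * q + 2)
      have := nn 3 (2 * q)
      have := nn 3 (2 * q + 1)
      have := nn 3 (2 * q + 2)
      rcases (by omega : x' = 2 ∨ x' = 3) with rfl | rfl <;>
      rcases (by omega : y' = 2 * q ∨ y' = 2 * q + 1 ∨ y' = 2 * q + 2) with
          rfl | rfl | rfl <;> omega
  · exact Or.inl hI'

theorem exit_left (D : TopDefect k q s) : s 2 (2 * q - 1) + s 2 (2 * q) = 1 := by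
  have q0 := D.pos
  have q3 := D.le_sub_three
  have g := D.gap
  have ll := D.lower_left
  have := D.below_gap
  have tl := D.top_sum (2 * q - 1) (by omega) (by omega) (by omega)
  have := D.snake.deg_at 0 1 2 (2 * q - 1) (2 * q) (2 * q + 1) ll.1
  omega

theorem exit_right (D : TopDefect k q s) : s 2 (2 * q + 2) + s 2 (2 * q + 3) = 1 := by
  have q0 := D.pos
  have q3 := D.le_sub_three
  have g := D.gap
  have ll := D.lower_right
  have := D.below_gap
  have tl := D.top_sum (2 * q + 3) (by omega) (by omega) (by omega)
  have := D.snake.deg_at 0 1 2 (2 * q + 1) (2 * q + 2) (2 * q + 3) ll.1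
  omega

/-- A cell at `(1, 2q + 3)` would have three neighbours: `(1, 2q + 2)`, one in column `2q + 4`, and
the cell counted by `exit_right`. -/
theorem upper_right (D : TopDefect k q s) : s 0 (2 * q + 3) = 1 ∧ s 1 (2 * q + 3) = 0 := by
  have H := D.snake
  have q0 := D.pos
  have q3 := D.le_sub_three
  have tl := D.top_sum (2 * q + 3) (by omega) (by omega) (by omega)
  have tl' := D.top_sum (2 * q + 4) (by omega) (by omega) (by omega)
  have ll := D.lower_right
  have e := D.exit_right
  rcases H.val 1 (2 * q + 3) with h | h
  · omega
  have := H.deg_at 0 1 2 (2 * q + 2) (2 * q + 3) (2 * q + 4) h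
  have := H.nonneg 2 (2 * q + 4)
  omega

/-- Two such cells would exhaust the block `(1, 1)`. For `2 ≤ q` the gates lie in columns `4` and
beyond, so `(2, 2)` has no border neighbour and would be left with only one neighbour. -/
theorem inner_corner (D : TopDefect k q s) (hq : 2 ≤ q) : s 2 2 + s 3 2 ≤ 1 := by
  have H := D.snake
  have q3 := D.le_sub_three
  by_contra hc
  have v1 := H.val 2 2
  have v2 := H.val 3 2
  have h : s 2 2 = 1 := by omega
  have d := H.deg_at 1 2 3 1 2 3 h
  have e := blk_at 2 3 2 3 1 1 _ (D.good 1 1 (by omega) (by omega) (by omega) (by omega) (by omega))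
  have n1 := H.nonneg 2 3
  have n2 := H.nonneg 3 3
  have z (a b : ℤ) (hb : ¬InnerCell k a b) (ha : 2 - a ≤ 1) (ha' : a - 2 ≤ 1) (hb1 : 2 - b ≤ 1)
      (hb2 : b - 2 ≤ 1) : s a b = 0 := by
    refine (H.val a b).resolve_right fun h1 => ?_
    have := D.cross h1 h ha ha' hb1 hb2 hb (by simp [InnerCell]; omega)
    omega
  rw [z 1 1, z 1 2, z 1 3, z 2 1, z 3 1] at d
  · omega
  all_goals simp [InnerCell]

/-- The bound propagates to the right: a full block with at most one cell in its even column has one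
in its odd column, and the window shared with the next even column then leaves room for only one
there. -/
theorem inner_col_le (D : TopDefect k q s) (hq : 2 ≤ q) (j : ℕ) (hj : (j : ℤ) + 2 < k) :
    s 2 (2 * (j + 1)) + s 3 (2 * (j + 1)) ≤ 1 := by
  induction j with
  | zero => simpa using D.inner_corner hq
  | succ m ih =>
    push_cast at hj ⊢
    have ih := ih (by omega)
    have e := blk_at 2 3 (2 * (m + 1)) (2 * (m + 1) + 1) 1 (m + 1) _
      (D.good 1 (m + 1) (by omega) (by omega) (by omega) (by omega) (by omega))
    have w := D.snake.win_at 2 3 (2 * ((m : ℤ) + 1) + 1) (2 * (m + 1 + 1))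
    omega

/-- For `2 ≤ q` the column bounds and `below_gap` leave exactly one cell of rows `2` and `3` in each
of the columns `2q - 2` to `2q + 1`. The cell through which the path leaves the gate `(1, 2q)` then
has three neighbours. -/
theorem eq_one (D : TopDefect k q s) : q = 1 := by
  have H := D.snake
  have q3 := D.le_sub_three
  have q0 := D.pos
  by_contra hq
  have hq : 2 ≤ q := by omega
  have c1 := D.inner_col_le hq (q - 1).toNat (by omega)
  have c2 := D.inner_col_le hq (q - 2).toNat (by omega)
  rw [show ((q - 1).toNat : ℤ) + 1 = q by omega] at c1
  rw [show 2 * (((q - 2).toNat : ℤ) + 1) = 2 * q - 2 by omega] at c2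
  have e1 := blk_at 2 3 (2 * q) (2 * q + 1) 1 q _
      (D.good 1 q (by omega) (by omega) (by omega) (by omega) (by omega))
  have e2 := blk_at 2 3 (2 * q - 2) (2 * q - 1) 1 (q - 1) _
      (D.good 1 (q - 1) (by omega) (by omega) (by omega) (by omega) (by omega))
  have w := H.win_at 2 3 (2 * q - 1) (2 * q)
  have b := D.below_gap
  have ll := D.lower_left
  have e := D.exit_left
  have v0 := H.val 2 (2 * q)
  have n1 := H.nonneg 3 (2 * q - 1)
  have n2 := H.le_one 3 (2 * q)
  have n3 := H.le_one 3 (2 * q + 1)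
  have n (a b : ℤ) := H.nonneg a b
  -- If the exit is `(2, 2q - 1)`, its neighbours include `(1, 2q)`, `(3, 2q)` and a cell of column
  -- `2q - 2`. If it is `(2, 2q)`, they include `(1, 2q)`, `(3, 2q - 1)` and `(3, 2q + 1)`.
  rcases v0 with h | h
  · have h1 : s 2 (2 * q - 1) = 1 := by omega
    have := H.deg_at 1 2 3 (2 * q - 2) (2 * q - 1) (2 * q) h1
    have := n 1 (2 * q - 2)
    have := n 1 (2 * q - 1)
    omega
  · have := H.deg_at 1 2 3 (2 * q - 1) (2 * q) (2 * q + 1) h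
    have := n 1 (2 * q - 1)
    have := n 1 (2 * q + 1)
    have := n 3 (2 * q)
    omega

end TopDefect

/-! ### The cells around the opening -/

namespace TopDefect

variable {k : ℤ} {s : ℤ → ℤ → ℤ}

theorem row_zero (D : TopDefect k 1 s) :
    s 0 0 = 0 ∧ s 0 1 = 1 ∧ s 0 2 = 0 ∧ s 0 3 = 0 ∧ s 0 4 = 0 ∧ s 0 5 = 1 := by
  have a := D.corner_left
  have b := D.lower_left
  have c := D.gap
  have d := D.lower_right
  have e := D.upper_right
  norm_num at b c d e
  tauto

theorem row_one (D : TopDefect k 1 s) :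
    s 1 0 = 1 ∧ s 1 1 = 0 ∧ s 1 2 = 1 ∧ s 1 3 = 0 ∧ s 1 4 = 1 ∧ s 1 5 = 0 := by
  have a := D.corner_left
  have b := D.lower_left
  have c := D.gap
  have d := D.lower_right
  have e := D.upper_right
  norm_num at b c d e
  tauto

/-- The left gate exits to `(2, 1)` or `(2, 2)`, and `(2, 1)` would have three neighbours: `(1, 0)`,
`(1, 2)` and a cell of row `3` in the left strip. -/
theorem row_two (D : TopDefect k 1 s) :
    s 2 0 = 1 ∧ s 2 1 = 0 ∧ s 2 2 = 1 ∧ s 2 3 = 0 ∧ s 2 4 + s 2 5 = 1 := by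
  have H := D.snake
  have h4 := D.four_le
  have a := D.below_gap
  have b := D.exit_left
  have c := D.exit_right
  norm_num at a b c
  have l1 := H.left_sum D.sides 1 (by omega) (by omega)
  have l2 := H.left_sum D.sides 2 (by omega) (by omega)
  have l3 := H.left_sum D.sides 3 (by omega) (by omega)
  have r := D.row_one
  rcases H.val 2 1 with h | h
  · omega
  have := H.deg_at 1 2 3 0 1 2 h
  have := H.nonneg 3 2
  omega

/-- Mirror image of `inner_corner`: the gates, now in columns `2` and `4`, are far from the right
corner. -/
theorem inner_corner_right (D : TopDefect k 1 s) (hk : 6 ≤ k) :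
    s 2 (2 * k - 3) + s 3 (2 * k - 3) ≤ 1 := by
  have H := D.snake
  by_contra hc
  have v1 := H.val 2 (2 * k - 3)
  have v2 := H.val 3 (2 * k - 3)
  have h : s 2 (2 * k - 3) = 1 := by omega
  have d := H.deg_at 1 2 3 (2 * k - 4) (2 * k - 3) (2 * k - 2) h
  have e := blk_at 2 3 (2 * k - 4) (2 * k - 3) 1 (k - 2) _
    (D.good 1 (k - 2) (by omega) (by omega) (by omega) (by omega) (by omega))
  have n1 := H.nonneg 2 (2 * k - 4)
  have n2 := H.nonneg 3 (2 * k - 4)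
  have z (a b : ℤ) (hb : ¬InnerCell k a b) (ha : 2 - a ≤ 1) (ha' : a - 2 ≤ 1)
      (hb1 : 2 * k - 3 - b ≤ 1) (hb2 : b - (2 * k - 3) ≤ 1) : s a b = 0 := by
    refine (H.val a b).resolve_right fun h1 => ?_
    have := D.cross h1 h ha ha' hb1 hb2 hb (by simp [InnerCell]; omega)
    omega
  rw [z 1 (2 * k - 4), z 1 (2 * k - 3), z 1 (2 * k - 2), z 2 (2 * k - 2), z 3 (2 * k - 2)] at d
  · omega
  all_goals first | omega | simp [InnerCell]

theorem inner_odd_col_le (D : TopDefect k 1 s) (hk : 6 ≤ k) (j : ℕ) (hj : (j : ℤ) + 2 < k) :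
    s 2 (2 * (k - 2 - j) + 1) + s 3 (2 * (k - 2 - j) + 1) ≤ 1 := by
  induction j with
  | zero =>
    have := D.inner_corner_right hk
    rw [show 2 * (k - 2 - ((0 : ℕ) : ℤ)) + 1 = 2 * k - 3 by push_cast; ring]
    exact this
  | succ m ih =>
    push_cast at hj ⊢
    have ih := ih (by omega)
    have e := blk_at 2 3 (2 * (k - 2 - m)) (2 * (k - 2 - m) + 1) 1 (k - 2 - m) _
      (D.good 1 (k - 2 - m) (by omega) (by omega) (by omega) (by omega) (by omega))
    have w := D.snake.win_at 2 3 (2 * (k - 2 - (m + 1 : ℤ)) + 1) (2 * (k - 2 - (m : ℤ)))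
    omega

/-- The cells of the third and fourth rows next to the two ends of the border path. -/
theorem entry (D : TopDefect k 1 s) (hk : 6 ≤ k) :
    s 3 2 = 1 ∧ s 3 3 = 0 ∧ s 2 4 = 1 ∧ s 2 5 = 0 ∧ s 3 4 + s 3 5 = 1 := by
  have H := D.snake
  have r1 := D.row_one
  have r2 := D.row_two
  have c3 := D.inner_odd_col_le hk (k - 3).toNat (by omega)
  have c5 := D.inner_odd_col_le hk (k - 4).toNat (by omega)
  -- Bounding column `7` puts a cell into column `6`; it serves as the third neighbour of `(2, 5)`
  -- in `d5`.
  have c7 := D.inner_odd_col_le hk (k - 5).toNat (by omega)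
  rw [show 2 * (k - 2 - ((k - 3).toNat : ℤ)) + 1 = 3 by omega] at c3
  rw [show 2 * (k - 2 - ((k - 4).toNat : ℤ)) + 1 = 5 by omega] at c5
  rw [show 2 * (k - 2 - ((k - 5).toNat : ℤ)) + 1 = 7 by omega] at c7
  have e1 := blk_at 2 3 2 3 1 1 _
    (D.good 1 1 (by omega) (by omega) (by omega) (by omega) (by omega))
  have e2 := blk_at 2 3 4 5 1 2 _
    (D.good 1 2 (by omega) (by omega) (by omega) (by omega) (by omega))
  have e3 := blk_at 2 3 6 7 1 3 _
    (D.good 1 3 (by omega) (by omega) (by omega) (by omega) (by omega))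
  have w1 := H.win_at 2 3 3 4
  have w2 := H.win_at 2 3 5 6
  have n := H.nonneg
  have n33 := H.val 3 3
  have n24 := H.val 2 4
  have n34 := H.val 3 4
  have n35 := H.val 3 5
  have d5 : ¬(s 2 5 = 1 ∧ s 3 4 = 1) := by
    rintro ⟨h, h'⟩
    have := H.deg_at 1 2 3 4 5 6 h
    have := n 1 5
    have := n 1 6
    have := n 2 4
    have := n 3 5
    omega
  have d4 : ¬(s 2 4 = 1 ∧ s 3 3 = 1 ∧ s 3 5 = 1) := by
    rintro ⟨h, h1, h2⟩
    have := H.deg_at 1 2 3 3 4 5 h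
    have := n 1 3
    have := n 1 5
    have := n 3 4
    omega
  omega

end TopDefect

/-! ### Peeling off the border path -/

open Classical in
/-- Removal of the border path, whose two ends are joined up at the cell `(0, 1)` of the inner
board. -/
noncomputable def peel (k : ℤ) (s : ℤ → ℤ → ℤ) : ℤ → ℤ → ℤ := fun x y =>
  if InnerCell k (x + 2) (y + 2) then
    -- If the path went on from `(2, 4)` to `(3, 5)`, which becomes `(1, 3)`, it would be out of
    -- reach of `(0, 1)`; the value `s 3 5` at `(0, 2)` provides the link. In the end this value is
    -- shown to be `0`.
    if x = 0 ∧ y = 0 then 0 else if x = 0 ∧ y = 1 then 1 else if x = 0 ∧ y = 2 then s 3 5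
    else s (x + 2) (y + 2)
  else 0

namespace TopDefect

variable {k : ℤ} {s : ℤ → ℤ → ℤ}

theorem peel_border {x y : ℤ} (h : ¬InnerCell k (x + 2) (y + 2)) : peel k s x y = 0 := by
  simp [peel, h]

theorem peel_zero_zero : peel k s 0 0 = 0 := by
  simp [peel]

theorem peel_zero_one (hk : 6 ≤ k) : peel k s 0 1 = 1 := by
  have : InnerCell k 2 3 := by simp [InnerCell]; omega
  simp [peel, this]

theorem peel_zero_two (hk : 6 ≤ k) : peel k s 0 2 = s 3 5 := by
  have : InnerCell k 2 4 := by simp [InnerCell]; omega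
  simp [peel, this]

theorem peel_far {x y : ℤ} (h : InnerCell k (x + 2) (y + 2)) (h' : ¬(x = 0 ∧ 0 ≤ y ∧ y ≤ 2)) :
    peel k s x y = s (x + 2) (y + 2) := by
  rw [peel, if_pos h, if_neg (by omega), if_neg (by omega), if_neg (by omega)]

/-- Only `(0, 1)` can be a new cell: `(0, 2)` comes from `(2, 4)`, which is occupied. -/
theorem peel_le (D : TopDefect k 1 s) (hk : 6 ≤ k) {x y : ℤ} (h : ¬(x = 0 ∧ y = 1)) :
    peel k s x y ≤ s (x + 2) (y + 2) := by
  have n := D.snake.nonneg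
  by_cases hI : InnerCell k (x + 2) (y + 2)
  · by_cases h' : x = 0 ∧ 0 ≤ y ∧ y ≤ 2
    · obtain ⟨rfl, h1, h2⟩ := h'
      rcases (by omega : y = 0 ∨ y = 2) with rfl | rfl
      · rw [peel_zero_zero]; exact n _ _
      · rw [peel_zero_two hk]
        have := D.entry hk
        norm_num
        rw [this.2.2.1]
        exact D.snake.le_one _ _
    · rw [peel_far hI h']
  · rw [peel_border hI]; exact n _ _

theorem peel_val (D : TopDefect k 1 s) (x y : ℤ) : peel k s x y = 0 ∨ peel k s x y = 1 := by
  have := D.snake.val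
  simp only [peel]
  split_ifs <;> simp [this]

theorem border_zero (D : TopDefect k 1 s) {x y a b : ℤ} (h : s x y = 1)
    (hI : InnerCell k x y) (hx : x - a ≤ 1) (hx' : a - x ≤ 1) (hy : y - b ≤ 1)
    (hy' : b - y ≤ 1) (hb : ¬InnerCell k a b) (hn : ¬(a = 1 ∧ (b = 2 ∨ b = 4))) : s a b = 0 := by
  refine (D.snake.val a b).resolve_right fun h1 => ?_
  have := D.cross h1 h hx hx' hy hy' hb hI
  omega

/-- Away from the gates, the border neighbours of an occupied inner cell are empty already, so
erasing the border leaves its neighbourhood unchanged. -/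
theorem peel_nbr (D : TopDefect k 1 s) {x y a b : ℤ} (h : s (x + 2) (y + 2) = 1)
    (hI : InnerCell k (x + 2) (y + 2)) (hx : x - a ≤ 1) (hx' : a - x ≤ 1) (hy : y - b ≤ 1)
    (hy' : b - y ≤ 1) (hn : ¬(a ≤ 0 ∧ b ≤ 2)) : peel k s a b = s (a + 2) (b + 2) := by
  by_cases hb : InnerCell k (a + 2) (b + 2)
  · exact peel_far hb (by omega)
  · rw [peel_border hb, D.border_zero h hI (by omega) (by omega) (by omega) (by omega) hb
      (by omega)]

theorem peel_deg (D : TopDefect k 1 s) (hk : 6 ≤ k) (x y : ℤ) (h : peel k s x y = 1) :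
    kingSum (peel k s) x y = 2 := by
  have H := D.snake
  have hI : InnerCell k (x + 2) (y + 2) := by
    by_contra hI
    rw [peel_border hI] at h
    omega
  have e := D.entry hk
  have r1 := D.row_one
  have r2 := D.row_two
  have p00 := peel_zero_zero (k := k) (s := s)
  have p01 := peel_zero_one (s := s) hk
  have p02 := peel_zero_two (s := s) hk
  have pn (a b : ℤ) (hab : a < 0 ∨ b < 0) : peel k s a b = 0 :=
    peel_border (by simp only [InnerCell]; omega)
  have pf (a b : ℤ) (h1 : 0 ≤ a ∧ a ≤ 2 ∧ 0 ≤ b ∧ b ≤ 4 ∧ ¬(a = 0 ∧ b ≤ 2) := by omega) :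
      peel k s a b = s (a + 2) (b + 2) :=
    peel_far (by simp only [InnerCell]; omega) (by omega)
  have in_s (a b : ℤ) (h1 : ¬(a = 0 ∧ b = 1)) (h2 : peel k s a b = 1) : s (a + 2) (b + 2) = 1 := by
    have := D.peel_le hk h1
    have := H.le_one (a + 2) (b + 2)
    omega
  simp only [InnerCell] at hI
  -- Only these cells can touch one of the three altered values in row `0`.
  by_cases near : x ≤ 1 ∧ y ≤ 3
  · rcases (by omega : x = 0 ∨ x = 1) with rfl | rfl <;>
    rcases (by omega : y = 0 ∨ y = 1 ∨ y = 2 ∨ y = 3) with rfl | rfl | rfl | rfl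
    · omega
    · simp only [kingSum]
      norm_num
      rw [p00, p02, pn (-1) 0 (by omega), pn (-1) 1 (by omega), pn (-1) 2 (by omega), pf 1 0,
        pf 1 1, pf 1 2]
      norm_num
      omega
    · simp only [kingSum]
      norm_num
      rw [p01, pn (-1) 1 (by omega), pn (-1) 2 (by omega), pn (-1) 3 (by omega), pf 0 3,
        pf 1 1, pf 1 2, pf 1 3]
      norm_num
      omega
    · rw [pf 0 3] at h
      norm_num at h
      omega
    · have d := H.deg_at 2 3 4 1 2 3 e.1
      have z1 := D.border_zero (a := 3) (b := 1) e.1 (by simp [InnerCell]; omega) (by norm_num)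
        (by norm_num) (by norm_num) (by norm_num) (by simp [InnerCell]) (by norm_num)
      have z2 := D.border_zero (a := 4) (b := 1) e.1 (by simp [InnerCell]; omega) (by norm_num)
        (by norm_num) (by norm_num) (by norm_num) (by simp [InnerCell]) (by norm_num)
      simp only [kingSum]
      norm_num
      rw [p00, p01, pn 0 (-1) (by omega), pn 1 (-1) (by omega), pn 2 (-1) (by omega), pf 1 1,
        pf 2 0, pf 2 1]
      norm_num
      omega
    · rw [pf 1 1] at h
      norm_num at h
      omega
    · rw [pf 1 2] at h
      norm_num at h
      have d := H.deg_at 2 3 4 3 4 5 h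
      simp only [kingSum]
      norm_num
      rw [p01, p02, pf 0 3, pf 1 1, pf 1 3, pf 2 1, pf 2 2, pf 2 3]
      norm_num
      omega
    · rw [pf 1 3] at h
      norm_num at h
      have d := H.deg_at 2 3 4 4 5 6 h
      simp only [kingSum]
      norm_num
      rw [p02, pf 0 3, pf 0 4, pf 1 2, pf 1 4, pf 2 2, pf 2 3, pf 2 4]
      norm_num
      omega
  · have hs := in_s x y (by omega) h
    have d := H.deg _ _ hs
    simp only [kingSum] at d ⊢
    have hI' : InnerCell k (x + 2) (y + 2) := hI
    have g (a b : ℤ) (h1 : x - a ≤ 1 ∧ a - x ≤ 1 ∧ y - b ≤ 1 ∧ b - y ≤ 1) :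
        peel k s a b = s (a + 2) (b + 2) :=
      D.peel_nbr hs hI' h1.1 h1.2.1 h1.2.2.1 h1.2.2.2 (by omega)
    rw [g (x - 1) (y - 1) (by omega), g (x - 1) y (by omega), g (x - 1) (y + 1) (by omega),
      g x (y - 1) (by omega), g x (y + 1) (by omega), g (x + 1) (y - 1) (by omega),
      g (x + 1) y (by omega), g (x + 1) (y + 1) (by omega)]
    rw [show x - 1 + 2 = x + 2 - 1 by ring, show y - 1 + 2 = y + 2 - 1 by ring,
      show x + 1 + 2 = x + 2 + 1 by ring, show y + 1 + 2 = y + 2 + 1 by ring]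
    exact d

theorem peel_win (D : TopDefect k 1 s) (hk : 6 ≤ k) (x y : ℤ) :
    peel k s x y + peel k s x (y + 1) + peel k s (x + 1) y + peel k s (x + 1) (y + 1) ≤ 2 := by
  have e := D.entry hk
  have H := D.snake
  by_cases near : (x = -1 ∨ x = 0) ∧ (y = 0 ∨ y = 1)
  · have p00 := peel_zero_zero (k := k) (s := s)
    have p01 := peel_zero_one (s := s) hk
    have p02 := peel_zero_two (s := s) hk
    have pn (a b : ℤ) (hab : a < 0 ∨ b < 0) : peel k s a b = 0 :=
      peel_border (by simp only [InnerCell]; omega)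
    have l (a b : ℤ) : peel k s a b ≤ 1 := by
      have := D.peel_val a b
      omega
    have pf (a b : ℤ) (h1 : 1 ≤ a ∧ a ≤ 2 ∧ 0 ≤ b ∧ b ≤ 4 := by omega) :
        peel k s a b = s (a + 2) (b + 2) :=
      peel_far (by simp only [InnerCell]; omega) (by omega)
    have p11 := pf 1 1
    have p12 := pf 1 2
    norm_num at p11 p12
    obtain ⟨rfl | rfl, rfl | rfl⟩ := near <;> norm_num
    · rw [pn (-1) 0 (by omega), pn (-1) 1 (by omega), p00, p01]
      norm_num
    · rw [pn (-1) 1 (by omega), pn (-1) 2 (by omega), p01]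
      linarith [l 0 2]
    · linarith [l 1 0]
    · omega
  · have w := H.win (x + 2) (y + 2)
    rw [show x + 2 + 1 = x + 1 + 2 by ring, show y + 2 + 1 = y + 1 + 2 by ring] at w
    have := D.peel_le hk (x := x) (y := y) (by omega)
    have := D.peel_le hk (x := x) (y := y + 1) (by omega)
    have := D.peel_le hk (x := x + 1) (y := y) (by omega)
    have := D.peel_le hk (x := x + 1) (y := y + 1) (by omega)
    omega

theorem eq_of_peel_eq_zero (D : TopDefect k 1 s) {x y : ℤ} (h : s x y = 1)
    (h' : peel k s (x - 2) (y - 2) = 0) (hI : InnerCell k x y) :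
    x = 2 ∧ (y = 2 ∨ y = 4 ∧ s 3 5 = 0) := by
  have r2 := D.row_two
  simp only [peel, sub_add_cancel, hI, if_true] at h'
  split_ifs at h' with h1 h2 h3
  · omega
  · omega
  · obtain rfl : x = 2 := by omega
    obtain rfl : y = 4 := by omega
    tauto
  · omega

theorem peel_conn (D : TopDefect k 1 s) (hk : 6 ≤ k) (T : ℤ → ℤ → Prop)
    (hT : KingClosed (peel k s) T) (x y x' y' : ℤ) (h : peel k s x y = 1)
    (h' : peel k s x' y' = 1) (t : T x y) : T x' y' := by
  have p00 := peel_zero_zero (k := k) (s := s)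
  have p01 := peel_zero_one (s := s) hk
  have e := D.entry hk
  have r2 := D.row_two
  have in_s (a b : ℤ) (h1 : ¬(a = 0 ∧ b = 1)) (h2 : peel k s a b = 1) : s (a + 2) (b + 2) = 1 := by
    have := D.peel_le hk h1
    have := D.snake.le_one (a + 2) (b + 2)
    omega
  -- The cells lost by peeling, namely the border path and its ends, inherit the truth value at `(0,
  -- 1)`, to which they are contracted.
  let T' : ℤ → ℤ → Prop := fun a b =>
    (peel k s (a - 2) (b - 2) = 1 ∧ T (a - 2) (b - 2)) ∨ (peel k s (a - 2) (b - 2) = 0 ∧ T 0 1)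
  have lift (a b : ℤ) (hab : peel k s a b = 1) :
      ∃ c d, s c d = 1 ∧ (T' c d ↔ T a b) := by
    by_cases h1 : a = 0 ∧ b = 1
    · obtain ⟨rfl, rfl⟩ := h1
      exact ⟨2, 2, r2.2.2.1, by simp [T', p00]⟩
    · exact ⟨a + 2, b + 2, in_s a b h1 hab, by simp [T', hab]⟩
  obtain ⟨c, d, hs, hc⟩ := lift x y h
  obtain ⟨c', d', hs', hc'⟩ := lift x' y' h'
  refine hc'.1 (D.snake.conn T' ?_ c d c' d' hs hs' (hc.2 t))
  -- A surviving cell next to a lost one is, after translation, equal or adjacent to `(0, 1)`.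
  have near (a b a' b' : ℤ) (h1 : s a b = 1) (h2 : s a' b' = 1) (h3 : a' - a ≤ 1)
      (h4 : a - a' ≤ 1) (h5 : b' - b ≤ 1) (h6 : b - b' ≤ 1) (z : peel k s (a - 2) (b - 2) = 0)
      (z' : peel k s (a' - 2) (b' - 2) = 1) : a' - 2 ≤ 1 ∧ 0 ≤ a' - 2 ∧ b' - 2 ≤ 2 ∧ 0 ≤ b' - 2 := by
    have hI' : InnerCell k a' b' := by
      by_contra hI'
      rw [peel_border (by simpa using hI')] at z'
      omega
    have hI2 := hI'
    simp only [InnerCell] at hI2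
    by_cases hI : InnerCell k a b
    · obtain ⟨rfl, rfl | ⟨rfl, hz⟩⟩ := D.eq_of_peel_eq_zero h1 z hI
      · omega
      · refine ⟨by omega, by omega, ?_, by omega⟩
        by_contra hb
        obtain rfl : b' = 5 := by omega
        rcases (by omega : a' = 2 ∨ a' = 3) with rfl | rfl <;> omega
    · obtain ⟨rfl, rfl, hy⟩ := D.cross h1 h2 h3 h4 h5 h6 hI hI'
      refine ⟨by omega, by omega, ?_, by omega⟩
      by_contra hb
      obtain rfl : b' = 5 := by omega
      omega
  intro a b a' b' h1 h2 h3 h4 h5 h6 hab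
  rcases D.peel_val (a' - 2) (b' - 2) with z' | z' <;>
  rcases hab with ⟨z, hab⟩ | ⟨z, hab⟩
  · have := near a' b' a b h2 h1 h4 h3 h6 h5 z' z
    exact Or.inr ⟨z', hT _ _ _ _ z p01 (by omega) (by omega) (by omega) (by omega) hab⟩
  · exact Or.inr ⟨z', hab⟩
  · exact Or.inl ⟨z', hT _ _ _ _ z z' (by omega) (by omega) (by omega) (by omega) hab⟩
  · have := near a b a' b' h1 h2 h3 h4 h5 h6 z z'
    exact Or.inl ⟨z', hT _ _ _ _ p01 z' (by omega) (by omega) (by omega) (by omega) hab⟩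

theorem peel_snake (D : TopDefect k 1 s) (hk : 6 ≤ k) : Snake (k - 2) (peel k s) where
  val := D.peel_val
  out x y h := peel_border (by simp only [InnerCell]; omega)
  deg := D.peel_deg hk
  win := D.peel_win hk
  conn := D.peel_conn hk

theorem peel_blk (D : TopDefect k 1 s) (hk : 6 ≤ k) (i j : ℤ) (hi : 0 ≤ i) (hi' : i < k - 2)
    (hj : 0 ≤ j) (hj' : j < k - 2) (hij : i ≠ 0 ∨ j ≠ 1) : blk (peel k s) i j = 2 := by
  have e := D.entry hk
  by_cases h0 : i = 0 ∧ j = 0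
  · obtain ⟨rfl, rfl⟩ := h0
    have p1 := peel_far (k := k) (s := s) (x := 1) (y := 0) (by simp [InnerCell]; omega) (by omega)
    have p2 := peel_far (k := k) (s := s) (x := 1) (y := 1) (by simp [InnerCell]; omega) (by omega)
    norm_num at p1 p2
    simp only [blk]
    norm_num
    rw [peel_zero_zero, peel_zero_one hk, p1, p2]
    omega
  · rw [← D.good (i + 1) (j + 1) (by omega) (by omega) (by omega) (by omega) (by omega)]
    simp only [blk]
    rw [peel_far (by simp only [InnerCell]; omega) (by omega),
      peel_far (by simp only [InnerCell]; omega) (by omega),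
      peel_far (by simp only [InnerCell]; omega) (by omega),
      peel_far (by simp only [InnerCell]; omega) (by omega),
      show 2 * i + 1 + 2 = 2 * (i + 1) + 1 by ring, show 2 * i + 2 = 2 * (i + 1) by ring,
      show 2 * j + 1 + 2 = 2 * (j + 1) + 1 by ring, show 2 * j + 2 = 2 * (j + 1) by ring]

/-- If `(3, 5)` were occupied, peeling would give block `(0, 1)` two cells, hence a snake with all
blocks full, which `border_not_full` excludes. -/
theorem three_five (D : TopDefect k 1 s) (hk : 6 ≤ k) : s 3 5 = 0 := by
  refine (D.snake.val 3 5).resolve_right fun h => ?_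
  have e := D.entry hk
  have r2 := D.row_two
  have b : blk (peel k s) 0 1 = 2 := by
    have p1 := peel_far (k := k) (s := s) (x := 0) (y := 3) (by simp [InnerCell]; omega) (by omega)
    have p2 := peel_far (k := k) (s := s) (x := 1) (y := 2) (by simp [InnerCell]; omega) (by omega)
    have p3 := peel_far (k := k) (s := s) (x := 1) (y := 3) (by simp [InnerCell]; omega) (by omega)
    norm_num at p1 p2 p3
    simp only [blk]
    norm_num
    rw [peel_zero_two hk, p1, p2, p3]
    omega
  have all (i j : ℤ) (hi : 0 ≤ i) (hi' : i < k - 2) (hj : 0 ≤ j) (hj' : j < k - 2) :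
      blk (peel k s) i j = 2 := by
    by_cases hij : i ≠ 0 ∨ j ≠ 1
    · exact D.peel_blk hk i j hi hi' hj hj' hij
    · push Not at hij
      rw [hij.1, hij.2, b]
  refine (D.peel_snake hk).border_not_full (by omega) ?_ fun i j h1 h2 h3 h4 _ => all i j h1 h2 h3 h4
  rw [all 1 1 (by omega) (by omega) (by omega) (by omega)]
  norm_num

theorem peel_topDefect (D : TopDefect k 1 s) (hk : 6 ≤ k) : TopDefect (k - 2) 1 (peel k s) := by
  have e := D.entry hk
  have r2 := D.row_two
  have h35 := D.three_five hk
  have p1 := peel_far (k := k) (s := s) (x := 0) (y := 3) (by simp [InnerCell]; omega) (by omega)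
  have p2 := peel_far (k := k) (s := s) (x := 1) (y := 2) (by simp [InnerCell]; omega) (by omega)
  have p3 := peel_far (k := k) (s := s) (x := 1) (y := 3) (by simp [InnerCell]; omega) (by omega)
  norm_num at p1 p2 p3
  refine ⟨D.peel_snake hk, by omega, by omega, by omega, D.peel_blk hk, ?_, ?_⟩ <;> norm_num
  · rw [peel_zero_two hk, p2]
    omega
  · rw [p1, p3]
    omega

end TopDefect

/-! ### Wrapping a border path around a board -/

/-- The cells of the border path which leaves the border from `(1, 2)` and `(1, 4)`. -/
def RingCell (k x y : ℤ) : Prop :=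
  (x = 0 ∧ (y = 1 ∨ 5 ≤ y ∧ y ≤ 2 * k - 2)) ∨ (x = 1 ∧ (y = 2 ∨ y = 4)) ∨
    ((y = 0 ∨ y = 2 * k - 1) ∧ 1 ≤ x ∧ x ≤ 2 * k - 2) ∨
    (x = 2 * k - 1 ∧ 1 ≤ y ∧ y ≤ 2 * k - 2)

open Classical in
/-- The board `t`, opened at the cell `(0, 1)`, surrounded by a border path. -/
noncomputable def wrap (k : ℤ) (t : ℤ → ℤ → ℤ) : ℤ → ℤ → ℤ := fun x y =>
  if InnerCell k x y then
    if x = 2 ∧ y = 2 then 1 else if x = 2 ∧ y = 3 then 0 else if x = 2 ∧ y = 4 then 1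
    else t (x - 2) (y - 2)
  else if RingCell k x y then 1 else 0

/-- No long empty stretches along the sides, so that a straight border path around the board is
the only possible one. -/
structure Tight (k : ℤ) (t : ℤ → ℤ → ℤ) : Prop where
  left : ∀ x, 0 ≤ x → x < 2 * k → t (x - 1) 0 = 1 ∨ t x 0 = 1 ∨ t (x + 1) 0 = 1
  right : ∀ x, 0 ≤ x → x < 2 * k →
    t (x - 1) (2 * k - 1) = 1 ∨ t x (2 * k - 1) = 1 ∨ t (x + 1) (2 * k - 1) = 1
  bottom : ∀ y, 0 ≤ y → y < 2 * k →
    t (2 * k - 1) (y - 1) = 1 ∨ t (2 * k - 1) y = 1 ∨ t (2 * k - 1) (y + 1) = 1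
  -- The range starts at `4` since row `0` of a standard cycle is empty in columns `2` to `4`.
  top : ∀ y, 4 ≤ y → y < 2 * k → t 0 (y - 1) = 1 ∨ t 0 y = 1 ∨ t 0 (y + 1) = 1

section Wrap

variable {k : ℤ} {t : ℤ → ℤ → ℤ}

theorem wrap_ring {x y : ℤ} (hI : ¬InnerCell k x y) (h : RingCell k x y) : wrap k t x y = 1 := by
  rw [wrap, if_neg hI, if_pos h]

theorem wrap_border {x y : ℤ} (hI : ¬InnerCell k x y) (h : ¬RingCell k x y) :
    wrap k t x y = 0 := by
  rw [wrap, if_neg hI, if_neg h]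

theorem wrap_inner {x y : ℤ} (hI : InnerCell k x y) (h : ¬(x = 2 ∧ 2 ≤ y ∧ y ≤ 4)) :
    wrap k t x y = t (x - 2) (y - 2) := by
  rw [wrap, if_pos hI, if_neg (by omega), if_neg (by omega), if_neg (by omega)]

theorem wrap_two_two (hk : 6 ≤ k) : wrap k t 2 2 = 1 := by
  have : InnerCell k 2 2 := by simp [InnerCell]; omega
  simp [wrap, this]

theorem wrap_two_three (hk : 6 ≤ k) : wrap k t 2 3 = 0 := by
  have : InnerCell k 2 3 := by simp [InnerCell]; omega
  simp [wrap, this]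

theorem wrap_two_four (hk : 6 ≤ k) : wrap k t 2 4 = 1 := by
  have : InnerCell k 2 4 := by simp [InnerCell]; omega
  simp [wrap, this]

/-- The ring fills the outer lines except for the corners and the opening, whatever `t` is. -/
theorem wrap_tight (hk : 6 ≤ k) : Tight k (wrap k t) := by
  have w1 (x y : ℤ) (h : ¬InnerCell k x y ∧ RingCell k x y) := wrap_ring (t := t) h.1 h.2
  simp only [InnerCell, RingCell] at w1
  refine ⟨fun x h h' => ?_, fun x h h' => ?_, fun x h h' => ?_, fun x h h' => ?_⟩
  · by_cases h0 : x = 0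
    · exact Or.inr (Or.inr (w1 _ _ (by omega)))
    by_cases h1 : x = 2 * k - 1
    · exact Or.inl (w1 _ _ (by omega))
    exact Or.inr (Or.inl (w1 _ _ (by omega)))
  · by_cases h0 : x = 0
    · exact Or.inr (Or.inr (w1 _ _ (by omega)))
    by_cases h1 : x = 2 * k - 1
    · exact Or.inl (w1 _ _ (by omega))
    exact Or.inr (Or.inl (w1 _ _ (by omega)))
  · by_cases h0 : x = 0
    · exact Or.inr (Or.inr (w1 _ _ (by omega)))
    by_cases h1 : x = 2 * k - 1
    · exact Or.inl (w1 _ _ (by omega))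
    exact Or.inr (Or.inl (w1 _ _ (by omega)))
  · by_cases h0 : x = 4
    · exact Or.inr (Or.inr (w1 _ _ (by omega)))
    by_cases h1 : x = 2 * k - 1
    · exact Or.inl (w1 _ _ (by omega))
    exact Or.inr (Or.inl (w1 _ _ (by omega)))

namespace TopDefect

variable {s : ℤ → ℤ → ℤ}

theorem corner_bottom_left (D : TopDefect k 1 s) : s (2 * k - 1) 0 = 0 ∧ s (2 * k - 2) 1 = 0 ∧
    s (2 * k - 1) 1 = 1 ∧ s (2 * k - 2) 0 = 1 := by
  have h4 := D.four_le
  have h := D.snake.reflX.corner (by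
    rw [blk_reflX]; exact D.good _ _ (by omega) (by omega) (by omega) (by omega) (by omega))
  simp only [reflX, sub_zero, sub_sub] at h
  norm_num at h
  exact h

theorem corner_bottom_right (D : TopDefect k 1 s) : s (2 * k - 1) (2 * k - 1) = 0 ∧
    s (2 * k - 2) (2 * k - 2) = 0 ∧ s (2 * k - 1) (2 * k - 2) = 1 ∧
    s (2 * k - 2) (2 * k - 1) = 1 := by
  have h4 := D.four_le
  have h := D.snake.reflX.reflY.corner (by
    rw [blk_reflY, blk_reflX]
    exact D.good _ _ (by omega) (by omega) (by omega) (by omega) (by omega))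
  simp only [reflX, reflY, sub_zero, sub_sub] at h
  norm_num at h
  exact h

/-- A cell adjacent to an occupied inner cell is empty, if it is on the border. -/
theorem empty_of_cross (D : TopDefect k 1 s) {x y x' y' : ℤ} (h' : s x' y' = 1)
    (hx : x' - x ≤ 1) (hx' : x - x' ≤ 1) (hy : y' - y ≤ 1) (hy' : y - y' ≤ 1)
    (hb : ¬InnerCell k x y) (hi : InnerCell k x' y') (hn : ¬(x = 1 ∧ (y = 2 ∨ y = 4))) :
    s x y = 0 := by
  refine (D.snake.val x y).resolve_right fun h => ?_
  have := D.cross h h' hx hx' hy hy' hb hi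
  omega

/-- Outside the opening, a border cell on the line next to the inner board would touch three
consecutive inner positions, one of which is occupied by tightness. Crossings occur only at the
gates, so the path keeps to the outer line, and peeling loses no information. -/
theorem eq_wrap_peel (D : TopDefect k 1 s) (hk : 6 ≤ k) (ht : Tight (k - 2) (peel k s)) :
    s = wrap k (peel k s) := by
  have H := D.snake
  have e := D.entry hk
  have r0 := D.row_zero
  have r1 := D.row_one
  have r2 := D.row_two
  have c1 := D.corner_right
  have c2 := D.corner_bottom_left
  have c3 := D.corner_bottom_right
  have in_s (a b : ℤ) (h1 : ¬(a = 0 ∧ b = 1)) (h2 : peel k s a b = 1) :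
      s (a + 2) (b + 2) = 1 ∧ InnerCell k (a + 2) (b + 2) := by
    have := D.peel_le hk h1
    have := D.snake.le_one (a + 2) (b + 2)
    refine ⟨by omega, ?_⟩
    by_contra hI
    rw [peel_border hI] at h2
    omega
  have left (x : ℤ) (h : 2 ≤ x) (h' : x ≤ 2 * k - 3) : s x 1 = 0 := by
    rcases ht.left (x - 2) (by omega) (by omega) with h1 | h1 | h1 <;>
    obtain ⟨h2, h3⟩ := in_s _ _ (by omega) h1 <;>
    exact D.empty_of_cross h2 (by omega) (by omega) (by omega) (by omega)
      (by simp only [InnerCell]; omega) h3 (by omega)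
  have right (x : ℤ) (h : 2 ≤ x) (h' : x ≤ 2 * k - 3) : s x (2 * k - 2) = 0 := by
    rcases ht.right (x - 2) (by omega) (by omega) with h1 | h1 | h1 <;>
    obtain ⟨h2, h3⟩ := in_s _ _ (by omega) h1 <;>
    exact D.empty_of_cross h2 (by omega) (by omega) (by omega) (by omega)
      (by simp only [InnerCell]; omega) h3 (by omega)
  have bottom (y : ℤ) (h : 2 ≤ y) (h' : y ≤ 2 * k - 3) : s (2 * k - 2) y = 0 := by
    rcases ht.bottom (y - 2) (by omega) (by omega) with h1 | h1 | h1 <;>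
    obtain ⟨h2, h3⟩ := in_s _ _ (by omega) h1 <;>
    exact D.empty_of_cross h2 (by omega) (by omega) (by omega) (by omega)
      (by simp only [InnerCell]; omega) h3 (by omega)
  have top (y : ℤ) (h : 6 ≤ y) (h' : y ≤ 2 * k - 3) : s 1 y = 0 := by
    rcases ht.top (y - 2) (by omega) (by omega) with h1 | h1 | h1 <;>
    obtain ⟨h2, h3⟩ := in_s _ _ (by omega) h1 <;>
    exact D.empty_of_cross h2 (by omega) (by omega) (by omega) (by omega)
      (by simp only [InnerCell]; omega) h3 (by omega)
  funext x y
  by_cases hI : InnerCell k x y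
  · by_cases hm : x = 2 ∧ 2 ≤ y ∧ y ≤ 4
    · obtain ⟨rfl, h1, h2⟩ := hm
      rcases (by omega : y = 2 ∨ y = 3 ∨ y = 4) with rfl | rfl | rfl
      · rw [wrap_two_two hk]; omega
      · rw [wrap_two_three hk]; omega
      · rw [wrap_two_four hk]; omega
    · rw [wrap_inner hI hm, peel_far (by simpa using hI) (by omega), sub_add_cancel, sub_add_cancel]
  have w1 (h : RingCell k x y) : wrap k (peel k s) x y = 1 := wrap_ring hI h
  have w0 (h : ¬RingCell k x y) : wrap k (peel k s) x y = 0 := wrap_border hI h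
  simp only [RingCell] at w0 w1
  by_cases hB : 0 ≤ x ∧ x < 2 * k ∧ 0 ≤ y ∧ y < 2 * k
  swap
  · rw [H.out x y hB, w0 (by omega)]
  simp only [InnerCell] at hI
  by_cases hx : x ≤ 1
  · have := D.top_sum y (by omega) (by omega)
    rcases (by omega : y ≤ 5 ∨ 6 ≤ y ∧ y ≤ 2 * k - 3 ∨ y = 2 * k - 2 ∨ y = 2 * k - 1) with
      hy | hy | rfl | rfl
    · rcases (by omega : y = 0 ∨ y = 1 ∨ y = 2 ∨ y = 3 ∨ y = 4 ∨ y = 5) with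
        rfl | rfl | rfl | rfl | rfl | rfl <;>
      rcases (by omega : x = 0 ∨ x = 1) with rfl | rfl <;>
      first
      | rw [w1 (by omega)]; omega
      | rw [w0 (by omega)]; omega
    · have := top y hy.1 hy.2
      rcases (by omega : x = 0 ∨ x = 1) with rfl | rfl
      · rw [w1 (by omega)]; omega
      · rw [w0 (by omega)]; omega
    · rcases (by omega : x = 0 ∨ x = 1) with rfl | rfl
      · rw [w1 (by omega)]; omega
      · rw [w0 (by omega)]; omega
    · rcases (by omega : x = 0 ∨ x = 1) with rfl | rfl
      · rw [w0 (by omega)]; omega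
      · rw [w1 (by omega)]; omega
  by_cases hx2 : x ≤ 2 * k - 3
  · by_cases hy : y ≤ 1
    · have := left x (by omega) (by omega)
      have := H.left_sum D.sides x (by omega) (by omega)
      rcases (by omega : y = 0 ∨ y = 1) with rfl | rfl
      · rw [w1 (by omega)]; omega
      · rw [w0 (by omega)]; omega
    · have := right x (by omega) (by omega)
      have := H.right_sum D.sides x (by omega) (by omega)
      rcases (by omega : y = 2 * k - 2 ∨ y = 2 * k - 1) with rfl | rfl
      · rw [w0 (by omega)]; omega
      · rw [w1 (by omega)]; omega
  rcases (by omega : x = 2 * k - 2 ∨ x = 2 * k - 1) with rfl | rfl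
  · rcases (by omega : y = 0 ∨ y = 1 ∨ 2 ≤ y ∧ y ≤ 2 * k - 3 ∨ y = 2 * k - 2 ∨ y = 2 * k - 1) with
      rfl | rfl | hy | rfl | rfl
    · rw [w1 (by omega)]; omega
    · rw [w0 (by omega)]; omega
    · rw [w0 (by omega), bottom y hy.1 hy.2]
    · rw [w0 (by omega)]; omega
    · rw [w1 (by omega)]; omega
  · rcases (by omega : y = 0 ∨ y = 1 ∨ 2 ≤ y ∧ y ≤ 2 * k - 3 ∨ y = 2 * k - 2 ∨ y = 2 * k - 1) with
      rfl | rfl | hy | rfl | rfl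
    · rw [w0 (by omega)]; omega
    · rw [w1 (by omega)]; omega
    · have := H.bottom_sum D.sides y (by omega) (by omega)
      have := bottom y hy.1 hy.2
      rw [w1 (by omega)]; omega
    · rw [w1 (by omega)]; omega
    · rw [w0 (by omega)]; omega

end TopDefect

end Wrap

/-! ### The wrapped board is a standard cycle -/

theorem iff_of_step {f : ℤ → Prop} {a : ℤ} (n : ℕ) (h : ∀ i, a ≤ i → i < a + n → (f i ↔ f (i + 1)))
    (i : ℤ) (hi : a ≤ i) (hi' : i ≤ a + n) : f i ↔ f a := by
  obtain ⟨m, rfl⟩ := Int.le.dest hi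
  have hm : m ≤ n := by omega
  clear hi hi'
  induction m with
  | zero => simp
  | succ m ih =>
    have e := ih (by omega)
    have e' := h (a + m) (by omega) (by omega)
    push_cast
    rw [← add_assoc]
    exact e'.symm.trans e

namespace TopDefect

variable {k : ℤ} {t : ℤ → ℤ → ℤ}

theorem wrap_val (D : TopDefect (k - 2) 1 t) (x y : ℤ) : wrap k t x y = 0 ∨ wrap k t x y = 1 := by
  have := D.snake.val
  simp only [wrap]
  split_ifs <;> simp [this]

theorem wrap_side_eq_one (a b : ℤ) (hab : (a = 0 ∧ 5 ≤ b ∧ b ≤ 2 * k - 2) ∨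
    (b = 0 ∧ 1 ≤ a ∧ a ≤ 2 * k - 2) ∨ (b = 2 * k - 1 ∧ 1 ≤ a ∧ a ≤ 2 * k - 2) ∨
    (a = 2 * k - 1 ∧ 1 ≤ b ∧ b ≤ 2 * k - 2) ∨ (a = 0 ∧ b = 1) ∨ (a = 1 ∧ b = 2) ∨
    (a = 1 ∧ b = 4)) : wrap k t a b = 1 := by
  refine wrap_ring ?_ ?_
  · simp only [InnerCell]
    rcases hab with h | h | h | h | h | h | h <;> omega
  · simp only [RingCell]
    tauto

theorem ringCell_cases {x y : ℤ} (h : RingCell k x y) : (x = 1 ∧ y = 2) ∨ (x = 1 ∧ y = 4) ∨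
    (x = 0 ∧ y = 1) ∨ (x = 0 ∧ y = 5) ∨ (x = 0 ∧ 6 ≤ y ∧ y ≤ 2 * k - 3) ∨
    (x = 0 ∧ y = 2 * k - 2) ∨ (x = 1 ∧ y = 0) ∨ (2 ≤ x ∧ x ≤ 2 * k - 3 ∧ y = 0) ∨
    (x = 2 * k - 2 ∧ y = 0) ∨ (x = 1 ∧ y = 2 * k - 1) ∨
    (2 ≤ x ∧ x ≤ 2 * k - 3 ∧ y = 2 * k - 1) ∨ (x = 2 * k - 2 ∧ y = 2 * k - 1) ∨
    (x = 2 * k - 1 ∧ y = 1) ∨ (x = 2 * k - 1 ∧ 2 ≤ y ∧ y ≤ 2 * k - 3) ∨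
    (x = 2 * k - 1 ∧ y = 2 * k - 2) := by
  rcases h with ⟨h, h'⟩ | ⟨h, h' | h'⟩ | ⟨h | h, h'⟩ | ⟨h, h'⟩
  · rcases (by omega : y = 1 ∨ y = 5 ∨ (6 ≤ y ∧ y ≤ 2 * k - 3) ∨ y = 2 * k - 2) with
      e | e | e | e <;> simp only [h, e, true_and, true_or, or_true, and_self]
  · exact Or.inl ⟨h, h'⟩
  · exact Or.inr (Or.inl ⟨h, h'⟩)
  · rcases (by omega : x = 1 ∨ (2 ≤ x ∧ x ≤ 2 * k - 3) ∨ x = 2 * k - 2) with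
      e | e | e <;> simp only [h, e, true_and, true_or, or_true, and_self]
  · rcases (by omega : x = 1 ∨ (2 ≤ x ∧ x ≤ 2 * k - 3) ∨ x = 2 * k - 2) with
      e | e | e <;> simp only [h, e, true_and, true_or, or_true, and_self]
  · rcases (by omega : y = 1 ∨ (2 ≤ y ∧ y ≤ 2 * k - 3) ∨ y = 2 * k - 2) with
      e | e | e <;> simp only [h, e, true_and, true_or, or_true, and_self]

theorem wrap_ring_deg (D : TopDefect (k - 2) 1 t) (x y : ℤ)
    (h : RingCell k x y) : kingSum (wrap k t) x y = 2 := by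
  have hk : 6 ≤ k := by linarith [D.four_le]
  have w0 (a b : ℤ) (hab : ¬InnerCell k a b ∧ ¬RingCell k a b) := wrap_border (t := t) hab.1 hab.2
  have side := wrap_side_eq_one (k := k) (t := t)
  have w22 := wrap_two_two (t := t) hk
  have w23 := wrap_two_three (t := t) hk
  have w24 := wrap_two_four (t := t) hk
  have w25 : wrap k t 2 5 = 0 := by
    rw [wrap_inner (by simp [InnerCell]; omega) (by omega)]
    have := D.gap
    norm_num at this ⊢
    tauto
  simp only [InnerCell, RingCell] at w0
  simp only [kingSum]
  have cases := ringCell_cases h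
  clear h
  rcases cases with ⟨rfl, rfl⟩ | ⟨rfl, rfl⟩ | cases
  · norm_num
    rw [w22, w23, side 0 1 (by omega), w0 0 2 (by omega), w0 0 3 (by omega), w0 1 1 (by omega),
      w0 1 3 (by omega), w0 2 1 (by omega)]
    norm_num
  · norm_num
    rw [w25, w23, w24, side 0 5 (by omega), w0 0 4 (by omega), w0 0 3 (by omega),
      w0 1 5 (by omega), w0 1 3 (by omega)]
    norm_num
  clear w22 w23 w24 w25
  -- The remaining ring cells lie on the outer lines, so all their neighbours are border positions
  -- or outside the board, with values independent of `t`.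
  rcases cases with h | h | h | h | h | h | h | h | h | h | h | h | h <;>
  · first | rw [w0 (x - 1) (y - 1) (by omega)] | rw [side (x - 1) (y - 1) (by omega)]
    first | rw [w0 (x - 1) y (by omega)] | rw [side (x - 1) y (by omega)]
    first | rw [w0 (x - 1) (y + 1) (by omega)] | rw [side (x - 1) (y + 1) (by omega)]
    first | rw [w0 x (y - 1) (by omega)] | rw [side x (y - 1) (by omega)]
    first | rw [w0 x (y + 1) (by omega)] | rw [side x (y + 1) (by omega)]
    first | rw [w0 (x + 1) (y - 1) (by omega)] | rw [side (x + 1) (y - 1) (by omega)]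
    first | rw [w0 (x + 1) y (by omega)] | rw [side (x + 1) y (by omega)]
    first | rw [w0 (x + 1) (y + 1) (by omega)] | rw [side (x + 1) (y + 1) (by omega)]
    norm_num

/-- Away from the opening, `wrap k t` is `t` near the inner board. -/
theorem wrap_near (D : TopDefect (k - 2) 1 t) {x y a b : ℤ}
    (hI : InnerCell k x y) (hx : x - a ≤ 1) (hx' : a - x ≤ 1) (hy : y - b ≤ 1)
    (hy' : b - y ≤ 1) (hn : ¬(a ≤ 2 ∧ b ≤ 4)) : wrap k t a b = t (a - 2) (b - 2) := by
  by_cases hb : InnerCell k a b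
  · exact wrap_inner hb (by omega)
  · simp only [InnerCell] at hI
    rw [wrap_border hb, D.snake.out]
    · simp only [InnerCell] at hb
      omega
    · simp only [RingCell]
      omega

theorem wrap_inner_deg (D : TopDefect (k - 2) 1 t) (x y : ℤ) (hI : InnerCell k x y)
    (h : wrap k t x y = 1) : kingSum (wrap k t) x y = 2 := by
  have hk : 6 ≤ k := by linarith [D.four_le]
  have H := D.snake
  have w1 (a b : ℤ) (hab : ¬InnerCell k a b ∧ RingCell k a b) := wrap_ring (t := t) hab.1 hab.2
  have w0 (a b : ℤ) (hab : ¬InnerCell k a b ∧ ¬RingCell k a b) := wrap_border (t := t) hab.1 hab.2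
  have w22 := wrap_two_two (t := t) hk
  have w23 := wrap_two_three (t := t) hk
  have w24 := wrap_two_four (t := t) hk
  have wi (a b : ℤ) (hab : 2 ≤ a ∧ a ≤ 4 ∧ 2 ≤ b ∧ b ≤ 6 ∧ ¬(a = 2 ∧ b ≤ 4)) :
      wrap k t a b = t (a - 2) (b - 2) :=
    wrap_inner (by simp only [InnerCell]; omega) (by omega)
  have r0 := D.row_zero
  have r1 := D.row_one
  have hI2 := hI
  simp only [InnerCell, RingCell] at w0 w1 hI2
  by_cases near : x ≤ 3 ∧ y ≤ 5
  · rcases (by omega : x = 2 ∨ x = 3) with rfl | rfl <;>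
    rcases (by omega : y = 2 ∨ y = 3 ∨ y = 4 ∨ y = 5) with rfl | rfl | rfl | rfl
    · simp only [kingSum]
      norm_num
      rw [w0 1 1 (by omega), w1 1 2 (by omega), w0 1 3 (by omega), w0 2 1 (by omega), w23,
        w0 3 1 (by omega), wi 3 2 (by omega), wi 3 3 (by omega)]
      norm_num
      omega
    · omega
    · simp only [kingSum]
      norm_num
      rw [w0 1 3 (by omega), w1 1 4 (by omega), w0 1 5 (by omega), w23, wi 2 5 (by omega),
        wi 3 3 (by omega), wi 3 4 (by omega), wi 3 5 (by omega)]
      norm_num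
      omega
    · rw [wi 2 5 (by omega)] at h
      norm_num at h
      omega
    · have d := H.deg_at 0 1 2 (-1) 0 1 r1.1
      rw [H.out_bot 0 (-1), H.out_bot 1 (-1), H.out_bot 2 (-1)] at d
      simp only [kingSum]
      norm_num
      rw [w0 2 1 (by omega), w22, w23, w0 3 1 (by omega), wi 3 3 (by omega), w0 4 1 (by omega),
        wi 4 2 (by omega), wi 4 3 (by omega)]
      norm_num
      omega
    · rw [wi 3 3 (by omega)] at h
      norm_num at h
      omega
    · have d := H.deg_at 0 1 2 1 2 3 r1.2.2.1
      simp only [kingSum]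
      norm_num
      rw [w23, w24, wi 2 5 (by omega), wi 3 3 (by omega), wi 3 5 (by omega), wi 4 3 (by omega),
        wi 4 4 (by omega), wi 4 5 (by omega)]
      norm_num
      omega
    · rw [wi 3 5 (by omega)] at h
      norm_num at h
      omega
  · have g (a b : ℤ) (h1 : x - a ≤ 1 ∧ a - x ≤ 1 ∧ y - b ≤ 1 ∧ b - y ≤ 1) :
        wrap k t a b = t (a - 2) (b - 2) :=
      D.wrap_near hI h1.1 h1.2.1 h1.2.2.1 h1.2.2.2 (by omega)
    rw [g x y (by omega)] at h
    have d := H.deg _ _ h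
    simp only [kingSum] at d ⊢
    rw [g (x - 1) (y - 1) (by omega), g (x - 1) y (by omega), g (x - 1) (y + 1) (by omega),
      g x (y - 1) (by omega), g x (y + 1) (by omega), g (x + 1) (y - 1) (by omega),
      g (x + 1) y (by omega), g (x + 1) (y + 1) (by omega)]
    rw [show x - 1 - 2 = x - 2 - 1 by ring, show y - 1 - 2 = y - 2 - 1 by ring,
      show x + 1 - 2 = x - 2 + 1 by ring, show y + 1 - 2 = y - 2 + 1 by ring]
    exact d

theorem wrap_deg (D : TopDefect (k - 2) 1 t) (x y : ℤ) (h : wrap k t x y = 1) :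
    kingSum (wrap k t) x y = 2 := by
  by_cases hI : InnerCell k x y
  · exact D.wrap_inner_deg x y hI h
  · refine D.wrap_ring_deg x y ?_
    by_contra hR
    rw [wrap_border hI hR] at h
    omega

theorem wrap_win (D : TopDefect (k - 2) 1 t) (x y : ℤ) :
    wrap k t x y + wrap k t x (y + 1) + wrap k t (x + 1) y + wrap k t (x + 1) (y + 1) ≤ 2 := by
  have hk : 6 ≤ k := by linarith [D.four_le]
  have H := D.snake
  have w1 (a b : ℤ) (hab : ¬InnerCell k a b ∧ RingCell k a b) := wrap_ring (t := t) hab.1 hab.2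
  have w0 (a b : ℤ) (hab : ¬InnerCell k a b ∧ ¬RingCell k a b) := wrap_border (t := t) hab.1 hab.2
  have le (a b : ℤ) : wrap k t a b ≤ 1 := by
    have := D.wrap_val a b
    omega
  have hw := H.win (x - 2) (y - 2)
  have g (a b : ℤ) (hI : ∃ c d, InnerCell k c d ∧ c - a ≤ 1 ∧ a - c ≤ 1 ∧ d - b ≤ 1 ∧ b - d ≤ 1)
      (hn : ¬(a ≤ 2 ∧ b ≤ 4)) : wrap k t a b = t (a - 2) (b - 2) := by
    obtain ⟨c, d, h0, h1, h2, h3, h4⟩ := hI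
    exact D.wrap_near h0 h1 h2 h3 h4 hn
  simp only [InnerCell, RingCell] at w0 w1 g
  -- Of two cells stacked across a side at most one is in the ring; a window along the edge splits
  -- into two such pairs.
  have pair (a b c d : ℤ) (h : (a < 0 ∧ c ≤ 0) ∨ (a = 0 ∧ c = 1 ∧ b = d) ∨ (2 * k ≤ c ∧ 2 * k - 1 ≤ a)
      ∨ (a = 2 * k - 2 ∧ c = 2 * k - 1 ∧ b = d) ∨ (b < 0 ∧ d ≤ 0) ∨ (b = 0 ∧ d = 1 ∧ a = c) ∨
      (2 * k ≤ d ∧ 2 * k - 1 ≤ b) ∨ (b = 2 * k - 2 ∧ d = 2 * k - 1 ∧ a = c)) :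
      wrap k t a b + wrap k t c d ≤ 1 := by
    by_cases hab : ¬(2 ≤ a ∧ a < 2 * k - 2 ∧ 2 ≤ b ∧ b < 2 * k - 2) ∧
      ¬((a = 0 ∧ (b = 1 ∨ 5 ≤ b ∧ b ≤ 2 * k - 2)) ∨ (a = 1 ∧ (b = 2 ∨ b = 4)) ∨
    ((b = 0 ∨ b = 2 * k - 1) ∧ 1 ≤ a ∧ a ≤ 2 * k - 2) ∨
    (a = 2 * k - 1 ∧ 1 ≤ b ∧ b ≤ 2 * k - 2))
    · rw [w0 a b hab]
      linarith [le c d]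
    · rw [w0 c d (by omega)]
      linarith [le a b]
  by_cases c1 : x ≤ 0 ∨ 2 * k - 2 ≤ x
  · have := pair x y (x + 1) y (by omega)
    have := pair x (y + 1) (x + 1) (y + 1) (by omega)
    omega
  by_cases c2 : y ≤ 0 ∨ 2 * k - 2 ≤ y
  · have := pair x y x (y + 1) (by omega)
    have := pair (x + 1) y (x + 1) (y + 1) (by omega)
    omega
  by_cases near : x ≤ 2 ∧ y ≤ 4
  · have w22 := wrap_two_two (t := t) hk
    have w23 := wrap_two_three (t := t) hk
    have w24 := wrap_two_four (t := t) hk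
    have wi (a b : ℤ) (hab : 2 ≤ a ∧ a ≤ 4 ∧ 2 ≤ b ∧ b ≤ 6 ∧ ¬(a = 2 ∧ b ≤ 4)) :
        wrap k t a b = t (a - 2) (b - 2) :=
      wrap_inner (by simp only [InnerCell]; omega) (by omega)
    have r0 := D.row_zero
    have r1 := D.row_one
    have a1 := wi 2 5 (by omega)
    have a2 := wi 3 3 (by omega)
    have a3 := wi 3 5 (by omega)
    have b1 := w0 1 1 (by omega)
    have b2 := w0 1 3 (by omega)
    have b3 := w0 1 5 (by omega)
    have b4 := w0 2 1 (by omega)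
    have b5 := w0 3 1 (by omega)
    norm_num at a1 a2 a3
    have l1 := le 1 2
    have l2 := le 1 4
    have l3 := le 3 2
    have l4 := le 3 4
    rcases (by omega : x = 1 ∨ x = 2) with rfl | rfl <;>
    rcases (by omega : y = 1 ∨ y = 2 ∨ y = 3 ∨ y = 4) with rfl | rfl | rfl | rfl <;>
    · norm_num
      omega
  · have hk2 := le
    rw [show x - 2 + 1 = x + 1 - 2 by ring, show y - 2 + 1 = y + 1 - 2 by ring] at hw
    have cell : ∃ c d, (2 ≤ c ∧ c < 2 * k - 2 ∧ 2 ≤ d ∧ d < 2 * k - 2) ∧ x ≤ c ∧ c ≤ x + 1 ∧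
        y ≤ d ∧ d ≤ y + 1 := by
      rcases (by omega : x = 1 ∨ 2 ≤ x) with h | h <;>
      rcases (by omega : y = 1 ∨ 2 ≤ y) with h' | h'
      · exact ⟨2, 2, by omega⟩
      · exact ⟨2, y, by omega⟩
      · exact ⟨x, 2, by omega⟩
      · exact ⟨x, y, by omega⟩
    obtain ⟨c, d, hc, e1, e2, e3, e4⟩ := cell
    by_cases n0 : x + 1 ≤ 2 ∧ y + 1 ≤ 4
    · omega
    by_cases n1 : x ≤ 2 ∧ y ≤ 4
    · omega
    by_cases n2 : x ≤ 2 ∧ y + 1 ≤ 4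
    · omega
    by_cases n3 : x + 1 ≤ 2 ∧ y ≤ 4
    · omega
    rw [g x y ⟨c, d, hc, by omega⟩ n1, g x (y + 1) ⟨c, d, hc, by omega⟩ n2,
      g (x + 1) y ⟨c, d, hc, by omega⟩ n3, g (x + 1) (y + 1) ⟨c, d, hc, by omega⟩ n0]
    exact hw

end TopDefect

namespace TopDefect

variable {k : ℤ} {t : ℤ → ℤ → ℤ}

/-- A king-closed predicate is constant on the border path and its two end cells. -/
theorem ring_connected (hk : 6 ≤ k) {T : ℤ → ℤ → Prop} (hT : KingClosed (wrap k t) T) :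
    (T 2 4 ↔ T 2 2) ∧ ∀ x y, RingCell k x y → (T x y ↔ T 2 2) := by
  have side := wrap_side_eq_one (k := k) (t := t)
  have adj (a b a' b' : ℤ) (h : wrap k t a b = 1) (h' : wrap k t a' b' = 1)
      (hd : a' - a ≤ 1 ∧ a - a' ≤ 1 ∧ b' - b ≤ 1 ∧ b - b' ≤ 1) : T a b ↔ T a' b' :=
    ⟨hT _ _ _ _ h h' hd.1 hd.2.1 hd.2.2.1 hd.2.2.2,
      hT _ _ _ _ h' h hd.2.1 hd.1 hd.2.2.2 hd.2.2.1⟩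
  have s22 := wrap_two_two (t := t) hk
  have s24 := wrap_two_four (t := t) hk
  have a1 := adj 2 2 1 2 s22 (side _ _ (by omega)) (by omega)
  have a2 := adj 1 2 0 1 (side _ _ (by omega)) (side _ _ (by omega)) (by omega)
  have a3 := adj 0 1 1 0 (side _ _ (by omega)) (side _ _ (by omega)) (by omega)
  have left := iff_of_step (f := fun i => T i 0) (a := 1) (2 * k - 3).toNat fun i h h' =>
    adj i 0 (i + 1) 0 (side _ _ (by omega)) (side _ _ (by omega)) (by omega)
  have a4 := adj (2 * k - 2) 0 (2 * k - 1) 1 (side _ _ (by omega)) (side _ _ (by omega)) (by omega)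
  have bottom := iff_of_step (f := fun i => T (2 * k - 1) i) (a := 1) (2 * k - 3).toNat
    fun i h h' => adj (2 * k - 1) i (2 * k - 1) (i + 1) (side _ _ (by omega)) (side _ _ (by omega))
      (by omega)
  have a5 := adj (2 * k - 1) (2 * k - 2) (2 * k - 2) (2 * k - 1) (side _ _ (by omega))
    (side _ _ (by omega)) (by omega)
  have right := iff_of_step (f := fun i => T i (2 * k - 1)) (a := 1) (2 * k - 3).toNat
    fun i h h' => adj i (2 * k - 1) (i + 1) (2 * k - 1) (side _ _ (by omega)) (side _ _ (by omega))
      (by omega)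
  have a6 := adj 1 (2 * k - 1) 0 (2 * k - 2) (side _ _ (by omega)) (side _ _ (by omega)) (by omega)
  have top := iff_of_step (f := fun i => T 0 i) (a := 5) (2 * k - 7).toNat fun i h h' =>
    adj 0 i 0 (i + 1) (side _ _ (by omega)) (side _ _ (by omega)) (by omega)
  have a7 := adj 0 5 1 4 (side _ _ (by omega)) (side _ _ (by omega)) (by omega)
  have a8 := adj 1 4 2 4 (side _ _ (by omega)) s24 (by omega)
  have c10 : T 1 0 ↔ T 2 2 := (a1.trans (a2.trans a3)).symm
  have cl (i : ℤ) (h : 1 ≤ i) (h' : i ≤ 2 * k - 2) : T i 0 ↔ T 2 2 :=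
    (left i h (by omega)).trans c10
  have cb1 : T (2 * k - 1) 1 ↔ T 2 2 := a4.symm.trans (cl _ (by omega) (by omega))
  have cb (i : ℤ) (h : 1 ≤ i) (h' : i ≤ 2 * k - 2) : T (2 * k - 1) i ↔ T 2 2 :=
    (bottom i h (by omega)).trans cb1
  have cr1 : T 1 (2 * k - 1) ↔ T 2 2 :=
    (right (2 * k - 2) (by omega) (by omega)).symm.trans
      (a5.symm.trans (cb _ (by omega) (by omega)))
  have cr (i : ℤ) (h : 1 ≤ i) (h' : i ≤ 2 * k - 2) : T i (2 * k - 1) ↔ T 2 2 :=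
    (right i h (by omega)).trans cr1
  have ct5 : T 0 5 ↔ T 2 2 :=
    (top (2 * k - 2) (by omega) (by omega)).symm.trans (a6.symm.trans cr1)
  have ct (i : ℤ) (h : 5 ≤ i) (h' : i ≤ 2 * k - 2) : T 0 i ↔ T 2 2 :=
    (top i h (by omega)).trans ct5
  have c14 : T 1 4 ↔ T 2 2 := a7.symm.trans ct5
  refine ⟨a8.symm.trans c14, ?_⟩
  rintro x y (⟨rfl, rfl | h⟩ | ⟨rfl, rfl | rfl⟩ | ⟨rfl | rfl, h⟩ | ⟨rfl, h⟩)
  · exact a3.trans c10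
  · exact ct y h.1 h.2
  · exact a1.symm
  · exact c14
  · exact cl x h.1 h.2
  · exact cr x h.1 h.2
  · exact cb y h.1 h.2

theorem wrap_conn (D : TopDefect (k - 2) 1 t) (T : ℤ → ℤ → Prop)
    (hT : KingClosed (wrap k t) T) (x y x' y' : ℤ) (h : wrap k t x y = 1)
    (h' : wrap k t x' y' = 1) (ht : T x y) : T x' y' := by
  have hk : 6 ≤ k := by linarith [D.four_le]
  obtain ⟨r1, r2⟩ := ring_connected hk hT
  have r0 := D.row_zero
  have q1 := D.row_one
  -- The cell `(0, 1)` stands for the whole ring, on which `T` has the same truth value as at `(2,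
  -- 2)`.
  let T' : ℤ → ℤ → Prop := fun a b => (a = 0 ∧ b = 1 ∧ T 2 2) ∨ (¬(a = 0 ∧ b = 1) ∧ T (a + 2) (b + 2))
  have hT0 : T' 0 1 ↔ T 2 2 := by simp [T']
  have hT1 (a b : ℤ) (hab : ¬(a = 0 ∧ b = 1)) : T' a b ↔ T (a + 2) (b + 2) := by
    simp only [T', hab, not_false_eq_true, true_and, or_iff_right_iff_imp]
    tauto
  have wt (a b : ℤ) (hab : ¬(a = 0 ∧ b = 1)) (h1 : t a b = 1) : wrap k t (a + 2) (b + 2) = 1 := by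
    have hb := D.snake.inside h1
    rw [wrap_inner]
    · simpa using h1
    · simp only [InnerCell]
      omega
    · intro hm
      obtain rfl : a = 0 := by omega
      rcases (by omega : b = 0 ∨ b = 2) with rfl | rfl <;> omega
  have key : KingClosed t T' := by
    have start (a b : ℤ) (h1 : t a b = 1) (hab : ¬(a = 0 ∧ b = 1)) (d1 : a ≤ 1) (d2 : b ≤ 2) :
        T (a + 2) (b + 2) ↔ T 2 2 := by
      have hw := wt a b hab h1
      have hb := D.snake.inside h1
      have s22 := wrap_two_two (t := t) hk
      have s24 := wrap_two_four (t := t) hk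
      rcases (by omega : a = 0 ∨ a = 1) with rfl | rfl <;>
      rcases (by omega : b = 0 ∨ b = 1 ∨ b = 2) with rfl | rfl | rfl <;> try omega
      · exact ⟨hT _ _ _ _ hw s22 (by omega) (by omega) (by omega) (by omega),
          hT _ _ _ _ s22 hw (by omega) (by omega) (by omega) (by omega)⟩
      · rw [← r1]
        exact ⟨hT _ _ _ _ hw s24 (by omega) (by omega) (by omega) (by omega),
          hT _ _ _ _ s24 hw (by omega) (by omega) (by omega) (by omega)⟩
    intro a b a' b' h1 h2 h3 h4 h5 h6 hab
    by_cases e : a = 0 ∧ b = 1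
    · by_cases e' : a' = 0 ∧ b' = 1
      · rw [e'.1, e'.2, ← e.1, ← e.2]
        exact hab
      · rw [e.1, e.2, hT0] at hab
        rw [hT1 _ _ e']
        exact (start a' b' h2 e' (by omega) (by omega)).2 hab
    · rw [hT1 _ _ e] at hab
      by_cases e' : a' = 0 ∧ b' = 1
      · rw [e'.1, e'.2, hT0]
        exact (start a b h1 e (by omega) (by omega)).1 hab
      · rw [hT1 _ _ e']
        exact hT _ _ _ _ (wt a b e h1) (wt a' b' e' h2) (by omega) (by omega) (by omega) (by omega)
          hab
  have rep (a b : ℤ) (h1 : wrap k t a b = 1) : ∃ c d, t c d = 1 ∧ (T' c d ↔ T a b) := by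
    have c01 : t 0 1 = 1 := r0.2.1
    by_cases hI : InnerCell k a b
    · by_cases hm : a = 2 ∧ 2 ≤ b ∧ b ≤ 4
      · obtain ⟨rfl, hm⟩ := hm
        rcases (by omega : b = 2 ∨ b = 3 ∨ b = 4) with rfl | rfl | rfl
        · exact ⟨0, 1, c01, hT0⟩
        · rw [wrap_two_three hk] at h1
          omega
        · exact ⟨0, 1, c01, hT0.trans r1.symm⟩
      · refine ⟨a - 2, b - 2, by rwa [wrap_inner hI hm] at h1, ?_⟩
        rw [hT1 _ _ (by omega), sub_add_cancel, sub_add_cancel]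
    · refine ⟨0, 1, c01, hT0.trans (r2 a b ?_).symm⟩
      by_contra hR
      rw [wrap_border hI hR] at h1
      omega
  obtain ⟨c, d, hc, e⟩ := rep x y h
  obtain ⟨c', d', hc', e'⟩ := rep x' y' h'
  exact e'.1 (D.snake.conn T' key c d c' d' hc hc' (e.2 ht))

theorem wrap_snake (D : TopDefect (k - 2) 1 t) : Snake k (wrap k t) where
  val := D.wrap_val
  out x y h := by
    have := D.four_le
    exact wrap_border (by simp only [InnerCell]; omega) (by simp only [RingCell]; omega)
  deg := D.wrap_deg
  win := D.wrap_win
  conn := D.wrap_conn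

theorem wrap_blk (D : TopDefect (k - 2) 1 t) (i j : ℤ) (hi : 0 ≤ i) (hi' : i < k) (hj : 0 ≤ j)
    (hj' : j < k) (hij : i ≠ 0 ∨ j ≠ 1) : blk (wrap k t) i j = 2 := by
  have hk : 6 ≤ k := by linarith [D.four_le]
  by_cases hin : 1 ≤ i ∧ i < k - 1 ∧ 1 ≤ j ∧ j < k - 1
  · have r0 := D.row_zero
    have r1 := D.row_one
    by_cases near : i = 1 ∧ j ≤ 2
    · have wi (a b : ℤ) (hab : a = 3 ∧ 2 ≤ b ∧ b ≤ 6 ∨ a = 2 ∧ b = 5) :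
          wrap k t a b = t (a - 2) (b - 2) :=
        wrap_inner (by simp only [InnerCell]; omega) (by omega)
      obtain ⟨rfl, hj2⟩ := near
      rcases (by omega : j = 1 ∨ j = 2) with rfl | rfl
      · simp only [blk]
        norm_num
        rw [wrap_two_two hk, wrap_two_three hk, wi 3 2 (by omega), wi 3 3 (by omega)]
        norm_num
        omega
      · simp only [blk]
        norm_num
        rw [wrap_two_four hk, wi 2 5 (by omega), wi 3 4 (by omega), wi 3 5 (by omega)]
        norm_num
        omega
    · rw [← D.good (i - 1) (j - 1) (by omega) (by omega) (by omega) (by omega) (by omega)]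
      simp only [blk]
      rw [wrap_inner (by simp only [InnerCell]; omega) (by omega),
        wrap_inner (by simp only [InnerCell]; omega) (by omega),
        wrap_inner (by simp only [InnerCell]; omega) (by omega),
        wrap_inner (by simp only [InnerCell]; omega) (by omega),
        show 2 * (i - 1) = 2 * i - 2 by ring, show 2 * (j - 1) = 2 * j - 2 by ring,
        show 2 * i + 1 - 2 = 2 * i - 2 + 1 by ring, show 2 * j + 1 - 2 = 2 * j - 2 + 1 by ring]
  · have w0 (a b : ℤ) (hab : ¬InnerCell k a b ∧ ¬RingCell k a b) :=
      wrap_border (t := t) hab.1 hab.2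
    have side := wrap_side_eq_one (k := k) (t := t)
    simp only [InnerCell, RingCell] at w0
    have cases : (i = 0 ∧ j = 0) ∨ (i = 0 ∧ j = 2) ∨ (i = 0 ∧ 3 ≤ j ∧ j ≤ k - 2) ∨
        (i = 0 ∧ j = k - 1) ∨ (1 ≤ i ∧ i ≤ k - 2 ∧ j = 0) ∨ (1 ≤ i ∧ i ≤ k - 2 ∧ j = k - 1) ∨
        (i = k - 1 ∧ j = 0) ∨ (i = k - 1 ∧ 1 ≤ j ∧ j ≤ k - 2) ∨ (i = k - 1 ∧ j = k - 1) := by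
      omega
    clear hin hij
    simp only [blk]
    rcases cases with h | h | h | h | h | h | h | h | h <;>
    · first | rw [w0 (2 * i) (2 * j) (by omega)] | rw [side (2 * i) (2 * j) (by omega)]
      first | rw [w0 (2 * i) (2 * j + 1) (by omega)] | rw [side (2 * i) (2 * j + 1) (by omega)]
      first | rw [w0 (2 * i + 1) (2 * j) (by omega)] | rw [side (2 * i + 1) (2 * j) (by omega)]
      first
      | rw [w0 (2 * i + 1) (2 * j + 1) (by omega)]
      | rw [side (2 * i + 1) (2 * j + 1) (by omega)]
      norm_num

theorem wrap_topDefect (D : TopDefect (k - 2) 1 t) : TopDefect k 1 (wrap k t) := by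
  have hk : 6 ≤ k := by linarith [D.four_le]
  have w0 (a b : ℤ) (hab : ¬InnerCell k a b ∧ ¬RingCell k a b) := wrap_border (t := t) hab.1 hab.2
  have side := wrap_side_eq_one (k := k) (t := t)
  simp only [InnerCell, RingCell] at w0
  refine ⟨D.wrap_snake, by omega, by omega, by omega, D.wrap_blk, ?_, ?_⟩ <;> norm_num
  · rw [w0 0 2 (by omega), side 1 2 (by omega)]
    norm_num
  · rw [w0 0 3 (by omega), w0 1 3 (by omega)]
    norm_num

theorem peel_wrap (D : TopDefect (k - 2) 1 t) : peel k (wrap k t) = t := by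
  have hk : 6 ≤ k := by linarith [D.four_le]
  have r0 := D.row_zero
  have r1 := D.row_one
  funext x y
  by_cases hI : InnerCell k (x + 2) (y + 2)
  · by_cases hm : x = 0 ∧ 0 ≤ y ∧ y ≤ 2
    · obtain ⟨rfl, h1, h2⟩ := hm
      rcases (by omega : y = 0 ∨ y = 1 ∨ y = 2) with rfl | rfl | rfl
      · rw [peel_zero_zero]; omega
      · rw [peel_zero_one hk]; omega
      · have g := D.gap
        rw [peel_zero_two hk, wrap_inner (by simp [InnerCell]; omega) (by omega)]
        norm_num at g ⊢
        omega
    · rw [peel_far hI hm, wrap_inner hI (by omega), add_sub_cancel_right, add_sub_cancel_right]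
  · rw [peel_border hI, D.snake.out]
    simp only [InnerCell] at hI
    omega

end TopDefect

/-! ### The induction step from `k` to `k + 2` -/

/-- The tight extremal snake cycles with their defective block at `(0, 1)`. -/
def Standard (k : ℤ) : Set (ℤ → ℤ → ℤ) := {s | TopDefect k 1 s}

/-- `wrap (k + 2)` maps `Standard k` bijectively onto `Standard (k + 2)`, with inverse `peel (k +
2)`. Tightness of the smaller boards gives surjectivity, and tightness of the larger ones is then
automatic. -/
theorem standard_step {k : ℤ} (hk : 4 ≤ k) (h : ∀ t ∈ Standard k, Tight k t) :
    (∀ t ∈ Standard (k + 2), Tight (k + 2) t) ∧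
      (Standard (k + 2)).ncard = (Standard k).ncard := by
  have e (s) (hs : s ∈ Standard (k + 2)) :
      peel (k + 2) s ∈ Standard k ∧ s = wrap (k + 2) (peel (k + 2) s) := by
    have D : TopDefect (k + 2) 1 s := hs
    have D' := D.peel_topDefect (by omega)
    rw [add_sub_cancel_right] at D'
    exact ⟨D', D.eq_wrap_peel (by omega) (by rw [add_sub_cancel_right]; exact h _ D')⟩
  have d (t) (ht : t ∈ Standard k) : TopDefect (k + 2 - 2) 1 t := by
    rw [add_sub_cancel_right]; exact ht
  constructor
  · intro s hs
    rw [(e s hs).2]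
    exact wrap_tight (by omega)
  · have : Standard (k + 2) = wrap (k + 2) '' Standard k := by
      ext s
      constructor
      · intro hs
        exact ⟨_, (e s hs).1, (e s hs).2.symm⟩
      · rintro ⟨t, ht, rfl⟩
        exact (d t ht).wrap_topDefect
    rw [this]
    refine Set.InjOn.ncard_image fun t ht t' ht' hh => ?_
    rw [← (d t ht).peel_wrap, ← (d t' ht').peel_wrap]
    exact congrArg _ hh

/-! ### The base case: the board of side eight -/

/-- The indicator function of the cells of a list. -/
def ofList (L : List (ℤ × ℤ)) : ℤ → ℤ → ℤ := fun x y => if (x, y) ∈ L then 1 else 0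

theorem ofList_eq_one {L : List (ℤ × ℤ)} {x y : ℤ} : ofList L x y = 1 ↔ (x, y) ∈ L := by
  simp [ofList]

theorem ofList_val (L : List (ℤ × ℤ)) (x y : ℤ) : ofList L x y = 0 ∨ ofList L x y = 1 := by
  simp only [ofList]
  split_ifs <;> simp

/-- Consecutive cells of a path. -/
def KingStep (p q : ℤ × ℤ) : Prop :=
  q.1 - p.1 ≤ 1 ∧ p.1 - q.1 ≤ 1 ∧ q.2 - p.2 ≤ 1 ∧ p.2 - q.2 ≤ 1

instance (p q : ℤ × ℤ) : Decidable (KingStep p q) := by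
  unfold KingStep
  infer_instance

theorem iff_head_of_isChain {s : ℤ → ℤ → ℤ} {T : ℤ → ℤ → Prop} (hT : KingClosed s T)
    (l : List (ℤ × ℤ)) (a : ℤ × ℤ) (hs : ∀ p ∈ a :: l, s p.1 p.2 = 1)
    (h : (a :: l).IsChain KingStep) : ∀ p ∈ a :: l, (T p.1 p.2 ↔ T a.1 a.2) := by
  induction l generalizing a with
  | nil => simp
  | cons b l ih =>
    rw [List.isChain_cons_cons] at h
    have ih := ih b (fun p hp => hs p (List.mem_cons_of_mem _ hp)) h.2
    obtain ⟨⟨h1, h2, h3, h4⟩, -⟩ := h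
    have sa := hs a (by simp)
    have sb := hs b (by simp)
    intro p hp
    rcases List.mem_cons.1 hp with rfl | hp
    · rfl
    · exact (ih p hp).trans ⟨hT _ _ _ _ sb sa h2 h1 h4 h3, hT _ _ _ _ sa sb h1 h2 h3 h4⟩

/-- This reduces the snake conditions to finite checks. A window whose first three positions are
empty holds at most one cell, so only windows with a listed cell in one of those positions need
testing. The closing edge of the cycle plays no part: the chain gives connectedness and degrees are
tested directly. -/
theorem snake_ofList {k : ℤ} {L : List (ℤ × ℤ)} (a : ℤ × ℤ) (l : List (ℤ × ℤ)) (hL : L = a :: l)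
    (hb : ∀ p ∈ L, 0 ≤ p.1 ∧ p.1 < 2 * k ∧ 0 ≤ p.2 ∧ p.2 < 2 * k)
    (hd : ∀ p ∈ L, kingSum (ofList L) p.1 p.2 = 2)
    (hw : ∀ p ∈ L, ∀ d ∈ [((0 : ℤ), (0 : ℤ)), (0, 1), (1, 0)],
      ofList L (p.1 - d.1) (p.2 - d.2) + ofList L (p.1 - d.1) (p.2 - d.2 + 1) +
      ofList L (p.1 - d.1 + 1) (p.2 - d.2) + ofList L (p.1 - d.1 + 1) (p.2 - d.2 + 1) ≤ 2)
    (hc : L.IsChain KingStep) : Snake k (ofList L) where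
  val := ofList_val _
  out x y h := by
    refine (ofList_val _ x y).resolve_right fun h' => h ?_
    exact hb (x, y) (ofList_eq_one.1 h')
  deg x y h := hd (x, y) (ofList_eq_one.1 h)
  win x y := by
    have v := ofList_val L
    rcases v x y with h1 | h1
    · rcases v x (y + 1) with h2 | h2
      · rcases v (x + 1) y with h3 | h3
        · have := v (x + 1) (y + 1)
          omega
        · have := hw (x + 1, y) (ofList_eq_one.1 h3) (1, 0) (by simp)
          simp only [sub_zero, add_sub_cancel_right] at this
          exact this
      · have := hw (x, y + 1) (ofList_eq_one.1 h2) (0, 1) (by simp)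
        simp only [sub_zero, add_sub_cancel_right] at this
        exact this
    · have := hw (x, y) (ofList_eq_one.1 h1) (0, 0) (by simp)
      simp only [sub_zero] at this
      exact this
  conn T hT x y x' y' h h' t := by
    subst hL
    have key := iff_head_of_isChain hT l a (fun p hp => ofList_eq_one.2 hp) hc
    exact (key (x', y') (ofList_eq_one.1 h')).2 ((key (x, y) (ofList_eq_one.1 h)).1 t)

/-- A snake cycle is not properly contained in another one. -/
theorem Snake.eq_of_le {k : ℤ} {s t : ℤ → ℤ → ℤ} (H : Snake k s) (H' : Snake k t)
    (h : ∀ x y, t x y = 1 → s x y = 1) (hne : ∃ x y, t x y = 1) : s = t := by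
  obtain ⟨a, b, hab⟩ := hne
  have le (x y : ℤ) : t x y ≤ s x y := by
    have := h x y
    have := H'.val x y
    have := H.nonneg x y
    omega
  -- A cell of `t` has both its neighbours in `t`, so it has no other neighbour in `s`.
  have closed : KingClosed s (fun x y => t x y = 1) := by
    intro x y x' y' h1 h2 h3 h4 h5 h6 h7
    have d := H.deg x y h1
    have d' := H'.deg x y h7
    simp only [kingSum] at d d'
    have l1 := le (x - 1) (y - 1)
    have l2 := le (x - 1) y
    have l3 := le (x - 1) (y + 1)
    have l4 := le x (y - 1)
    have l5 := le x (y + 1)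
    have l6 := le (x + 1) (y - 1)
    have l7 := le (x + 1) y
    have l8 := le (x + 1) (y + 1)
    rcases (by omega : x' = x - 1 ∨ x' = x ∨ x' = x + 1) with rfl | rfl | rfl <;>
    rcases (by omega : y' = y - 1 ∨ y' = y ∨ y' = y + 1) with rfl | rfl | rfl <;> omega
  funext x y
  rcases H.val x y with h0 | h0
  · have := le x y
    have := H'.nonneg x y
    omega
  · rw [h0, H.conn _ closed a b x y (h a b hab) h0 hab]

/-- The cycles on the board of side eight. The parameters are the columns of four cells. -/
def smallCycle (p : ℤ × ℤ × ℤ × ℤ) : List (ℤ × ℤ) :=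
  [(2, 2), (1, 2), (0, 1), (1, 0), (2, 0), (3, 0), (4, 0), (5, 0), (6, 0), (7, 1), (7, 2), (7, 3),
    (7, 4), (7, 5), (7, 6), (6, 7), (5, 7), (4, 7), (3, 7), (2, p.1), (1, 7), (0, 6), (0, 5),
    (1, 4), (2, p.2.1), (3, p.2.2.1), (4, 5), (5, 4), (5, 3), (4, 2), (3, p.2.2.2)]

def smallParams : List (ℤ × ℤ × ℤ × ℤ) :=
  [(7, 5, 5, 3), (7, 4, 4, 2), (6, 4, 4, 2), (7, 5, 4, 2), (7, 4, 5, 2), (7, 5, 5, 2)]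

theorem smallCycle_topDefect (p : ℤ × ℤ × ℤ × ℤ) (hp : p ∈ smallParams) :
    TopDefect 4 1 (ofList (smallCycle p)) := by
  have hS : Snake 4 (ofList (smallCycle p)) := by
    refine snake_ofList _ _ rfl ?_ ?_ ?_ ?_
    · revert p; decide +kernel
    · revert p; decide +kernel
    · revert p; decide +kernel
    · revert p; decide +kernel
  have hg : ∀ i ∈ [(0 : ℤ), 1, 2, 3], ∀ j ∈ [(0 : ℤ), 1, 2, 3], (i ≠ 0 ∨ j ≠ 1) →
      blk (ofList (smallCycle p)) i j = 2 := by
    clear hS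
    revert p; decide +kernel
  refine ⟨hS, by norm_num, by norm_num, by norm_num, ?_, ?_, ?_⟩
  · intro i j h1 h2 h3 h4 h5
    refine hg i ?_ j ?_ h5 <;> simp only [List.mem_cons, List.not_mem_nil, or_false] <;> omega
  · clear hS hg
    revert p; decide +kernel
  · clear hS hg
    revert p; decide +kernel

theorem smallCycle_tight (p : ℤ × ℤ × ℤ × ℤ) (hp : p ∈ smallParams) :
    Tight 4 (ofList (smallCycle p)) := by
  have h1 : ∀ x ∈ [(0 : ℤ), 1, 2, 3, 4, 5, 6, 7],
      (ofList (smallCycle p) (x - 1) 0 = 1 ∨ ofList (smallCycle p) x 0 = 1 ∨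
        ofList (smallCycle p) (x + 1) 0 = 1) ∧
      (ofList (smallCycle p) (x - 1) 7 = 1 ∨ ofList (smallCycle p) x 7 = 1 ∨
        ofList (smallCycle p) (x + 1) 7 = 1) ∧
      (ofList (smallCycle p) 7 (x - 1) = 1 ∨ ofList (smallCycle p) 7 x = 1 ∨
        ofList (smallCycle p) 7 (x + 1) = 1) ∧
      (4 ≤ x → ofList (smallCycle p) 0 (x - 1) = 1 ∨ ofList (smallCycle p) 0 x = 1 ∨
        ofList (smallCycle p) 0 (x + 1) = 1) := by
    revert p; decide +kernel
  have h2 (x : ℤ) (h : 0 ≤ x) (h' : x < 2 * 4) := h1 x (by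
    simp only [List.mem_cons, List.not_mem_nil, or_false]; omega)
  exact ⟨fun x h h' => (h2 x h h').1, fun x h h' => (h2 x h h').2.1,
    fun x h h' => (h2 x h h').2.2.1, fun x h h' => (h2 x (by omega) h').2.2.2 h⟩

/-- Degree counts at the two lower inner corners fix the lower half of the inner board, which in
turn straightens the adjacent parts of the border. What is left are the choices between `(3, 2)` and
`(3, 3)`, `(2, 4)` and `(2, 5)`, `(3, 4)` and `(3, 5)`, `(2, 6)` and `(2, 7)`; the constraints `t1`,
`t2`, `t3` allow six combinations. By `Snake.eq_of_le` it is enough to see that the listed cells are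
occupied. -/
theorem TopDefect.exists_smallCycle {s : ℤ → ℤ → ℤ} (D : TopDefect 4 1 s) :
    ∃ p ∈ smallParams, s = ofList (smallCycle p) := by
  have H := D.snake
  have S := D.sides
  have n := H.nonneg
  have r0 := D.row_zero
  have r1 := D.row_one
  have r2 := D.row_two
  have c1 := D.corner_right
  have c2 := D.corner_bottom_left
  have c3 := D.corner_bottom_right
  have g (i j : ℤ) (h : 1 ≤ i ∧ i ≤ 2 ∧ 1 ≤ j ∧ j ≤ 2) : blk s i j = 2 :=
    D.good i j (by omega) (by omega) (by omega) (by omega) (by omega)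
  have b11 := blk_at 2 3 2 3 1 1 _ (g 1 1 (by omega))
  have b12 := blk_at 2 3 4 5 1 2 _ (g 1 2 (by omega))
  have b21 := blk_at 4 5 2 3 2 1 _ (g 2 1 (by omega))
  have b22 := blk_at 4 5 4 5 2 2 _ (g 2 2 (by omega))
  clear g
  have z (x y x' y' : ℤ) (h : s x' y' = 1) (hi : 2 ≤ x' ∧ x' < 6 ∧ 2 ≤ y' ∧ y' < 6)
      (hb : ¬(2 ≤ x ∧ x < 6 ∧ 2 ≤ y ∧ y < 6))
      (hd : x' - x ≤ 1 ∧ x - x' ≤ 1 ∧ y' - y ≤ 1 ∧ y - y' ≤ 1 ∧ x ≠ 1) : s x y = 0 :=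
    D.empty_of_cross h hd.1 hd.2.1 hd.2.2.1 hd.2.2.2.1 hb hi (by omega)
  have v42 := H.val 4 2
  have v43 := H.val 4 3
  have v44 := H.val 4 4
  have v45 := H.val 4 5
  have v52 := H.val 5 2
  have v53 := H.val 5 3
  have v54 := H.val 5 4
  have v55 := H.val 5 5
  have e52 : s 5 2 = 0 := by
    refine v52.resolve_right fun h => ?_
    have d := H.deg_at 4 5 6 1 2 3 h
    rw [z 4 1 5 2 h (by omega) (by omega) (by omega), z 5 1 5 2 h (by omega) (by omega) (by omega),
      z 6 1 5 2 h (by omega) (by omega) (by omega), z 6 2 5 2 h (by omega) (by omega) (by omega),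
      z 6 3 5 2 h (by omega) (by omega) (by omega)] at d
    omega
  have e55 : s 5 5 = 0 := by
    refine v55.resolve_right fun h => ?_
    have d := H.deg_at 4 5 6 4 5 6 h
    rw [z 4 6 5 5 h (by omega) (by omega) (by omega), z 5 6 5 5 h (by omega) (by omega) (by omega),
      z 6 4 5 5 h (by omega) (by omega) (by omega), z 6 5 5 5 h (by omega) (by omega) (by omega),
      z 6 6 5 5 h (by omega) (by omega) (by omega)] at d
    omega
  have w1 := H.win_at 3 4 2 3
  have w2 := H.win_at 3 4 4 5
  have w3 := H.win_at 4 5 3 4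
  have e42 : s 4 2 = 1 := by
    refine v42.resolve_left fun h => ?_
    have h3 : s 5 3 = 1 := by omega
    have d := H.deg_at 4 5 6 2 3 4 h3
    rw [z 6 2 5 3 h3 (by omega) (by omega) (by omega), z 6 3 5 3 h3 (by omega) (by omega) (by omega),
      z 6 4 5 3 h3 (by omega) (by omega) (by omega)] at d
    omega
  have e45 : s 4 5 = 1 := by
    refine v45.resolve_left fun h => ?_
    have h3 : s 5 4 = 1 := by omega
    have d := H.deg_at 4 5 6 3 4 5 h3
    rw [z 6 3 5 4 h3 (by omega) (by omega) (by omega), z 6 4 5 4 h3 (by omega) (by omega) (by omega),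
      z 6 5 5 4 h3 (by omega) (by omega) (by omega)] at d
    omega
  have e53 : s 5 3 = 1 := by
    refine v53.resolve_left fun h => ?_
    have d := H.deg_at 3 4 5 1 2 3 e42
    rw [z 3 1 4 2 e42 (by omega) (by omega) (by omega), z 4 1 4 2 e42 (by omega) (by omega) (by omega),
      z 5 1 4 2 e42 (by omega) (by omega) (by omega)] at d
    omega
  have e54 : s 5 4 = 1 := by
    refine v54.resolve_left fun h => ?_
    have d := H.deg_at 3 4 5 4 5 6 e45
    rw [z 3 6 4 5 e45 (by omega) (by omega) (by omega), z 4 6 4 5 e45 (by omega) (by omega) (by omega),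
      z 5 6 4 5 e45 (by omega) (by omega) (by omega)] at d
    omega
  have l3 := H.left_sum S 3 (by norm_num) (by norm_num)
  have l4 := H.left_sum S 4 (by norm_num) (by norm_num)
  have l5 := H.left_sum S 5 (by norm_num) (by norm_num)
  have q2 := H.right_sum S 2 (by norm_num) (by norm_num)
  have q3 := H.right_sum S 3 (by norm_num) (by norm_num)
  have q4 := H.right_sum S 4 (by norm_num) (by norm_num)
  have q5 := H.right_sum S 5 (by norm_num) (by norm_num)
  have m2 := H.bottom_sum S 2 (by norm_num) (by norm_num)
  have m3 := H.bottom_sum S 3 (by norm_num) (by norm_num)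
  have m4 := H.bottom_sum S 4 (by norm_num) (by norm_num)
  have m5 := H.bottom_sum S 5 (by norm_num) (by norm_num)
  norm_num at c1 c2 c3 q2 q3 q4 q5 m2 m3 m4 m5
  have f3 := z 3 1 4 2 e42 (by omega) (by omega) (by omega)
  have f4 := z 4 1 4 2 e42 (by omega) (by omega) (by omega)
  have f5 := z 5 1 4 2 e42 (by omega) (by omega) (by omega)
  have g3 := z 3 6 4 5 e45 (by omega) (by omega) (by omega)
  have g4 := z 4 6 4 5 e45 (by omega) (by omega) (by omega)
  have g5 := z 5 6 4 5 e45 (by omega) (by omega) (by omega)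
  have i2 := z 6 2 5 3 e53 (by omega) (by omega) (by omega)
  have i3 := z 6 3 5 3 e53 (by omega) (by omega) (by omega)
  have i4 := z 6 4 5 4 e54 (by omega) (by omega) (by omega)
  have i5 := z 6 5 5 4 e54 (by omega) (by omega) (by omega)
  have v26 := H.val 2 6
  have v24 := H.val 2 4
  have v33 := H.val 3 3
  have v34 := H.val 3 4
  have t1 : s 2 5 = 1 → s 2 6 = 0 := fun h => z 2 6 2 5 h (by omega) (by omega) (by omega)
  have t2 : s 3 5 = 1 → s 2 6 = 0 := fun h => z 2 6 3 5 h (by omega) (by omega) (by omega)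
  have t3 : s 3 3 = 1 → s 3 4 + s 2 4 = 0 := by
    intro h
    have := H.deg_at 2 3 4 2 3 4 h
    have := n 2 4
    have := n 3 4
    omega
  clear w1 w2 w3 v42 v43 v44 v45 v52 v53 v54 v55 z
  have fin (p) (hp : p ∈ smallParams) (h1 : s 2 p.1 = 1) (h2 : s 2 p.2.1 = 1)
      (h3 : s 3 p.2.2.1 = 1) (h4 : s 3 p.2.2.2 = 1) : ∃ p ∈ smallParams, s = ofList (smallCycle p) := by
    refine ⟨p, hp, H.eq_of_le (smallCycle_topDefect p hp).snake ?_ ⟨2, 2, ?_⟩⟩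
    · intro x y hxy
      rw [ofList_eq_one] at hxy
      simp only [smallCycle, List.mem_cons, List.not_mem_nil, or_false, Prod.mk.injEq] at hxy
      rcases hxy with h | h | h | h | h | h | h | h | h | h | h | h | h | h | h | h | h | h | h | h |
        h | h | h | h | h | h | h | h | h | h | h <;> rw [h.1, h.2] <;> first | assumption | omega
    · simp [ofList_eq_one, smallCycle]
  rcases v33 with h33 | h33
  · rcases v34 with h34 | h34 <;> rcases v24 with h24 | h24
    · exact fin (7, 5, 5, 2) (by decide) (by show s 2 7 = 1; omega) (by show s 2 5 = 1; omega)
        (by show s 3 5 = 1; omega) (by show s 3 2 = 1; omega)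
    · exact fin (7, 4, 5, 2) (by decide) (by show s 2 7 = 1; omega) (by show s 2 4 = 1; omega)
        (by show s 3 5 = 1; omega) (by show s 3 2 = 1; omega)
    · exact fin (7, 5, 4, 2) (by decide) (by show s 2 7 = 1; omega) (by show s 2 5 = 1; omega)
        (by show s 3 4 = 1; omega) (by show s 3 2 = 1; omega)
    · rcases v26 with h26 | h26
      · exact fin (7, 4, 4, 2) (by decide) (by show s 2 7 = 1; omega) (by show s 2 4 = 1; omega)
          (by show s 3 4 = 1; omega) (by show s 3 2 = 1; omega)
      · exact fin (6, 4, 4, 2) (by decide) (by show s 2 6 = 1; omega) (by show s 2 4 = 1; omega)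
          (by show s 3 4 = 1; omega) (by show s 3 2 = 1; omega)
  · have := n 2 4
    have := n 3 4
    exact fin (7, 5, 5, 3) (by decide) (by show s 2 7 = 1; omega) (by show s 2 5 = 1; omega)
      (by show s 3 5 = 1; omega) (by show s 3 3 = 1; omega)

theorem standard_four : (Standard 4).ncard = 6 ∧ ∀ t ∈ Standard 4, Tight 4 t := by
  have e : Standard 4 = (fun p => ofList (smallCycle p)) '' (smallParams.toFinset : Set _) := by
    ext s
    simp only [Standard, Set.mem_ofPred_eq, Set.mem_image, List.coe_toFinset]
    constructor
    · intro D
      obtain ⟨p, hp, rfl⟩ := D.exists_smallCycle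
      exact ⟨p, hp, rfl⟩
    · rintro ⟨p, hp, rfl⟩
      exact smallCycle_topDefect p hp
  constructor
  · rw [e, Set.InjOn.ncard_image]
    · rw [Set.ncard_coe_finset]
      decide
    · have key : ∀ p ∈ smallParams, ∀ q ∈ smallParams,
          (ofList (smallCycle p) 2 6 = ofList (smallCycle q) 2 6 ∧
          ofList (smallCycle p) 2 4 = ofList (smallCycle q) 2 4 ∧
          ofList (smallCycle p) 3 4 = ofList (smallCycle q) 3 4 ∧
          ofList (smallCycle p) 3 3 = ofList (smallCycle q) 3 3) → p = q := by
        decide +kernel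
      intro p hp q hq h
      simp only [List.coe_toFinset, Set.mem_ofPred_eq] at hp hq
      refine key p hp q hq ?_
      simp only at h
      rw [h]
      exact ⟨rfl, rfl, rfl, rfl⟩
  · rw [e]
    rintro t ⟨p, hp, rfl⟩
    simp only [List.coe_toFinset, Set.mem_ofPred_eq] at hp
    exact smallCycle_tight p hp

theorem standard_ncard (m : ℕ) : (Standard (2 * m + 4)).ncard = 6 ∧
    ∀ t ∈ Standard (2 * m + 4), Tight (2 * m + 4) t := by
  induction m with
  | zero => simpa using standard_four
  | succ m ih =>
    have := standard_step (by omega) ih.2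
    rw [show (2 * ((m + 1 : ℕ) : ℤ) + 4) = 2 * m + 4 + 2 by push_cast; ring]
    exact ⟨this.2.trans ih.1, this.1⟩

/-! ### The eight symmetries acting on indicator functions -/

/-- The symmetries of the board of side `2 * k`: possibly reflect each coordinate, then possibly
exchange the coordinates. -/
def move (k : ℤ) (g : Bool × Bool × Bool) (p : ℤ × ℤ) : ℤ × ℤ :=
  let x := if g.1 then 2 * k - 1 - p.1 else p.1
  let y := if g.2.1 then 2 * k - 1 - p.2 else p.2
  if g.2.2 then (y, x) else (x, y)

/-- The indicator function `s`, moved by a symmetry of the board. -/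
def act (k : ℤ) (g : Bool × Bool × Bool) (s : ℤ → ℤ → ℤ) : ℤ → ℤ → ℤ := fun x y =>
  s (move k g (x, y)).1 (move k g (x, y)).2

theorem act_id (k : ℤ) (s : ℤ → ℤ → ℤ) : act k (false, false, false) s = s := rfl

theorem act_transp (k : ℤ) (s : ℤ → ℤ → ℤ) : act k (false, false, true) s = transp s := rfl

theorem act_reflY (k : ℤ) (c : Bool) (s : ℤ → ℤ → ℤ) :
    act k (false, true, c) s = reflY k (act k (false, false, c) s) := by
  cases c <;> rfl

theorem act_reflX (k : ℤ) (b c : Bool) (s : ℤ → ℤ → ℤ) :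
    act k (true, b, c) s = reflX k (act k (false, b, c) s) := by
  cases b <;> cases c <;> rfl

theorem reflX_reflX (k : ℤ) (s : ℤ → ℤ → ℤ) : reflX k (reflX k s) = s := by
  funext x y
  simp [reflX]

theorem reflY_reflY (k : ℤ) (s : ℤ → ℤ → ℤ) : reflY k (reflY k s) = s := by
  funext x y
  simp [reflY]

theorem transp_transp (s : ℤ → ℤ → ℤ) : transp (transp s) = s := rfl

theorem act_injective (k : ℤ) (g : Bool × Bool × Bool) : Function.Injective (act k g) := by
  have hx : Function.Injective (reflX k) := Function.Involutive.injective (reflX_reflX k)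
  have hy : Function.Injective (reflY k) := Function.Involutive.injective (reflY_reflY k)
  have ht : Function.Injective transp := fun s t h => congrArg transp h
  obtain ⟨a, b, c⟩ := g
  intro s t h
  cases a <;> cases b <;> cases c <;> simp only [act_reflX, act_reflY, act_id, act_transp] at h
  · exact h
  · exact ht h
  · exact hy h
  · exact ht (hy h)
  · exact hx h
  · exact ht (hx h)
  · exact hy (hx h)
  · exact ht (hy (hx h))

/-- A snake cycle all of whose blocks hold two cells, except for the block `(i, j)` which holds
only one. -/
structure DefectAt (k : ℤ) (s : ℤ → ℤ → ℤ) (i j : ℤ) : Prop where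
  snake : Snake k s
  mem : 0 ≤ i ∧ i < k ∧ 0 ≤ j ∧ j < k
  one : blk s i j = 1
  two : ∀ i' j', 0 ≤ i' → i' < k → 0 ≤ j' → j' < k → (i' ≠ i ∨ j' ≠ j) → blk s i' j' = 2

namespace DefectAt

variable {k : ℤ} {s : ℤ → ℤ → ℤ} {i j : ℤ}

theorem reflX (D : DefectAt k s i j) : DefectAt k (reflX k s) (k - 1 - i) j := by
  have := D.mem
  refine ⟨D.snake.reflX, by omega, ?_, fun i' j' h1 h2 h3 h4 h5 => ?_⟩
  · rw [blk_reflX, sub_sub_cancel, D.one]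
  · rw [blk_reflX, D.two _ _ (by omega) (by omega) h3 h4 (by omega)]

theorem reflY (D : DefectAt k s i j) : DefectAt k (reflY k s) i (k - 1 - j) := by
  have := D.mem
  refine ⟨D.snake.reflY, by omega, ?_, fun i' j' h1 h2 h3 h4 h5 => ?_⟩
  · rw [blk_reflY, sub_sub_cancel, D.one]
  · rw [blk_reflY, D.two _ _ h1 h2 (by omega) (by omega) (by omega)]

theorem transp (D : DefectAt k s i j) : DefectAt k (transp s) j i := by
  have := D.mem
  refine ⟨D.snake.transp, by omega, ?_, fun i' j' h1 h2 h3 h4 h5 => ?_⟩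
  · rw [blk_transp, D.one]
  · rw [blk_transp, D.two _ _ h3 h4 h1 h2 h5.symm]

theorem unique (D : DefectAt k s i j) {i' j' : ℤ} (D' : DefectAt k s i' j') : i' = i ∧ j' = j := by
  by_contra h
  have := D.two i' j' D'.mem.1 D'.mem.2.1 D'.mem.2.2.1 D'.mem.2.2.2 (by tauto)
  rw [D'.one] at this
  omega

end DefectAt

theorem TopDefect.defectAt {k : ℤ} {s : ℤ → ℤ → ℤ} (D : TopDefect k 1 s) : DefectAt k s 0 1 := by
  refine ⟨D.snake, ?_, ?_, D.good⟩
  · have := D.four_le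
    omega
  · have h1 := D.colL
    have h2 := D.colR
    simp only [blk]
    norm_num at h1 h2 ⊢
    omega

/-- The defective block of the image of a standard cycle. -/
def defectPos (k : ℤ) (g : Bool × Bool × Bool) : ℤ × ℤ :=
  let p : ℤ × ℤ := if g.2.2 then (1, 0) else (0, 1)
  (if g.1 then k - 1 - p.1 else p.1, if g.2.1 then k - 1 - p.2 else p.2)

/-- The block `(0, 1)` lies on no axis of symmetry of the board, so its eight images are distinct.
This is the source of asymmetry. -/
theorem defectPos_injective {k : ℤ} (hk : 4 ≤ k) : Function.Injective (defectPos k) := by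
  rintro ⟨a, b, c⟩ ⟨a', b', c'⟩ h
  cases a <;> cases b <;> cases c <;> cases a' <;> cases b' <;> cases c' <;>
    simp [defectPos] at h ⊢ <;> omega

theorem DefectAt.act {k : ℤ} {t : ℤ → ℤ → ℤ} (D : DefectAt k t 0 1) (g : Bool × Bool × Bool) :
    DefectAt k (act k g t) (defectPos k g).1 (defectPos k g).2 := by
  obtain ⟨a, b, c⟩ := g
  cases a <;> cases b <;> cases c <;> simp only [act_reflX, act_reflY, act_id, act_transp]
  · exact D
  · exact D.transp
  · exact D.reflY
  · exact D.transp.reflY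
  · exact D.reflX
  · exact D.transp.reflX
  · exact D.reflY.reflX
  · exact D.transp.reflY.reflX

/-- The position of the unique defective block reveals which symmetry was applied. -/
theorem act_eq_act {k : ℤ} {g g' : Bool × Bool × Bool} {t t' : ℤ → ℤ → ℤ} (ht : t ∈ Standard k)
    (ht' : t' ∈ Standard k) (h : act k g t = act k g' t') : g = g' ∧ t = t' := by
  have D : TopDefect k 1 t := ht
  have D' : TopDefect k 1 t' := ht'
  have e := D.defectAt.act g
  rw [h] at e
  have := e.unique (D'.defectAt.act g')
  obtain rfl : g = g' := (defectPos_injective D.four_le (Prod.ext this.1 this.2)).symm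
  exact ⟨rfl, act_injective k g h⟩

/-- The images of the standard cycles under the symmetries of the board. -/
def Extremal (k : ℤ) : Set (ℤ → ℤ → ℤ) := (fun p => act k p.1 p.2) '' (Set.univ ×ˢ Standard k)

theorem mem_extremal {k : ℤ} {s : ℤ → ℤ → ℤ} :
    s ∈ Extremal k ↔ ∃ g, ∃ t ∈ Standard k, act k g t = s := by
  simp [Extremal]

theorem extremal_ncard (k : ℤ) : (Extremal k).ncard = 8 * (Standard k).ncard := by
  rw [Extremal, Set.InjOn.ncard_image, Set.ncard_prod]
  · simp
  · rintro ⟨g, t⟩ ⟨-, ht⟩ ⟨g', t'⟩ ⟨-, ht'⟩ h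
    obtain ⟨rfl, rfl⟩ := act_eq_act ht ht' h
    rfl

theorem standard_subset_extremal {k : ℤ} {s : ℤ → ℤ → ℤ} (h : s ∈ Standard k) : s ∈ Extremal k :=
  mem_extremal.2 ⟨(false, false, false), s, h, rfl⟩

theorem extremal_reflX {k : ℤ} {s : ℤ → ℤ → ℤ} (h : reflX k s ∈ Extremal k) : s ∈ Extremal k := by
  obtain ⟨⟨a, b, c⟩, t, ht, e⟩ := mem_extremal.1 h
  refine mem_extremal.2 ⟨(!a, b, c), t, ht, ?_⟩
  rw [← reflX_reflX k s, ← e]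
  cases a
  · exact act_reflX k b c t
  · rw [act_reflX, reflX_reflX]
    rfl

theorem extremal_transp {k : ℤ} {s : ℤ → ℤ → ℤ} (h : transp s ∈ Extremal k) : s ∈ Extremal k := by
  obtain ⟨⟨a, b, c⟩, t, ht, e⟩ := mem_extremal.1 h
  refine mem_extremal.2 ⟨(b, a, !c), t, ht, ?_⟩
  rw [← transp_transp s, ← e]
  cases a <;> cases b <;> cases c <;> rfl

theorem extremal_reflY {k : ℤ} {s : ℤ → ℤ → ℤ} (h : reflY k s ∈ Extremal k) : s ∈ Extremal k := by
  refine extremal_transp (extremal_reflX (extremal_transp ?_))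
  exact h

theorem DefectAt.mem_extremal_of_top {k : ℤ} {s : ℤ → ℤ → ℤ} {j : ℤ} (hk : 4 ≤ k)
    (D : DefectAt k s 0 j) : s ∈ Extremal k := by
  have key {s : ℤ → ℤ → ℤ} {j : ℤ} (D : DefectAt k s 0 j) (h : s 0 (2 * j) + s 1 (2 * j) = 1)
      (h' : s 0 (2 * j + 1) + s 1 (2 * j + 1) = 0) : s ∈ Extremal k := by
    have T : TopDefect k j s := ⟨D.snake, hk, D.mem.2.2.1, D.mem.2.2.2, D.two, h, h'⟩
    obtain rfl := T.eq_one
    exact standard_subset_extremal T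
  have e := blk_at 0 1 (2 * j) (2 * j + 1) 0 j 1 D.one
  have n := D.snake.nonneg
  have n1 := n 0 (2 * j)
  have n2 := n 1 (2 * j)
  have n3 := n 0 (2 * j + 1)
  have n4 := n 1 (2 * j + 1)
  by_cases h : s 0 (2 * j) + s 1 (2 * j) = 1
  · exact key D h (by omega)
  -- Here the single cell is in the right column of the block; reflection exchanges the columns.
  · refine extremal_reflY (key D.reflY ?_ ?_) <;> simp only [_root_.reflY]
    · rw [show 2 * k - 1 - 2 * (k - 1 - j) = 2 * j + 1 by ring]
      omega
    · rw [show 2 * k - 1 - (2 * (k - 1 - j) + 1) = 2 * j by ring]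
      omega

theorem DefectAt.mem_extremal {k : ℤ} {s : ℤ → ℤ → ℤ} {i j : ℤ} (hk : 4 ≤ k)
    (D : DefectAt k s i j) : s ∈ Extremal k := by
  by_cases h : i = 0 ∨ i = k - 1 ∨ j = 0 ∨ j = k - 1
  · rcases h with rfl | rfl | rfl | rfl
    · exact D.mem_extremal_of_top hk
    · have D' := D.reflX
      rw [sub_self] at D'
      exact extremal_reflX (D'.mem_extremal_of_top hk)
    · exact extremal_transp (D.transp.mem_extremal_of_top hk)
    · have D' := D.reflY.transp
      rw [sub_self] at D'
      exact extremal_reflY (extremal_transp (D'.mem_extremal_of_top hk))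
  -- A defect away from the border would leave all border blocks full.
  · exfalso
    refine D.snake.border_not_full (by omega) ?_ fun i' j' h1 h2 h3 h4 h5 =>
      D.two i' j' h1 h2 h3 h4 (by omega)
    by_cases h11 : i = 1 ∧ j = 1
    · obtain ⟨rfl, rfl⟩ := h11
      rw [D.one]
    · rw [D.two 1 1 (by omega) (by omega) (by omega) (by omega) (by omega)]
      norm_num

theorem exists_defectAt_of_mem_extremal {k : ℤ} {s : ℤ → ℤ → ℤ} (h : s ∈ Extremal k) :
    ∃ i j, DefectAt k s i j := by
  obtain ⟨g, t, ht, rfl⟩ := mem_extremal.1 h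
  exact ⟨_, _, (TopDefect.defectAt ht).act g⟩

/-! ### Counting cells by blocks -/

/-- The number of cells on the board of side `2 * K`. -/
def cellCount (K : ℕ) (s : ℤ → ℤ → ℤ) : ℤ :=
  ∑ x ∈ Finset.range (2 * K), ∑ y ∈ Finset.range (2 * K), s x y

theorem sum_range_two_mul (f : ℕ → ℤ) (K : ℕ) :
    ∑ x ∈ Finset.range (2 * K), f x = ∑ i ∈ Finset.range K, (f (2 * i) + f (2 * i + 1)) := by
  induction K with
  | zero => simp
  | succ K ih =>
    rw [show 2 * (K + 1) = 2 * K + 1 + 1 by ring, Finset.sum_range_succ, Finset.sum_range_succ, ih,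
      Finset.sum_range_succ, add_assoc]

theorem cellCount_eq (K : ℕ) (s : ℤ → ℤ → ℤ) :
    cellCount K s = ∑ p ∈ Finset.range K ×ˢ Finset.range K, blk s p.1 p.2 := by
  rw [cellCount, sum_range_two_mul, Finset.sum_product]
  refine Finset.sum_congr rfl fun i _ => ?_
  rw [sum_range_two_mul, sum_range_two_mul, ← Finset.sum_add_distrib]
  refine Finset.sum_congr rfl fun j _ => ?_
  simp only [blk]
  push_cast
  ring

theorem sum_deficit (K : ℕ) (s : ℤ → ℤ → ℤ) :
    ∑ p ∈ Finset.range K ×ˢ Finset.range K, (2 - blk s p.1 p.2) = 2 * K ^ 2 - cellCount K s := by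
  rw [Finset.sum_sub_distrib, cellCount_eq]
  simp
  ring

theorem Snake.blk_le {k : ℤ} {s : ℤ → ℤ → ℤ} (H : Snake k s) (i j : ℤ) : blk s i j ≤ 2 := by
  have := H.win (2 * i) (2 * j)
  simp only [blk]
  exact this

theorem Snake.cellCount_le {K : ℕ} {s : ℤ → ℤ → ℤ} (hK : 4 ≤ K) (H : Snake K s) :
    cellCount K s ≤ 2 * K ^ 2 - 1 := by
  have h := sum_deficit K s
  have h0 : ∀ p ∈ Finset.range K ×ˢ Finset.range K, 0 ≤ 2 - blk s p.1 p.2 := fun p _ =>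
    sub_nonneg.2 (H.blk_le _ _)
  have h1 := Finset.sum_nonneg h0
  by_contra hc
  have h2 : ∑ p ∈ Finset.range K ×ˢ Finset.range K, (2 - blk s p.1 p.2) = 0 := by omega
  rw [Finset.sum_eq_zero_iff_of_nonneg h0] at h2
  have all (i j : ℤ) (h1 : 0 ≤ i) (h1' : i < K) (h3 : 0 ≤ j) (h3' : j < K) : blk s i j = 2 := by
    lift i to ℕ using h1
    lift j to ℕ using h3
    have := h2 (i, j) (by simp; omega)
    simp only at this
    omega
  refine H.border_not_full (by omega) ?_ fun i j h1 h2 h3 h4 _ => all i j h1 h2 h3 h4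
  rw [all 1 1 (by omega) (by omega) (by omega) (by omega)]
  norm_num

theorem Snake.exists_defectAt {K : ℕ} {s : ℤ → ℤ → ℤ} (H : Snake K s)
    (hc : cellCount K s = 2 * K ^ 2 - 1) : ∃ i j, DefectAt K s i j := by
  have h := sum_deficit K s
  -- The deficits `2 - blk` are nonnegative integers with sum `1`, so exactly one of them is `1`.
  rw [hc, sub_sub_cancel] at h
  have h0 : ∀ p ∈ Finset.range K ×ˢ Finset.range K, 0 ≤ 2 - blk s p.1 p.2 := fun p _ =>
    sub_nonneg.2 (H.blk_le _ _)
  obtain ⟨p, hp, hne⟩ := Finset.exists_ne_zero_of_sum_ne_zero (h.trans_ne one_ne_zero)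
  have hsum := Finset.add_sum_erase _ (fun p : ℕ × ℕ => 2 - blk s p.1 p.2) hp
  have h0' : ∀ q ∈ (Finset.range K ×ˢ Finset.range K).erase p, 0 ≤ 2 - blk s q.1 q.2 :=
    fun q hq => h0 q (Finset.mem_of_mem_erase hq)
  have h1 := Finset.sum_nonneg h0'
  have h2 := h0 p hp
  have h3 : ∑ q ∈ (Finset.range K ×ˢ Finset.range K).erase p, (2 - blk s q.1 q.2) = 0 := by omega
  rw [Finset.sum_eq_zero_iff_of_nonneg h0'] at h3
  simp only [Finset.mem_product, Finset.mem_range] at hp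
  refine ⟨p.1, p.2, H, by omega, by omega, ?_⟩
  intro i j h1 h1' h2 h2' hij
  lift i to ℕ using h1
  lift j to ℕ using h2
  have := h3 (i, j) (by
    simp only [Finset.mem_erase, Finset.mem_product, Finset.mem_range, ne_eq, Prod.ext_iff]
    omega)
  simp only at this
  omega

theorem DefectAt.cellCount_eq {K : ℕ} {s : ℤ → ℤ → ℤ} {i j : ℤ} (D : DefectAt K s i j) :
    cellCount K s = 2 * K ^ 2 - 1 := by
  have h := sum_deficit K s
  have m := D.mem
  have h1 : ∑ p ∈ Finset.range K ×ˢ Finset.range K, (2 - blk s p.1 p.2) = 1 := by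
    rw [Finset.sum_eq_single (i.toNat, j.toNat)]
    · rw [Int.toNat_of_nonneg m.1, Int.toNat_of_nonneg m.2.2.1, D.one]
      norm_num
    · intro p hp hne
      simp only [Finset.mem_product, Finset.mem_range, ne_eq, Prod.ext_iff] at hp hne
      rw [D.two p.1 p.2 (by omega) (by omega) (by omega) (by omega) (by omega), sub_self]
    · intro hn
      simp only [Finset.mem_product, Finset.mem_range] at hn
      omega
  omega

/-! ### Translation between subgraphs and indicator functions -/

open Classical in
/-- The indicator function of the vertex set of a subgraph of a king graph. -/
noncomputable def ind {A : Set (ℤ × ℤ)} (C : (kingGraph A).Subgraph) : ℤ → ℤ → ℤ := fun x y =>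
  if ∃ h : (x, y) ∈ A, (⟨(x, y), h⟩ : A) ∈ C.verts then 1 else 0

section Ind

variable {A : Set (ℤ × ℤ)} {C D : (kingGraph A).Subgraph}

theorem ind_eq_one {x y : ℤ} : ind C x y = 1 ↔ ∃ h : (x, y) ∈ A, (⟨(x, y), h⟩ : A) ∈ C.verts := by
  simp [ind]

theorem ind_coe (v : A) : ind C v.1.1 v.1.2 = 1 ↔ v ∈ C.verts := by
  rw [ind_eq_one]
  exact ⟨fun ⟨_, h⟩ => h, fun h => ⟨v.2, h⟩⟩

theorem ind_val (C : (kingGraph A).Subgraph) (x y : ℤ) : ind C x y = 0 ∨ ind C x y = 1 := by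
  simp only [ind]
  split_ifs <;> simp

theorem ind_out {x y : ℤ} (h : (x, y) ∉ A) : ind C x y = 0 := by
  simp [ind, h]

theorem adj_iff_of_isInduced (hC : C.IsInduced) (v w : A) :
    C.Adj v w ↔ v ∈ C.verts ∧ w ∈ C.verts ∧ (kingGraph A).Adj v w :=
  ⟨fun h => ⟨C.edge_vert h, C.edge_vert h.symm, C.adj_sub h⟩, fun h => hC h.1 h.2.1 h.2.2⟩

theorem ind_injOn : Set.InjOn (ind (A := A)) {C | C.IsInduced} := by
  intro C hC D hD h
  have hv : C.verts = D.verts := by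
    ext v
    rw [← ind_coe, ← ind_coe, h]
  refine SimpleGraph.Subgraph.ext hv ?_
  funext v w
  rw [adj_iff_of_isInduced hC, adj_iff_of_isInduced hD, hv]

theorem kingGraph_adj_iff (v w : A) : (kingGraph A).Adj v w ↔ v ≠ w ∧ w.1.1 - v.1.1 ≤ 1 ∧
    v.1.1 - w.1.1 ≤ 1 ∧ w.1.2 - v.1.2 ≤ 1 ∧ v.1.2 - w.1.2 ≤ 1 := by
  simp only [kingGraph, abs_le, ne_eq, and_congr_right_iff]
  intro _
  constructor
  · rintro ⟨⟨_, _⟩, _, _⟩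
    omega
  · rintro ⟨_, _, _, _⟩
    omega

/-- The eight king neighbours of a cell. -/
def kingNbrs (x y : ℤ) : Finset (ℤ × ℤ) :=
  {(x - 1, y - 1), (x - 1, y), (x - 1, y + 1), (x, y - 1), (x, y + 1), (x + 1, y - 1), (x + 1, y),
    (x + 1, y + 1)}

theorem sum_kingNbrs (s : ℤ → ℤ → ℤ) (x y : ℤ) :
    ∑ p ∈ kingNbrs x y, s p.1 p.2 = kingSum s x y := by
  have e : x - 1 ≠ x + 1 := by omega
  have e' : y - 1 ≠ y + 1 := by omega
  rw [kingNbrs, Finset.sum_insert, Finset.sum_insert, Finset.sum_insert, Finset.sum_insert,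
    Finset.sum_insert, Finset.sum_insert, Finset.sum_insert, Finset.sum_singleton]
  · simp only [kingSum]
    ring
  all_goals
    simp only [Finset.mem_insert, Finset.mem_singleton, Prod.mk.injEq]
    omega

theorem mem_kingNbrs {x y x' y' : ℤ} : (x', y') ∈ kingNbrs x y ↔ (x', y') ≠ (x, y) ∧
    x' - x ≤ 1 ∧ x - x' ≤ 1 ∧ y' - y ≤ 1 ∧ y - y' ≤ 1 := by
  simp only [kingNbrs, Finset.mem_insert, Finset.mem_singleton, Prod.mk.injEq, ne_eq]
  omega

theorem kingSum_eq_card (s : ℤ → ℤ → ℤ) (hs : ∀ x y, s x y = 0 ∨ s x y = 1) (x y : ℤ) :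
    kingSum s x y = ((kingNbrs x y).filter fun p => s p.1 p.2 = 1).card := by
  rw [← sum_kingNbrs, Finset.card_filter]
  push_cast
  refine Finset.sum_congr rfl fun p _ => ?_
  rcases hs p.1 p.2 with h | h <;> simp [h]

theorem ncard_neighborSet (hC : C.IsInduced) {v : A} (hv : v ∈ C.verts) :
    ((C.neighborSet v).ncard : ℤ) = kingSum (ind C) v.1.1 v.1.2 := by
  rw [kingSum_eq_card _ (ind_val C), ← Set.ncard_image_of_injective _ Subtype.val_injective,
    ← Set.ncard_coe_finset]
  congr 2
  ext ⟨x, y⟩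
  simp only [Set.mem_image, SimpleGraph.Subgraph.mem_neighborSet, adj_iff_of_isInduced hC,
    Finset.coe_filter, Set.mem_ofPred_eq, mem_kingNbrs, kingGraph_adj_iff, ind_eq_one]
  constructor
  · rintro ⟨w, ⟨-, hw, hne, h⟩, e⟩
    obtain rfl : w.1.1 = x := by rw [e]
    obtain rfl : w.1.2 = y := by rw [e]
    exact ⟨⟨fun h => hne (Subtype.ext h.symm), h⟩, w.2, hw⟩
  · rintro ⟨⟨hne, h⟩, hA, hw⟩
    refine ⟨⟨(x, y), hA⟩, ⟨hv, hw, ?_, h⟩, rfl⟩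
    rintro rfl
    exact hne rfl

/-- Handshake lemma: all degrees are `2`, so twice the number of edges is twice the number of
vertices. -/
theorem cycleLength_eq_ncard (hC : IsCycleSubgraph C) : cycleLength C = C.verts.ncard := by
  classical
  obtain ⟨hf, -, hd⟩ := hC
  have := hf.fintype
  have h := C.coe.sum_degrees_eq_twice_card_edges
  have hdeg (v : C.verts) [Fintype (C.coe.neighborSet v)] : C.coe.degree v = 2 := by
    rw [← hd v v.2, ← SimpleGraph.card_neighborSet_eq_degree, ← Nat.card_eq_fintype_card,
      Nat.card_coe_set_eq, ← Set.ncard_image_of_injective _ Subtype.val_injective]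
    congr 1
    ext w
    simp only [Set.mem_image, SimpleGraph.mem_neighborSet, SimpleGraph.Subgraph.coe_adj,
      SimpleGraph.Subgraph.mem_neighborSet]
    constructor
    · rintro ⟨w, h, rfl⟩
      exact h
    · intro h
      exact ⟨⟨w, C.edge_vert h.symm⟩, h, rfl⟩
  simp only [hdeg, Finset.sum_const, Finset.card_univ, smul_eq_mul] at h
  have e : cycleLength C = C.coe.edgeFinset.card := by
    rw [cycleLength, ← SimpleGraph.Subgraph.image_coe_edgeSet_coe,
      Set.ncard_image_of_injective _ (Sym2.map.injective Subtype.val_injective),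
      ← SimpleGraph.coe_edgeFinset, Set.ncard_coe_finset]
  have e2 : C.verts.ncard = Fintype.card C.verts := by
    rw [← Nat.card_coe_set_eq, Nat.card_eq_fintype_card]
  omega

theorem kingClosed_const (hC : C.Connected) (T : ℤ → ℤ → Prop)
    (hT : KingClosed (ind C) T) (x y x' y' : ℤ) (h : ind C x y = 1) (h' : ind C x' y' = 1)
    (t : T x y) : T x' y' := by
  obtain ⟨hA, hv⟩ := ind_eq_one.1 h
  obtain ⟨hA', hv'⟩ := ind_eq_one.1 h'
  have key (u v : C.verts) (p : C.coe.Walk u v) (hu : T u.1.1.1 u.1.1.2) : T v.1.1.1 v.1.1.2 := by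
    induction p with
    | nil => exact hu
    | cons hadj _ ih =>
      refine ih ?_
      have a := (kingGraph_adj_iff _ _).1 (C.adj_sub (SimpleGraph.Subgraph.coe_adj _ _ _ ▸ hadj))
      exact hT _ _ _ _ ((ind_coe _).2 (Subtype.property _)) ((ind_coe _).2 (Subtype.property _))
        a.2.1 a.2.2.1 a.2.2.2.1 a.2.2.2.2 hu
  obtain ⟨p⟩ := hC.coe.preconnected ⟨_, hv⟩ ⟨_, hv'⟩
  exact key _ _ p t

end Ind

theorem mem_board {K : ℕ} {x y : ℤ} : (x, y) ∈ standardBoard (2 * K) (2 * K) ↔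
    0 ≤ x ∧ x < 2 * K ∧ 0 ≤ y ∧ y < 2 * K := by
  simp only [standardBoard, Set.mem_prod, Set.mem_Ico]
  push_cast
  tauto

theorem board_finite (m n : ℕ) : (standardBoard m n).Finite :=
  (Set.finite_Ico _ _).prod (Set.finite_Ico _ _)

section Board

variable {K : ℕ} {C D : (kingGraph (standardBoard (2 * K) (2 * K))).Subgraph}

theorem ncard_verts (C : (kingGraph (standardBoard (2 * K) (2 * K))).Subgraph) :
    (C.verts.ncard : ℤ) = cellCount K (ind C) := by
  classical
  have e : ((fun p : ℕ × ℕ => ((p.1 : ℤ), (p.2 : ℤ))) ''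
      ((Finset.range (2 * K) ×ˢ Finset.range (2 * K)).filter fun p => ind C p.1 p.2 = 1 :
        Finset (ℕ × ℕ))) = Subtype.val '' C.verts := by
    ext ⟨x, y⟩
    simp only [Set.mem_image, Finset.coe_filter, Set.mem_ofPred_eq, Finset.mem_product,
      Finset.mem_range, Prod.mk.injEq]
    constructor
    · rintro ⟨⟨a, b⟩, ⟨-, h⟩, rfl, rfl⟩
      obtain ⟨hA, hv⟩ := ind_eq_one.1 h
      exact ⟨_, hv, rfl⟩
    · rintro ⟨⟨⟨a, b⟩, hA⟩, hv, h⟩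
      have hb := mem_board.1 hA
      simp only [Prod.mk.injEq] at h
      obtain ⟨rfl, rfl⟩ := h
      refine ⟨(a.toNat, b.toNat), ⟨by simp only; omega, ?_⟩, by simp only; omega, by simp only; omega⟩
      rw [Int.toNat_of_nonneg hb.1, Int.toNat_of_nonneg hb.2.2.1]
      exact ind_eq_one.2 ⟨hA, hv⟩
  rw [← Set.ncard_image_of_injective _ Subtype.val_injective, ← e, Set.ncard_image_of_injective,
    Set.ncard_coe_finset, Finset.card_filter, cellCount, Finset.sum_product]
  · push_cast
    refine Finset.sum_congr rfl fun x _ => Finset.sum_congr rfl fun y _ => ?_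
    rcases ind_val C x y with h | h <;> simp [h]
  · intro p q h
    simpa [Prod.ext_iff] using h

theorem kingSum_ind (hC : IsSnakeCycle C) {x y : ℤ} (h : ind C x y = 1) :
    kingSum (ind C) x y = 2 := by
  obtain ⟨hA, hv⟩ := ind_eq_one.1 h
  rw [← ncard_neighborSet hC.2 hv, hC.1.2.2 _ hv]
  norm_num

/-- A snake cycle with three cells in a two by two window has no other cells. -/
theorem window_closed (s : ℤ → ℤ → ℤ) (hs : ∀ x y, s x y = 0 ∨ s x y = 1)
    (hd : ∀ x y, s x y = 1 → kingSum s x y = 2) (a b : ℤ)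
    (h : 3 ≤ s a b + s a (b + 1) + s (a + 1) b + s (a + 1) (b + 1)) :
    KingClosed s fun x y => (x = a ∨ x = a + 1) ∧ (y = b ∨ y = b + 1) := by
  intro x y x' y' h1 h2 h3 h4 h5 h6 hT
  by_contra hT'
  have d := hd x y h1
  have le (u v : ℤ) : s u v ≤ 1 := by have := hs u v; omega
  have nn (u v : ℤ) : 0 ≤ s u v := by have := hs u v; omega
  have p1 := le a b
  have p2 := le a (b + 1)
  have p3 := le (a + 1) b
  have p4 := le (a + 1) (b + 1)
  -- A cell of the window has at least two neighbours inside it; a neighbour outside would be a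
  -- third.
  have key : 3 ≤ ∑ p ∈ kingNbrs x y, s p.1 p.2 := by
    have hmem : (x', y') ∈ kingNbrs x y := by
      rw [mem_kingNbrs]
      refine ⟨?_, h3, h4, h5, h6⟩
      rintro ⟨⟩
      exact hT' hT
    have hsub : insert (x', y') ((({a, a + 1} : Finset ℤ) ×ˢ {b, b + 1}).erase (x, y)) ⊆
        kingNbrs x y := by
      intro p hp
      rcases Finset.mem_insert.1 hp with rfl | hp
      · exact hmem
      · rw [Finset.mem_erase, Finset.mem_product] at hp
        simp only [Finset.mem_insert, Finset.mem_singleton] at hp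
        rw [← Prod.mk.eta (p := p), mem_kingNbrs]
        exact ⟨hp.1, by omega, by omega, by omega, by omega⟩
    have hle := Finset.sum_le_sum_of_subset_of_nonneg (f := fun p : ℤ × ℤ => s p.1 p.2) hsub
      fun p _ _ => nn _ _
    rw [Finset.sum_insert] at hle
    · have e := Finset.add_sum_erase (({a, a + 1} : Finset ℤ) ×ˢ {b, b + 1})
        (fun p : ℤ × ℤ => s p.1 p.2) (a := (x, y)) (by
          simp only [Finset.mem_product, Finset.mem_insert, Finset.mem_singleton]
          exact hT)
      rw [Finset.sum_product, Finset.sum_pair (by omega), Finset.sum_pair (by omega),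
        Finset.sum_pair (by omega)] at e
      simp only at e hle
      omega
    · intro h
      have := (Finset.mem_product.1 (Finset.mem_of_mem_erase h))
      simp only [Finset.mem_insert, Finset.mem_singleton] at this
      exact hT' this
  rw [sum_kingNbrs] at key
  omega

/-- A window with three cells would contain the whole cycle by `window_closed`, but it has room for
four cells only. -/
theorem snake_ind (hC : IsSnakeCycle C) (h5 : 5 ≤ C.verts.ncard) : Snake K (ind C) where
  val := ind_val C
  out x y h := ind_out fun h' => h (mem_board.1 h')
  deg x y h := kingSum_ind hC h
  conn := kingClosed_const hC.1.2.1
  win a b := by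
    by_contra hc
    have cl := window_closed (ind C) (ind_val C) (fun x y h => kingSum_ind hC h) a b (by omega)
    have start : ∃ x y, ind C x y = 1 ∧ (x = a ∨ x = a + 1) ∧ (y = b ∨ y = b + 1) := by
      by_contra! hno
      have := hno a b
      have := hno a (b + 1)
      have := hno (a + 1) b
      have := hno (a + 1) (b + 1)
      have := ind_val C a b
      have := ind_val C a (b + 1)
      have := ind_val C (a + 1) b
      have := ind_val C (a + 1) (b + 1)
      omega
    obtain ⟨x, y, hxy, hT⟩ := start
    have sub : Subtype.val '' C.verts ⊆ ((({a, a + 1} : Finset ℤ) ×ˢ {b, b + 1} : Finset (ℤ × ℤ)) :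
        Set (ℤ × ℤ)) := by
      rintro _ ⟨v, hv, rfl⟩
      have := kingClosed_const hC.1.2.1 _ cl x y v.1.1 v.1.2 hxy ((ind_coe v).2 hv) hT
      simp only [Finset.coe_product, Set.mem_prod, Finset.mem_coe, Finset.mem_insert,
        Finset.mem_singleton]
      exact this
    have := Set.ncard_le_ncard sub (Finset.finite_toSet _)
    rw [Set.ncard_image_of_injective _ Subtype.val_injective, Set.ncard_coe_finset,
      Finset.card_product] at this
    have c1 := Finset.card_le_two (a := a) (b := a + 1)
    have c2 := Finset.card_le_two (a := b) (b := b + 1)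
    nlinarith

theorem Snake.exists_subgraph {s : ℤ → ℤ → ℤ} (H : Snake K s) (hne : ∃ x y, s x y = 1) :
    ∃ C : (kingGraph (standardBoard (2 * K) (2 * K))).Subgraph, IsSnakeCycle C ∧ ind C = s := by
  let V : Set (standardBoard (2 * K) (2 * K)) := {v | s v.1.1 v.1.2 = 1}
  let C : (kingGraph (standardBoard (2 * K) (2 * K))).Subgraph :=
    (⊤ : (kingGraph (standardBoard (2 * K) (2 * K))).Subgraph).induce V
  have hI : C.IsInduced := fun v hv w hw h => ⟨hv, hw, h⟩
  have hs : ind C = s := by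
    funext x y
    rcases H.val x y with h | h
    · rw [h]
      refine (ind_val C x y).resolve_right fun h' => ?_
      obtain ⟨_, hv⟩ := ind_eq_one.1 h'
      have : s x y = 1 := hv
      omega
    · rw [h, ind_eq_one]
      exact ⟨mem_board.2 (H.inside h), h⟩
  refine ⟨C, ⟨⟨?_, ⟨?_⟩, ?_⟩, hI⟩, hs⟩
  · have : Finite (standardBoard (2 * K) (2 * K)) := board_finite _ _
    exact Set.toFinite _
  · rw [SimpleGraph.connected_iff]
    constructor
    · intro u v
      have hu : s u.1.1.1 u.1.1.2 = 1 := u.2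
      have hv : s v.1.1.1 v.1.1.2 = 1 := v.2
      let T : ℤ → ℤ → Prop := fun x y => ∃ w : C.verts, w.1.1 = (x, y) ∧ C.coe.Reachable u w
      have hT : KingClosed s T := by
        rintro x y x' y' h1 h2 h3 h4 h5 h6 ⟨w, hw, hr⟩
        let w' : C.verts := ⟨⟨(x', y'), mem_board.2 (H.inside h2)⟩, h2⟩
        refine ⟨w', rfl, ?_⟩
        by_cases e : w = w'
        · rwa [← e]
        · refine hr.trans (SimpleGraph.Adj.reachable ?_)
          rw [SimpleGraph.Subgraph.coe_adj]
          refine hI w.2 w'.2 ((kingGraph_adj_iff _ _).2 ⟨fun h => e (Subtype.ext h), ?_⟩)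
          rw [hw]
          exact ⟨h3, h4, h5, h6⟩
      obtain ⟨w, hw, hr⟩ := H.conn T hT _ _ _ _ hu hv ⟨u, rfl, SimpleGraph.Reachable.refl u⟩
      have : w = v := Subtype.ext (Subtype.ext hw)
      rwa [← this]
    · obtain ⟨x, y, h⟩ := hne
      exact ⟨⟨⟨(x, y), mem_board.2 (H.inside h)⟩, h⟩⟩
  · intro v hv
    have := ncard_neighborSet hI hv
    rw [hs, H.deg _ _ hv] at this
    exact_mod_cast this

theorem cycleLength_eq_cellCount (hC : IsSnakeCycle C) :
    (cycleLength C : ℤ) = cellCount K (ind C) := by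
  rw [cycleLength_eq_ncard hC.1, ncard_verts]

theorem cycleLength_le (hK : 4 ≤ K) (hC : IsSnakeCycle C) : cycleLength C ≤ 2 * K ^ 2 - 1 := by
  have h16 : 16 ≤ K ^ 2 := by nlinarith
  by_cases h5 : 5 ≤ C.verts.ncard
  · have := (snake_ind hC h5).cellCount_le hK
    have e := cycleLength_eq_cellCount hC
    zify [show 1 ≤ 2 * K ^ 2 by omega]
    omega
  · rw [cycleLength_eq_ncard hC.1]
    omega

theorem exists_of_mem_extremal (hK : 4 ≤ K) {s : ℤ → ℤ → ℤ} (h : s ∈ Extremal K) :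
    ∃ C : (kingGraph (standardBoard (2 * K) (2 * K))).Subgraph, IsSnakeCycle C ∧
      cycleLength C = 2 * K ^ 2 - 1 ∧ ind C = s := by
  obtain ⟨i, j, D⟩ := exists_defectAt_of_mem_extremal h
  have hne : ∃ x y, s x y = 1 := by
    by_contra! hno
    have h0 (x y : ℤ) : s x y = 0 := (D.snake.val x y).resolve_right (hno x y)
    have := D.one
    simp [blk, h0] at this
  obtain ⟨C, hC, e⟩ := D.snake.exists_subgraph hne
  refine ⟨C, hC, ?_, e⟩
  have h1 := cycleLength_eq_cellCount hC
  rw [e, D.cellCount_eq] at h1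
  have h16 : 16 ≤ K ^ 2 := by nlinarith
  zify [show 1 ≤ 2 * K ^ 2 by omega]
  exact h1

theorem ind_mem_extremal (hK : 4 ≤ K) (hC : IsSnakeCycle C) (h : cycleLength C = 2 * K ^ 2 - 1) :
    ind C ∈ Extremal K := by
  have h16 : 16 ≤ K ^ 2 := by nlinarith
  have H := snake_ind hC (by rw [← cycleLength_eq_ncard hC.1]; omega)
  have e := cycleLength_eq_cellCount hC
  rw [h] at e
  push_cast [show 1 ≤ 2 * K ^ 2 by omega] at e
  obtain ⟨i, j, D⟩ := H.exists_defectAt e.symm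
  exact D.mem_extremal (by exact_mod_cast hK)

theorem isLongest_iff (hK : 4 ≤ K) (hne : (Extremal K).Nonempty) :
    IsLongestSnakeCycle C ↔ IsSnakeCycle C ∧ ind C ∈ Extremal K := by
  constructor
  · rintro ⟨hC, hm⟩
    refine ⟨hC, ind_mem_extremal hK hC (le_antisymm (cycleLength_le hK hC) ?_)⟩
    obtain ⟨s, hs⟩ := hne
    obtain ⟨D, hD, hl, -⟩ := exists_of_mem_extremal hK hs
    rw [← hl]
    exact hm D hD
  · rintro ⟨hC, hm⟩
    refine ⟨hC, fun D hD => ?_⟩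
    obtain ⟨C', hC', hl, e⟩ := exists_of_mem_extremal hK hm
    obtain rfl := ind_injOn hC'.2 hC.2 e
    rw [hl]
    exact cycleLength_le hK hD

theorem image_longest (hK : 4 ≤ K) (hne : (Extremal K).Nonempty) :
    ind '' {C : (kingGraph (standardBoard (2 * K) (2 * K))).Subgraph | IsLongestSnakeCycle C} =
      Extremal K := by
  ext s
  constructor
  · rintro ⟨C, hC, rfl⟩
    exact ((isLongest_iff hK hne).1 hC).2
  · intro hs
    obtain ⟨C, hC, -, rfl⟩ := exists_of_mem_extremal hK hs
    exact ⟨C, (isLongest_iff hK hne).2 ⟨hC, hs⟩, rfl⟩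

end Board

/-! ### Board symmetries as isometries of the plane -/

/-- The symmetry of the board which applies `g` first and `h` second. -/
def moveComp (h g : Bool × Bool × Bool) : Bool × Bool × Bool :=
  if g.2.2 then (xor g.1 h.2.1, xor g.2.1 h.1, !h.2.2) else (xor g.1 h.1, xor g.2.1 h.2.1, h.2.2)

/-- The inverse of a symmetry of the board. -/
def moveInv (g : Bool × Bool × Bool) : Bool × Bool × Bool :=
  if g.2.2 then (g.2.1, g.1, true) else g

theorem move_move (k : ℤ) (h g : Bool × Bool × Bool) (p : ℤ × ℤ) :
    move k h (move k g p) = move k (moveComp h g) p := by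
  obtain ⟨a, b, c⟩ := g
  obtain ⟨a', b', c'⟩ := h
  cases a <;> cases b <;> cases c <;> cases a' <;> cases b' <;> cases c' <;>
    simp [move, moveComp]

theorem moveComp_eq_left {h g : Bool × Bool × Bool} (e : moveComp h g = h) :
    g = (false, false, false) := by
  revert h g
  decide

theorem moveInv_comp (g : Bool × Bool × Bool) : moveComp (moveInv g) g = (false, false, false) := by
  revert g
  decide

theorem comp_moveInv (g : Bool × Bool × Bool) : moveComp g (moveInv g) = (false, false, false) := by
  revert g
  decide

theorem act_act (k : ℤ) (h g : Bool × Bool × Bool) (s : ℤ → ℤ → ℤ) :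
    act k g (act k h s) = act k (moveComp h g) s := by
  funext x y
  simp only [act, ← move_move]

theorem move_mem {K : ℕ} (g : Bool × Bool × Bool) {p : ℤ × ℤ}
    (hp : p ∈ standardBoard (2 * K) (2 * K)) : move K g p ∈ standardBoard (2 * K) (2 * K) := by
  obtain ⟨x, y⟩ := p
  obtain ⟨a, b, c⟩ := g
  have := mem_board.1 hp
  cases a <;> cases b <;> cases c <;> refine mem_board.2 ?_ <;>
    simp only [if_true, if_false, Bool.false_eq_true] <;> omega

/-- The permutation of the cells of the board given by a symmetry. -/
def movePerm (K : ℕ) (g : Bool × Bool × Bool) : Equiv.Perm (standardBoard (2 * K) (2 * K)) where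
  toFun a := ⟨move K g a.1, move_mem g a.2⟩
  invFun a := ⟨move K (moveInv g) a.1, move_mem _ a.2⟩
  left_inv a := Subtype.ext ((move_move _ _ _ _).trans (by rw [moveInv_comp]; rfl))
  right_inv a := Subtype.ext ((move_move _ _ _ _).trans (by rw [comp_moveInv]; rfl))

/-- The extension of `move` to the plane. -/
noncomputable def planeMove (k : ℤ) (g : Bool × Bool × Bool) (p : EuclideanSpace ℝ (Fin 2)) :
    EuclideanSpace ℝ (Fin 2) :=
  let x := if g.1 then 2 * k - 1 - p 0 else p 0
  let y := if g.2.1 then 2 * k - 1 - p 1 else p 1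
  if g.2.2 then !₂[y, x] else !₂[x, y]

theorem planeMove_isometry (k : ℤ) (g : Bool × Bool × Bool) : Isometry (planeMove k g) := by
  refine Isometry.of_dist_eq fun p q => ?_
  rw [EuclideanSpace.dist_eq, EuclideanSpace.dist_eq, Fin.sum_univ_two, Fin.sum_univ_two]
  obtain ⟨a, b, c⟩ := g
  cases a <;> cases b <;> cases c <;>
    simp [planeMove, dist_sub_left, -dist_sub_eq_dist_add_right, -dist_sub_eq_dist_add_left,
      add_comm]

theorem planeMove_planeMove (k : ℤ) (h g : Bool × Bool × Bool) (p : EuclideanSpace ℝ (Fin 2)) :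
    planeMove k h (planeMove k g p) = planeMove k (moveComp h g) p := by
  obtain ⟨a, b, c⟩ := g
  obtain ⟨a', b', c'⟩ := h
  cases a <;> cases b <;> cases c <;> cases a' <;> cases b' <;> cases c' <;>
    simp [planeMove, moveComp]

theorem planeMove_id (k : ℤ) (p : EuclideanSpace ℝ (Fin 2)) :
    planeMove k (false, false, false) p = p := by
  ext i
  fin_cases i <;> simp [planeMove]

theorem planeMove_cellPoint (k : ℤ) (g : Bool × Bool × Bool) (p : ℤ × ℤ) :
    planeMove k g (cellPoint p) = cellPoint (move k g p) := by
  obtain ⟨a, b, c⟩ := g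
  cases a <;> cases b <;> cases c <;> simp [planeMove, cellPoint, move]

theorem movePerm_isBoardSymmetry (K : ℕ) (g : Bool × Bool × Bool) :
    IsBoardSymmetry (movePerm K g) := by
  refine ⟨⟨⟨planeMove K g, planeMove K (moveInv g), fun p => ?_, fun p => ?_⟩,
    planeMove_isometry K g⟩, fun a => planeMove_cellPoint K g a.1⟩
  · rw [planeMove_planeMove, moveInv_comp, planeMove_id]
  · rw [planeMove_planeMove, comp_moveInv, planeMove_id]

theorem IsBoardSymmetry.sq_dist {A : Set (ℤ × ℤ)} {σ : Equiv.Perm A} (h : IsBoardSymmetry σ)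
    (p q : A) : ((σ p).1.1 - (σ q).1.1) ^ 2 + ((σ p).1.2 - (σ q).1.2) ^ 2 =
      (p.1.1 - q.1.1) ^ 2 + (p.1.2 - q.1.2) ^ 2 := by
  obtain ⟨f, hf⟩ := h
  have e := f.isometry.dist_eq (cellPoint p) (cellPoint q)
  rw [hf, hf, EuclideanSpace.dist_eq, EuclideanSpace.dist_eq, Fin.sum_univ_two, Fin.sum_univ_two,
    Real.sqrt_inj (by positivity) (by positivity)] at e
  simp only [cellPoint, Real.dist_eq, sq_abs] at e
  have e' : (((σ p).1.1 - (σ q).1.1 : ℤ) : ℝ) ^ 2 + (((σ p).1.2 - (σ q).1.2 : ℤ) : ℝ) ^ 2 =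
      ((p.1.1 - q.1.1 : ℤ) : ℝ) ^ 2 + ((p.1.2 - q.1.2 : ℤ) : ℝ) ^ 2 := by
    push_cast
    simpa using e
  exact_mod_cast e'

/-- Each coordinate difference is at most `N` in absolute value, so the squared distance `2N²` is
attained only when both equal `N`. -/
theorem opposite_of_sq {N a b c d : ℤ} (ha : 0 ≤ a) (ha' : a ≤ N) (hb : 0 ≤ b) (hb' : b ≤ N)
    (hc : 0 ≤ c) (hc' : c ≤ N) (hd : 0 ≤ d) (hd' : d ≤ N)
    (h : (a - c) ^ 2 + (b - d) ^ 2 = N ^ 2 + N ^ 2) :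
    (a = 0 ∧ c = N ∨ a = N ∧ c = 0) ∧ (b = 0 ∧ d = N ∨ b = N ∧ d = 0) := by
  have h1 : (a - c) ^ 2 ≤ N ^ 2 := sq_le_sq' (by omega) (by omega)
  have h2 : (b - d) ^ 2 ≤ N ^ 2 := sq_le_sq' (by omega) (by omega)
  have h3 := sq_eq_sq_iff_eq_or_eq_neg.1 (show (a - c) ^ 2 = N ^ 2 by omega)
  have h4 := sq_eq_sq_iff_eq_or_eq_neg.1 (show (b - d) ^ 2 = N ^ 2 by omega)
  omega

theorem exists_move_corners {k N o1 o2 x1 x2 z1 z2 : ℤ} (hN : N = 2 * k - 1)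
    (h1 : o1 = 0 ∧ z1 = N ∨ o1 = N ∧ z1 = 0) (h2 : o2 = 0 ∧ z2 = N ∨ o2 = N ∧ z2 = 0)
    (hx : x1 = o1 ∧ x2 = z2 ∨ x1 = z1 ∧ x2 = o2) :
    ∃ g, (o1 = (move k g (0, 0)).1 ∧ o2 = (move k g (0, 0)).2) ∧
      (x1 = (move k g (N, 0)).1 ∧ x2 = (move k g (N, 0)).2) ∧
      (z1 = (move k g (N, N)).1 ∧ z2 = (move k g (N, N)).2) := by
  rcases h1 with ⟨h1, h1'⟩ | ⟨h1, h1'⟩ <;> rcases h2 with ⟨h2, h2'⟩ | ⟨h2, h2'⟩ <;>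
    rcases hx with ⟨h3, h3'⟩ | ⟨h3, h3'⟩ <;> subst h3 h3' h1 h1' h2 h2'
  · exact ⟨(false, false, true), by simp [move]⟩
  · exact ⟨(false, false, false), by simp [move]⟩
  · exact ⟨(true, false, true), by simp [move, hN]⟩
  · exact ⟨(false, true, false), by simp [move, hN]⟩
  · exact ⟨(false, true, true), by simp [move, hN]⟩
  · exact ⟨(true, false, false), by simp [move, hN]⟩
  · exact ⟨(true, true, true), by simp [move, hN]⟩
  · exact ⟨(true, true, false), by simp [move, hN]⟩

/-- Distances force diagonally opposite corners to go to diagonally opposite corners, so the images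
of `O`, `X`, `Z` agree with those under some `move`. The squared distances to these three corners
then determine the image of every cell: their differences are linear in its coordinates, with the
nonzero factor `N`. -/
theorem IsBoardSymmetry.exists_move {K : ℕ} (hK : 0 < K)
    {σ : Equiv.Perm (standardBoard (2 * K) (2 * K))} (h : IsBoardSymmetry σ) :
    ∃ g, ∀ a, (σ a).1 = move K g a.1 := by
  have bd (a : standardBoard (2 * K) (2 * K)) : 0 ≤ a.1.1 ∧ a.1.1 < 2 * K ∧ 0 ≤ a.1.2 ∧
      a.1.2 < 2 * K := mem_board.1 a.2
  obtain ⟨N, hN⟩ : ∃ N : ℤ, N = 2 * K - 1 := ⟨_, rfl⟩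
  let O : standardBoard (2 * K) (2 * K) := ⟨(0, 0), mem_board.2 (by omega)⟩
  let X : standardBoard (2 * K) (2 * K) := ⟨(N, 0), mem_board.2 (by omega)⟩
  let Y : standardBoard (2 * K) (2 * K) := ⟨(0, N), mem_board.2 (by omega)⟩
  let Z : standardBoard (2 * K) (2 * K) := ⟨(N, N), mem_board.2 (by omega)⟩
  have dOZ := h.sq_dist O Z
  have dXY := h.sq_dist X Y
  have dOX := h.sq_dist O X
  have bO := bd (σ O)
  have bX := bd (σ X)
  have bY := bd (σ Y)
  have bZ := bd (σ Z)
  have lin (p : standardBoard (2 * K) (2 * K)) := h.sq_dist p O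
  have linX (p : standardBoard (2 * K) (2 * K)) := h.sq_dist p X
  have linZ (p : standardBoard (2 * K) (2 * K)) := h.sq_dist p Z
  simp only [O, X, Y, Z] at dOZ dXY dOX lin linX linZ
  generalize (σ O).1 = o at *
  generalize (σ X).1 = x at *
  generalize (σ Y).1 = y at *
  generalize (σ Z).1 = z at *
  obtain ⟨o1, o2⟩ := o
  obtain ⟨x1, x2⟩ := x
  obtain ⟨y1, y2⟩ := y
  obtain ⟨z1, z2⟩ := z
  simp only at *
  have hOZ := opposite_of_sq (N := N) bO.1 (by omega) bO.2.2.1 (by omega) bZ.1 (by omega)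
    bZ.2.2.1 (by omega) (by rw [dOZ]; ring)
  have hXY := opposite_of_sq (N := N) bX.1 (by omega) bX.2.2.1 (by omega) bY.1 (by omega)
    bY.2.2.1 (by omega) (by rw [dXY]; ring)
  have hN0 : N ≠ 0 := by omega
  obtain ⟨hOZ1, hOZ2⟩ := hOZ
  obtain ⟨hXY1, hXY2⟩ := hXY
  have fin {g : Bool × Bool × Bool} (hg : ∀ u v x y : ℤ,
      (u - o1) ^ 2 + (v - o2) ^ 2 = (x - 0) ^ 2 + (y - 0) ^ 2 →
      (u - x1) ^ 2 + (v - x2) ^ 2 = (x - N) ^ 2 + (y - 0) ^ 2 →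
      (u - z1) ^ 2 + (v - z2) ^ 2 = (x - N) ^ 2 + (y - N) ^ 2 →
      N * (u - (move K g (x, y)).1) = 0 ∧ N * (v - (move K g (x, y)).2) = 0) :
      ∃ g, ∀ a, (σ a).1 = move K g a.1 := by
    refine ⟨g, fun a => ?_⟩
    obtain ⟨e1, e2⟩ := hg _ _ _ _ (lin a) (linX a) (linZ a)
    have e1 := (mul_eq_zero.1 e1).resolve_left hN0
    have e2 := (mul_eq_zero.1 e2).resolve_left hN0
    exact Prod.ext (sub_eq_zero.1 e1) (sub_eq_zero.1 e2)
  clear lin linX linZ bd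
  have key {g : Bool × Bool × Bool} (hO : o1 = (move K g (0, 0)).1 ∧ o2 = (move K g (0, 0)).2)
      (hX : x1 = (move K g (N, 0)).1 ∧ x2 = (move K g (N, 0)).2)
      (hZ : z1 = (move K g (N, N)).1 ∧ z2 = (move K g (N, N)).2) :
      ∃ g, ∀ a, (σ a).1 = move K g a.1 := by
    refine fin (g := g) fun u v x y e1 e2 e3 => ?_
    rw [hO.1, hO.2] at e1
    rw [hX.1, hX.2] at e2
    rw [hZ.1, hZ.2] at e3
    clear * - e1 e2 e3 hN
    obtain ⟨a, b, c⟩ := g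
    cases a <;> cases b <;> cases c <;> simp only [move, if_true, if_false, Bool.false_eq_true,
      ← hN] at e1 e2 e3 ⊢ <;> constructor <;> linarith
  -- The images of `O` and `X` are corners at squared distance `N²`, not `0` or `2N²`, so they share
  -- exactly one coordinate.
  have hsw : o1 = x1 ∧ o2 ≠ x2 ∨ o1 ≠ x1 ∧ o2 = x2 := by
    have hN2 : 0 < N ^ 2 := by have := sq_nonneg N; have := pow_ne_zero 2 hN0; omega
    by_cases e1 : o1 = x1 <;> by_cases e2 : o2 = x2
    · rw [e1, e2] at dOX
      simp only [sub_self] at dOX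
      rw [zero_sub, neg_sq] at dOX
      omega
    · exact Or.inl ⟨e1, e2⟩
    · exact Or.inr ⟨e1, e2⟩
    · have s1 : (o1 - x1) ^ 2 = N ^ 2 := sq_eq_sq_iff_eq_or_eq_neg.2 (by omega)
      have s2 : (o2 - x2) ^ 2 = N ^ 2 := sq_eq_sq_iff_eq_or_eq_neg.2 (by omega)
      rw [s1, s2, sub_self, zero_sub, neg_sq] at dOX
      omega
  clear fin
  obtain ⟨g, hO, hX, hZ⟩ := exists_move_corners hN hOZ1 hOZ2
    (show x1 = o1 ∧ x2 = z2 ∨ x1 = z1 ∧ x2 = o2 by omega)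
  exact key hO hX hZ

/-! ### Asymmetry and the number of classes -/

section Board

variable {K : ℕ} {C D : (kingGraph (standardBoard (2 * K) (2 * K))).Subgraph}
  {σ : Equiv.Perm (standardBoard (2 * K) (2 * K))}

theorem CarriesOnto.ind_eq (h : CarriesOnto σ C D) {g : Bool × Bool × Bool}
    (hg : ∀ a, (σ a).1 = move K g a.1) : ind C = act K g (ind D) := by
  have hmem (x y : ℤ) : ind C x y = 1 ↔ act K g (ind D) x y = 1 := by
    constructor
    · intro hx
      obtain ⟨hA, hv⟩ := ind_eq_one.1 hx
      have := (ind_coe _).2 ((h.1 _).2 hv)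
      rwa [hg] at this
    · intro hx
      obtain ⟨hA, -⟩ := ind_eq_one.1 hx
      have hA' := move_mem (moveInv g) hA
      rw [move_move, moveInv_comp] at hA'
      have hA' : (x, y) ∈ standardBoard (2 * K) (2 * K) := hA'
      refine (ind_coe ⟨(x, y), hA'⟩).2 ((h.1 _).1 ((ind_coe _).1 ?_))
      rw [hg]
      exact hx
  funext x y
  have := hmem x y
  rcases ind_val C x y with h1 | h1 <;>
    rcases ind_val D (move K g (x, y)).1 (move K g (x, y)).2 with h2 | h2 <;>
    simp only [act] at this ⊢ <;> omega

theorem kingGraph_adj_movePerm (g : Bool × Bool × Bool)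
    (v w : standardBoard (2 * K) (2 * K)) :
    (kingGraph _).Adj (movePerm K g v) (movePerm K g w) ↔ (kingGraph _).Adj v w := by
  rw [kingGraph_adj_iff, kingGraph_adj_iff, (movePerm K g).injective.ne_iff, and_congr_right_iff]
  intro _
  obtain ⟨a, b, c⟩ := g
  cases a <;> cases b <;> cases c <;>
    simp only [movePerm, Equiv.coe_fn_mk, move, if_true, if_false, Bool.false_eq_true] <;> omega

theorem carriesOnto_movePerm (hC : C.IsInduced) (hD : D.IsInduced) {g : Bool × Bool × Bool}
    (h : ind C = act K g (ind D)) : CarriesOnto (movePerm K g) C D := by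
  have hv (v : standardBoard (2 * K) (2 * K)) : movePerm K g v ∈ D.verts ↔ v ∈ C.verts := by
    rw [← ind_coe, ← ind_coe, h]
    rfl
  refine ⟨hv, fun v w => ?_⟩
  rw [adj_iff_of_isInduced hC, adj_iff_of_isInduced hD, hv, hv, kingGraph_adj_movePerm]

theorem IsLongestSnakeCycle.isAsymmetric (hK : 4 ≤ K) (hne : (Extremal K).Nonempty)
    (hC : IsLongestSnakeCycle C) : IsAsymmetric C := by
  intro σ hσ hc
  obtain ⟨g, hg⟩ := hσ.exists_move (by omega)
  obtain ⟨h, t, ht, e⟩ := mem_extremal.1 ((isLongest_iff hK hne).1 hC).2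
  have e' := hc.ind_eq hg
  rw [← e, act_act] at e'
  -- Both `h` and `moveComp h g` carry the same standard cycle to `ind C`, so they coincide and `g`
  -- is the identity.
  obtain rfl := moveComp_eq_left (act_eq_act ht ht e').1.symm
  exact Equiv.ext fun a => Subtype.ext (hg a)

/-- Each class contains exactly one standard cycle: every extremal cycle is an image of one, and by
`act_eq_act` no symmetry joins two different ones. -/
theorem card_essential (hK : 4 ≤ K) (hne : (Extremal K).Nonempty) :
    Nat.card (EssentialLongestSnakeCycles (standardBoard (2 * K) (2 * K))) =
      (Standard K).ncard := by
  have ex (t : Standard K) : ∃ C : (kingGraph (standardBoard (2 * K) (2 * K))).Subgraph,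
      IsLongestSnakeCycle C ∧ ind C = t := by
    have := standard_subset_extremal t.2
    rwa [← image_longest hK hne] at this
  choose F hF hi using ex
  rw [← Nat.card_coe_set_eq]
  symm
  refine Nat.card_congr (Equiv.ofBijective
    (fun t => Quotient.mk ((symmetrySetoid _).comap Subtype.val) ⟨F t, hF t⟩) ⟨?_, ?_⟩)
  · intro t t' h
    obtain ⟨σ, hσ, hc⟩ := Quotient.exact h
    obtain ⟨g, hg⟩ := hσ.exists_move (by omega)
    have e := hc.ind_eq hg
    simp only [hi] at e
    exact Subtype.ext (act_eq_act (g := (false, false, false)) t.2 t'.2 e).2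
  · intro q
    induction q using Quotient.inductionOn with
    | h C =>
      obtain ⟨C, hC⟩ := C
      obtain ⟨h, t, ht, e⟩ := mem_extremal.1 ((isLongest_iff hK hne).1 hC).2
      refine ⟨⟨t, ht⟩, Eq.symm (Quotient.sound ?_)⟩
      refine ⟨movePerm K h, movePerm_isBoardSymmetry K h, ?_⟩
      refine carriesOnto_movePerm hC.1.2 (hF _).1.2 ?_
      rw [hi, e]

end Board

theorem theorem5 (n : ℕ) (hmod : n ≡ 0 [MOD 4]) (hn : 8 ≤ n) :
    IsGreatest {l : ℕ | ∃ C : (kingGraph (standardBoard n n)).Subgraph,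
        IsSnakeCycle C ∧ cycleLength C = l} (n ^ 2 / 2 - 1) ∧
      {C : (kingGraph (standardBoard n n)).Subgraph | IsLongestSnakeCycle C}.ncard = 48 ∧
      (∀ C : (kingGraph (standardBoard n n)).Subgraph,
        IsLongestSnakeCycle C → IsAsymmetric C) ∧
      Nat.card (EssentialLongestSnakeCycles (standardBoard n n)) = 6 := by
  -- Divisibility of `n` by `4` makes `n / 2` even, which the induction in steps of two from `4`
  -- requires.
  obtain ⟨m, hm⟩ : ∃ m : ℕ, n = 2 * (2 * m + 4) :=
    ⟨n / 4 - 2, by have := Nat.modEq_zero_iff_dvd.1 hmod; omega⟩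
  obtain ⟨K, hKm⟩ : ∃ K, K = 2 * m + 4 := ⟨_, rfl⟩
  rw [← hKm] at hm
  subst hm
  have hK : 4 ≤ K := by omega
  have h6 : (Standard K).ncard = 6 := by
    rw [hKm]
    exact_mod_cast (standard_ncard m).1
  have h48 := extremal_ncard K
  rw [h6] at h48
  have hne : (Extremal (K : ℤ)).Nonempty := Set.nonempty_of_ncard_ne_zero (by omega)
  have hl : (2 * K) ^ 2 / 2 - 1 = 2 * K ^ 2 - 1 := by
    rw [show (2 * K) ^ 2 = 2 * (2 * K ^ 2) by ring, Nat.mul_div_cancel_left _ two_pos]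
  refine ⟨⟨?_, ?_⟩, ?_, fun C hC => hC.isAsymmetric hK hne, ?_⟩
  · obtain ⟨s, hs⟩ := hne
    obtain ⟨C, hC, hlen, -⟩ := exists_of_mem_extremal hK hs
    exact ⟨C, hC, by rw [hlen, hl]⟩
  · rintro _ ⟨C, hC, rfl⟩
    rw [hl]
    exact cycleLength_le hK hC
  · rw [show 48 = 8 * 6 from rfl, ← h48, ← image_longest hK hne, Set.InjOn.ncard_image]
    exact ind_injOn.mono fun C hC => hC.1.2
  · rw [card_essential hK hne, h6]
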